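/- **Proposition (nonemptiness of parametric grammars).** Let $\sigma$ be a vocabulary of function and relation symbols and let $\mathfrak S=(D;I)$ be a $\sigma$-structure with nonempty (finite or infinite) universe $D$. Fix disjoint countably infinite sets $\mathcal C$ of uninterpreted constants (parameters), $\mathcal V$ of local variables, and of nonterminals. A quantifier-free formula of $T=T_{\mathfrak S}$ is a Boolean combination of atomic formulas (equality included) over $\sigma$, $\mathcal C$ and $\mathcal V$; it is satisfiable if it holds in $\mathfrak S$ for some interpretations $X:\mathcal C\to D$ and $Y:\mathcal V\to D$. Formulas are encoded as words over a fixed finite alphabet, where symbols of $\sigma$ are written by means of an arbitrary fixed injective naming by bit strings, and parameters, variables and nonterminals are written as bit strings. A parametric grammar $G$ over $T$ consists of a start nonterminal $S$ and a finite list of productions $(A,\alpha,\varphi)$, where $A$ is a nonterminal, $\alpha$ is a finite sequence of nonterminals, local variables and parameters, and $\varphi$ is a quantifier-free formula of $T$. For an interpretation $X$ of the parameters, $L_X(G)\subseteq D^*$ is the set of nonterminal-free words derivable from $S$, where a step replaces one occurrence of $A$ by $\alpha[X,Y]$ (parameters and local variables replaced by their values) for some production $(A,\alpha,\varphi)$ and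 some interpretation $Y$ of the local variables, chosen afresh in each step, such that $\varphi(X,Y)$ holds in $\mathfrak S$. Let $L(G)=\bigcup_X L_X(G)$. If the satisfiability problem for quantifier-free formulas of $T$ is in NP (respectively PSPACE), then the problem of deciding, given a parametric grammar $G$ over $T$, whether $L(G)\neq\emptyset$ is in NP (respectively PSPACE). -/

import Mathlib

universe u v w

/-! ### Complexity classes, on Mathlib's multi-stack Turing machines -/

namespace Complexity

open Classical in
/-- `P`: the languages over the (finite) alphabet `Γ` whose characteristic function is computed by a
deterministic machine in polynomial time. -/
def PTIME (Γ : Type) : Set (Language Γ) :=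
  {A | Nonempty (Turing.TM2ComputableInPolyTime (id : List Γ → List Γ) Computability.encodeBool
    (fun x => decide (x ∈ A)))}

/-- The pair of an input `x` and a certificate `w` as one word. -/
def withCertificate {Γ : Type} (x : List Γ) (w : List Bool) : List (Γ ⊕ Bool) :=
  x.map Sum.inl ++ w.map Sum.inr

/-- `NP`: the languages with a polynomial-time verifier for certificates of polynomial length. -/
def NP (Γ : Type) : Set (Language Γ) :=
  {A | ∃ R ∈ PTIME (Γ ⊕ Bool), ∃ q : Polynomial ℕ, ∀ x : List Γ,
    x ∈ A ↔ ∃ w : List Bool, w.length ≤ q.eval x.length ∧ withCertificate x w ∈ R}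

/-- The space that a configuration occupies: the total height of all the stacks. -/
def cfgSpace (tm : Turing.FinTM2) (c : tm.Cfg) : ℕ :=
  ∑ k ∈ @Finset.univ tm.K tm.kFin, (c.stk k).length

open Classical in
/-- `PSPACE`: the languages over the (finite) alphabet `Γ` whose characteristic function is computed
by a deterministic machine that halts on every input and occupies polynomial space in every
configuration that it reaches. -/
def PSPACE (Γ : Type) : Set (Language Γ) :=
  {A | ∃ M : Turing.TM2Computable (id : List Γ → List Γ) Computability.encodeBool
      (fun x => decide (x ∈ A)),
    ∃ p : Polynomial ℕ, ∀ (x : List Γ) (c : M.tm.Cfg),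
      StateTransition.Reaches M.tm.step
        (Turing.initList M.tm (x.map M.inputAlphabet.invFun)) c →
      cfgSpace M.tm c ≤ p.eval x.length}

end Complexity

namespace ParametricGrammar

/-- Names of parameters (uninterpreted constants), of local variables and of nonterminals. The three
kinds of names are kept apart by the constructors under which they occur. -/
abbrev Ident : Type := List Bool

/-- Formulas over the vocabulary `L`; a free variable `Sum.inl a` is the parameter (uninterpreted
constant) `a`, and `Sum.inr y` is the local variable `y`. -/
abbrev GuardFormula (L : FirstOrder.Language.{u, v}) : Type (max u v) := L.Formula (Ident ⊕ Ident)

/-- A production `(A, α, φ)`. A terminal `Sum.inl a` of the right-hand side is the parameter `a`,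
and `Sum.inr y` is the local variable `y`. -/
structure Production (L : FirstOrder.Language.{u, v}) where
  lhs : Ident
  rhs : List (Symbol (Ident ⊕ Ident) Ident)
  guard : GuardFormula L
  guard_isQF : guard.IsQF

/-- A parametric grammar over the vocabulary `L`. Its finite sets of parameters and of nonterminals
are those whose names occur in it. -/
structure Grammar (L : FirstOrder.Language.{u, v}) where
  start : Ident
  productions : List (Production L)

section Semantics

variable {L : FirstOrder.Language.{u, v}} {D : Type w} [L.Structure D]

/-- Substitution of the values of the parameters and of the local variables in a symbol. -/
def instSymbol (X Y : Ident → D) : Symbol (Ident ⊕ Ident) Ident → Symbol D Ident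
  | Symbol.terminal t => Symbol.terminal (Sum.elim X Y t)
  | Symbol.nonterminal A => Symbol.nonterminal A

/-- The rewriting rule `A → α[X, Y]` obtained from a production. -/
def Production.inst (r : Production L) (X Y : Ident → D) : ContextFreeRule D Ident :=
  ⟨r.lhs, r.rhs.map (instSymbol X Y)⟩

/-- One derivation step, for the interpretation `X` of the parameters. The local variables are
interpreted afresh in each step. -/
def Grammar.Produces (G : Grammar L) (X : Ident → D) (u v : List (Symbol D Ident)) : Prop :=
  ∃ r ∈ G.productions, ∃ Y : Ident → D,
    r.guard.Realize (Sum.elim X Y) ∧ (r.inst X Y).Rewrites u v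

/-- `L_X(G)`. -/
def Grammar.languageAt (G : Grammar L) (X : Ident → D) : Language D :=
  {word | Relation.ReflTransGen (G.Produces X) [Symbol.nonterminal G.start]
    (word.map Symbol.terminal)}

/-- `L(G)`, the union of all `L_X(G)`. -/
def Grammar.language (G : Grammar L) (D : Type w) [L.Structure D] : Language D :=
  ⋃ X : Ident → D, G.languageAt X

/-- Satisfiability in the structure `D`. -/
def Satisfiable (φ : GuardFormula L) (D : Type w) [L.Structure D] : Prop :=
  ∃ X Y : Ident → D, φ.Realize (Sum.elim X Y)

end Semantics

/-! ### Formulas and grammars as words over a finite alphabet -/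

/-- The alphabet in which formulas and grammars are written. -/
inductive Tok
  | bit (b : Bool)
  | fin
  | param
  | loc
  | bound
  | func
  | rel
  | eq
  | bot
  | imp
  | all
  | lpar
  | rpar
  | nonterm
  | rule
  | guard
  deriving DecidableEq, Fintype

/-- A terminated bit string. -/
def encodeIdent (a : List Bool) : List Tok := a.map Tok.bit ++ [Tok.fin]

/-- An injective naming of the vocabulary symbols by bit strings. The two maps also see the arities,
so that the name of a symbol determines its arity. -/
structure SymbolCoding (L : FirstOrder.Language.{u, v}) where
  funcCode : (Σ n, L.Functions n) → List Bool
  relCode : (Σ n, L.Relations n) → List Bool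
  funcCode_injective : Function.Injective funcCode
  relCode_injective : Function.Injective relCode

section Encoding

variable {L : FirstOrder.Language.{u, v}} (c : SymbolCoding L)

/-- A parameter or a local variable. -/
def encodeAtom : Ident ⊕ Ident → List Tok
  | Sum.inl a => Tok.param :: encodeIdent a
  | Sum.inr y => Tok.loc :: encodeIdent y

/-- Terms in prefix notation. -/
def encodeTerm {n : ℕ} : L.Term ((Ident ⊕ Ident) ⊕ Fin n) → List Tok
  | FirstOrder.Language.Term.var (Sum.inl a) => encodeAtom a
  | FirstOrder.Language.Term.var (Sum.inr i) =>
      Tok.bound :: encodeIdent (List.replicate i.val true)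
  | FirstOrder.Language.Term.func (l := k) f ts =>
      Tok.func :: encodeIdent (c.funcCode ⟨k, f⟩) ++
        (List.ofFn fun i => encodeTerm (ts i)).flatten

/-- Formulas in parenthesized prefix notation. The clause for quantifiers makes the function total;
it is not used on quantifier-free formulas. -/
def encodeFormula : {n : ℕ} → L.BoundedFormula (Ident ⊕ Ident) n → List Tok
  | _, FirstOrder.Language.BoundedFormula.falsum => [Tok.lpar, Tok.bot, Tok.rpar]
  | _, FirstOrder.Language.BoundedFormula.equal t₁ t₂ =>
      [Tok.lpar, Tok.eq] ++ encodeTerm c t₁ ++ encodeTerm c t₂ ++ [Tok.rpar]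
  | _, FirstOrder.Language.BoundedFormula.rel (l := k) R ts =>
      [Tok.lpar, Tok.rel] ++ encodeIdent (c.relCode ⟨k, R⟩) ++
        (List.ofFn fun i => encodeTerm c (ts i)).flatten ++ [Tok.rpar]
  | _, FirstOrder.Language.BoundedFormula.imp φ ψ =>
      [Tok.lpar, Tok.imp] ++ encodeFormula φ ++ encodeFormula ψ ++ [Tok.rpar]
  | _, FirstOrder.Language.BoundedFormula.all φ =>
      [Tok.lpar, Tok.all] ++ encodeFormula φ ++ [Tok.rpar]

/-- A symbol of a right-hand side. -/
def encodeSymbol : Symbol (Ident ⊕ Ident) Ident → List Tok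
  | Symbol.terminal t => encodeAtom t
  | Symbol.nonterminal A => Tok.nonterm :: encodeIdent A

def encodeProduction (r : Production L) : List Tok :=
  Tok.rule :: encodeIdent r.lhs ++ r.rhs.flatMap encodeSymbol ++
    Tok.guard :: encodeFormula c r.guard

def encodeGrammar (G : Grammar L) : List Tok :=
  encodeIdent G.start ++ G.productions.flatMap (encodeProduction c)

/-- The satisfiability problem of the quantifier-free theory of the structure `D`. -/
def satProblem (D : Type w) [L.Structure D] : Language Tok :=
  {x | ∃ φ : GuardFormula L, φ.IsQF ∧ encodeFormula c φ = x ∧ Satisfiable φ D}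

/-- The nonemptiness problem of parametric grammars over the theory of the structure `D`. -/
def nonemptinessProblem (D : Type w) [L.Structure D] : Language Tok :=
  {x | ∃ G : Grammar L, encodeGrammar c G = x ∧ Set.Nonempty (G.language D : Set (List D))}

end Encoding

end ParametricGrammar

/-!
Annotate the text of a grammar with marks that guess which productions are used. Some word is
derivable by the marked productions if and only if the start symbol is productive for them, which a
number of scans of the text decides, regardless of the guards. Since the local variables are
interpreted afresh in each step, all marked guards are satisfied by a common interpretation of the
parameters if and only if the conjunction of the guards, with the local variables renamed apart, is
satisfiable. So nonemptiness is the projection, along the marks, of the preimage of satisfiability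
under a polynomial-time function. Both NP and PSPACE are closed under such projections and
preimages.
-/

/-! ### Programs for stack machines -/

namespace StackProgram

open Turing TM2 Function

section Basic

variable {K : Type} {Γ : K → Type} {σ Λ Λ' : Type}

/-- The total height of a family of stacks. -/
def height [Fintype K] (S : ∀ k, List (Γ k)) : ℕ := ∑ k, (S k).length

/-- Rename the labels of a statement and replace `halt` by a jump to `e` (if `e` is a label). -/
def relabel (f : Λ → Λ') (e : Option Λ') : Stmt Γ Λ σ → Stmt Γ Λ' σ
  | .push k g q => .push k g (relabel f e q)
  | .peek k g q => .peek k g (relabel f e q)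
  | .pop k g q => .pop k g (relabel f e q)
  | .load g q => .load g (relabel f e q)
  | .branch g q₁ q₂ => .branch g (relabel f e q₁) (relabel f e q₂)
  | .goto l => .goto fun v => f (l v)
  | .halt => e.elim .halt fun l => .goto fun _ => l

/-- The effect of `relabel` on configurations. -/
def relabelCfg (f : Λ → Λ') (e : Option Λ') (c : Cfg Γ Λ σ) : Cfg Γ Λ' σ :=
  ⟨c.l.elim e fun l => some (f l), c.var, c.stk⟩

variable [DecidableEq K]

theorem stepAux_relabel (f : Λ → Λ') (e : Option Λ') (q : Stmt Γ Λ σ) (v : σ)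
    (S : ∀ k, List (Γ k)) :
    stepAux (relabel f e q) v S = relabelCfg f e (stepAux q v S) := by
  induction q generalizing v S with
  | push k g _ ih => exact ih _ _
  | peek k g _ ih => exact ih _ _
  | pop k g _ ih => exact ih _ _
  | load g _ ih => exact ih _ _
  | branch g q₁ q₂ ih₁ ih₂ =>
    simp only [relabel, stepAux]
    cases g v
    · exact ih₂ _ _
    · exact ih₁ _ _
  | goto l => rfl
  | halt => cases e <;> rfl

theorem step_relabel {M : Λ → Stmt Γ Λ σ}
    {M' : Λ' → Stmt Γ Λ' σ} (f : Λ → Λ') (e : Option Λ') (h : ∀ l, M' (f l) = relabel f e (M l))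
    (c d : Cfg Γ Λ σ) (hc : step M c = some d) :
    step M' (relabelCfg f e c) = some (relabelCfg f e d) := by
  obtain ⟨l, v, S⟩ := c
  cases l with
  | none => simp at hc
  | some l =>
    simp only [step, Option.some.injEq] at hc
    subst hc
    simp only [relabelCfg, Option.elim, step, h, stepAux_relabel]

/-- An upper bound for the number of symbols that a statement pushes. -/
def pushes : Stmt Γ Λ σ → ℕ
  | .push _ _ q => pushes q + 1
  | .peek _ _ q => pushes q
  | .pop _ _ q => pushes q
  | .load _ q => pushes q
  | .branch _ q₁ q₂ => pushes q₁ + pushes q₂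
  | .goto _ => 0
  | .halt => 0

variable [Fintype K]

theorem height_update (S : ∀ k, List (Γ k)) (k : K) (l : List (Γ k)) :
    height (update S k l) + (S k).length = height S + l.length := by
  classical
  have h : ∀ T : ∀ k, List (Γ k),
      height T = (T k).length + ∑ j ∈ Finset.univ.erase k, (T j).length := fun T =>
    (Finset.add_sum_erase _ (fun j => (T j).length) (Finset.mem_univ k)).symm
  rw [h S, h (update S k l), update_self,
    Finset.sum_congr rfl fun j hj => by rw [update_of_ne (Finset.ne_of_mem_erase hj)]]
  omega

theorem height_stepAux (q : Stmt Γ Λ σ) (v : σ) (S : ∀ k, List (Γ k)) :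
    height (stepAux q v S).stk ≤ height S + pushes q := by
  induction q generalizing v S with
  | push k g q ih =>
    have h := height_update S k (g v :: S k)
    have := ih v (update S k (g v :: S k))
    simp only [stepAux, pushes, List.length_cons] at *
    omega
  | peek k g _ ih => exact ih _ _
  | pop k g q ih =>
    have h := height_update S k (S k).tail
    have := ih (g v (S k).head?) (update S k (S k).tail)
    simp only [stepAux, pushes, List.length_tail] at *
    omega
  | load g _ ih => exact ih _ _
  | branch g q₁ q₂ ih₁ ih₂ =>
    have h₁ := ih₁ v S
    have h₂ := ih₂ v S
    simp only [stepAux, pushes]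
    cases g v <;> simp only [cond] <;> omega
  | goto l => exact le_refl _
  | halt => exact le_refl _

/-- `Path M m n c d`: the machine goes from `c` to `d` in `n` steps, through configurations of
height at most `m`. -/
inductive Path (M : Λ → Stmt Γ Λ σ) (m : ℕ∞) : ℕ → Cfg Γ Λ σ → Cfg Γ Λ σ → Prop
  | refl (c : Cfg Γ Λ σ) (h : (height c.stk : ℕ∞) ≤ m) : Path M m 0 c c
  | head {n : ℕ} {c d e : Cfg Γ Λ σ} (h : (height c.stk : ℕ∞) ≤ m) (hs : step M c = some d)
      (hp : Path M m n d e) : Path M m (n + 1) c e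

namespace Path

variable {M : Λ → Stmt Γ Λ σ} {m : ℕ∞} {n n' : ℕ} {c d e : Cfg Γ Λ σ}

theorem height_le (h : Path M m n c d) : (height c.stk : ℕ∞) ≤ m := by
  cases h <;> assumption

theorem height_le_right (h : Path M m n c d) : (height d.stk : ℕ∞) ≤ m := by
  induction h with
  | refl _ hc => exact hc
  | head _ _ _ ih => exact ih

theorem trans (h : Path M m n c d) (h' : Path M m n' d e) : Path M m (n + n') c e := by
  induction h with
  | refl c _ => simpa using h'
  | head hc hs _ ih => rw [Nat.add_right_comm]; exact .head hc hs (ih h')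

theorem mono {m' : ℕ∞} (hm : m ≤ m') (h : Path M m n c d) : Path M m' n c d := by
  induction h with
  | refl c hc => exact .refl c (hc.trans hm)
  | head hc hs _ ih => exact .head (hc.trans hm) hs ih

theorem map {K' : Type} [DecidableEq K'] [Fintype K'] {Γ' : K' → Type} {σ' : Type}
    {M' : Λ' → Stmt Γ' Λ' σ'} {m' : ℕ∞} (φ : Cfg Γ Λ σ → Cfg Γ' Λ' σ')
    (hφ : ∀ c d, step M c = some d → step M' (φ c) = some (φ d))
    (hm : ∀ c, (height c.stk : ℕ∞) ≤ m → (height (φ c).stk : ℕ∞) ≤ m')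
    (h : Path M m n c d) : Path M' m' n (φ c) (φ d) := by
  induction h with
  | refl c hc => exact .refl _ (hm _ hc)
  | head hc hs _ ih => exact .head (hm _ hc) (hφ _ _ hs) ih

theorem relabelled {M' : Λ' → Stmt Γ Λ' σ} (f : Λ → Λ') (e : Option Λ')
    (h : ∀ l, M' (f l) = relabel f e (M l)) (hp : Path M m n c d) :
    Path M' m n (relabelCfg f e c) (relabelCfg f e d) :=
  hp.map (relabelCfg f e) (step_relabel f e h) fun _ hc => hc

theorem height_bound {B : ℕ} (hB : ∀ l, pushes (M l) ≤ B) (h : Path M ⊤ n c d) :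
    Path M ((height c.stk + B * n : ℕ) : ℕ∞) n c d := by
  induction h with
  | refl c _ => exact .refl c (by simp)
  | @head n c d e hc hs _ ih =>
    refine .head (by exact_mod_cast Nat.le_add_right _ _) hs (ih.mono ?_)
    obtain ⟨l, v, S⟩ := c
    cases l with
    | none => simp at hs
    | some l =>
      simp only [step, Option.some.injEq] at hs
      subst hs
      have := height_stepAux (M l) v S
      have := hB l
      rw [Nat.cast_le, Nat.mul_succ]
      dsimp only
      omega

theorem reaches_height_le {v : σ} {S : ∀ k, List (Γ k)} (h : Path M m n c ⟨none, v, S⟩)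
    (hr : StateTransition.Reaches (step M) c e) : (height e.stk : ℕ∞) ≤ m := by
  generalize hd : (⟨none, v, S⟩ : Cfg Γ Λ σ) = d at h
  induction h with
  | refl c hc =>
    subst hd
    rcases Relation.ReflTransGen.cases_head hr with rfl | ⟨_, h', _⟩
    · exact hc
    · simp at h'
  | head hc hs _ ih =>
    rcases Relation.ReflTransGen.cases_head hr with rfl | ⟨_, h', hr'⟩
    · exact hc
    · rw [Option.mem_def, hs, Option.some.injEq] at h'
      subst h'
      exact ih hr' hd

theorem iterate_eq (h : Path M m n c d) : (flip bind (step M))^[n] (some c) = some d := by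
  induction h with
  | refl c _ => rfl
  | head hc hs _ ih => rw [iterate_succ_apply]; simpa [flip, hs] using ih

theorem of_iterate_eq (hm : ∀ e, StateTransition.Reaches (step M) c e → (height e.stk : ℕ∞) ≤ m)
    (h : (flip bind (step M))^[n] (some c) = some d) : Path M m n c d := by
  induction n generalizing c with
  | zero =>
    obtain rfl : c = d := by simpa using h
    exact .refl _ (hm _ .refl)
  | succ n ih =>
    rw [iterate_succ_apply] at h
    cases hs : step M c with
    | none =>
      exfalso
      have : ∀ k, (flip bind (step M))^[k] none = none := fun k => by
        induction k with
        | zero => rfl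
        | succ k ih => rw [iterate_succ_apply]; exact ih
      simp only [flip, Option.bind_eq_bind, Option.bind_some, hs] at h
      exact absurd ((this n).symm.trans h) (by simp)
    | some e =>
      refine .head (hm _ .refl) hs (ih (fun e' he => hm e' (.head hs he)) ?_)
      simpa [flip, hs] using h

end Path

end Basic

section Single

variable {K : Type} {Γ : K → Type} [DecidableEq K]

/-- The family of stacks that are empty except for the stack `k`, which holds `l`. -/
def single (k : K) (l : List (Γ k)) : ∀ k, List (Γ k) := update (fun _ => []) k l

@[simp]
theorem single_self (k : K) (l : List (Γ k)) : single k l k = l := update_self ..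

@[simp]
theorem update_single (k : K) (l l' : List (Γ k)) : update (single k l) k l' = single k l' :=
  update_idem ..

theorem single_nil (k : K) : single k ([] : List (Γ k)) = fun _ => [] := update_eq_self ..

theorem height_single [Fintype K] (k : K) (l : List (Γ k)) : height (single k l) = l.length := by
  simpa [single, height] using height_update (fun k => ([] : List (Γ k))) k l

end Single

/-- A program: a piece of code with an entry label. It ends by halting. -/
structure Program {K : Type} (Γ : K → Type) (σ : Type) where
  Label : Type
  [labelFintype : Fintype Label]
  entry : Label
  code : Label → Stmt Γ Label σ

attribute [instance] Program.labelFintype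

/-- The contents of the memory: the internal state and the stacks. -/
abbrev Mem {K : Type} (Γ : K → Type) (σ : Type) : Type := σ × ∀ k, List (Γ k)

namespace Program

section Combinators

variable {K : Type} {Γ : K → Type} {σ : Type}

/-- A single statement. -/
def ofStmt (q : Stmt Γ Unit σ) : Program Γ σ := ⟨Unit, (), fun _ => q⟩

/-- Run `P`, then `Q`. -/
def seq (P Q : Program Γ σ) : Program Γ σ where
  Label := P.Label ⊕ Q.Label
  entry := .inl P.entry
  code
    | .inl l => relabel .inl (some (.inr Q.entry)) (P.code l)
    | .inr l => relabel .inr none (Q.code l)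

/-- Repeat `P` while the test holds. -/
def loop (b : σ → Bool) (P : Program Γ σ) : Program Γ σ where
  Label := Unit ⊕ P.Label
  entry := .inl ()
  code
    | .inl _ => .branch b (.goto fun _ => .inr P.entry) .halt
    | .inr l => relabel .inr (some (.inl ())) (P.code l)

/-- Pop the symbols of a stack one by one and run `P` for each of them. The test `b` tells whether
the last pop was successful. -/
def forEach (k : K) (set : σ → Option (Γ k) → σ) (b : σ → Bool) (P : Program Γ σ) :
    Program Γ σ where
  Label := Unit ⊕ P.Label
  entry := .inl ()
  code
    | .inl _ => .pop k set (.branch b (.goto fun _ => .inr P.entry) .halt)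
    | .inr l => relabel .inr (some (.inl ())) (P.code l)

/-- Run the program chosen by the internal state. -/
def select {α : Type} [Fintype α] (sel : σ → α) (P : α → Program Γ σ) : Program Γ σ where
  Label := Unit ⊕ Σ a, (P a).Label
  entry := .inl ()
  code
    | .inl _ => .goto fun v => .inr ⟨sel v, (P (sel v)).entry⟩
    | .inr ⟨a, l⟩ => relabel (fun l => .inr ⟨a, l⟩) none ((P a).code l)

/-- An upper bound for the number of symbols that one step of the program pushes. -/
def pushBound (P : Program Γ σ) : ℕ := Finset.univ.sup fun l => pushes (P.code l)

theorem pushes_le_pushBound (P : Program Γ σ) (l : P.Label) : pushes (P.code l) ≤ P.pushBound :=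
  Finset.le_sup (f := fun l => pushes (P.code l)) (Finset.mem_univ l)

variable [DecidableEq K] [Fintype K]

/-- `P.Runs s t m s'`: started in `s`, the program `P` ends in `s'`, in time `t` and space `m`. -/
def Runs (P : Program Γ σ) (s : Mem Γ σ) (t : ℕ) (m : ℕ∞) (s' : Mem Γ σ) : Prop :=
  ∃ n ≤ t, Path P.code m n ⟨some P.entry, s.1, s.2⟩ ⟨none, s'.1, s'.2⟩

variable {P Q : Program Γ σ} {s s' s'' : Mem Γ σ} {t t' : ℕ} {m m' : ℕ∞}

namespace Runs

theorem mono (h : P.Runs s t m s') (ht : t ≤ t') (hm : m ≤ m') : P.Runs s t' m' s' := by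
  obtain ⟨n, hn, h⟩ := h
  exact ⟨n, hn.trans ht, h.mono hm⟩

theorem mono_time (h : P.Runs s t m s') (ht : t ≤ t') : P.Runs s t' m s' :=
  h.mono ht le_rfl

theorem ofStmt {q : Stmt Γ Unit σ} (h : stepAux q s.1 s.2 = ⟨none, s'.1, s'.2⟩) :
    (ofStmt q).Runs s 1 ⊤ s' :=
  ⟨1, le_rfl, .head le_top (by simp [Program.ofStmt, h]) (.refl _ le_top)⟩

theorem seq (h : P.Runs s t m s') (h' : Q.Runs s' t' m s'') :
    (P.seq Q).Runs s (t + t') m s'' := by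
  obtain ⟨n, hn, h⟩ := h
  obtain ⟨n', hn', h'⟩ := h'
  exact ⟨n + n', by omega,
    (h.relabelled (M' := (P.seq Q).code) .inl (some (.inr Q.entry)) fun _ => rfl).trans
    (h'.relabelled (M' := (P.seq Q).code) .inr none fun _ => rfl)⟩

theorem loop_false {b : σ → Bool} (hb : b s.1 = false) (hm : (height s.2 : ℕ∞) ≤ m) :
    (Program.loop b P).Runs s 1 m s :=
  ⟨1, le_rfl, .head hm (by simp [Program.loop, hb]) (.refl _ hm)⟩

theorem loop_true {b : σ → Bool} (hb : b s.1 = true) (h : P.Runs s t m s')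
    (h' : (Program.loop b P).Runs s' t' m s'') :
    (Program.loop b P).Runs s (t + t' + 1) m s'' := by
  obtain ⟨n, hn, h⟩ := h
  obtain ⟨n', hn', h'⟩ := h'
  refine ⟨n + n' + 1, by omega, .head h.height_le ?_
    ((h.relabelled (M' := (Program.loop b P).code) .inr (some (.inl ())) fun _ => rfl).trans h')⟩
  simp [Program.loop, hb, relabelCfg]

theorem select {α : Type} [Fintype α] {sel : σ → α} {P : α → Program Γ σ}
    (h : (P (sel s.1)).Runs s t m s') : (Program.select sel P).Runs s (t + 1) m s' := by
  obtain ⟨n, hn, h⟩ := h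
  exact ⟨n + 1, by omega, .head h.height_le rfl
    (h.relabelled (M' := (Program.select sel P).code) (fun l => .inr ⟨sel s.1, l⟩) none
      fun _ => rfl)⟩

/-- `E x l` is the memory when `x` has been computed so far and `l` is what remains on the stack;
`J` is an invariant. -/
theorem forEach {k : K} {set : σ → Option (Γ k) → σ} {b : σ → Bool} {β : Type*}
    (E : β → List (Γ k) → Mem Γ σ) (f : β → Γ k → β) (J : β → List (Γ k) → Prop) {T : ℕ}
    (hk : ∀ x l, (E x l).2 k = l) (hu : ∀ x a l, update (E x (a :: l)).2 k l = (E x l).2)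
    (hv : ∀ x a l, (E x (a :: l)).1 = (E x l).1)
    (hb : ∀ v a, b (set v a) = a.isSome)
    (hJ : ∀ x a l, J x (a :: l) → J (f x a) l)
    (hP : ∀ x a l, J x (a :: l) →
      P.Runs (set (E x l).1 (some a), (E x l).2) T ⊤ (E (f x a) l))
    (x : β) (l : List (Γ k)) (hx : J x l) :
    (forEach k set b P).Runs (E x l) (l.length * (T + 1) + 1) ⊤
      (set (E (l.foldl f x) []).1 none, (E (l.foldl f x) []).2) := by
  induction l generalizing x with
  | nil =>
    refine ⟨1, by omega, .head le_top ?_ (.refl _ le_top)⟩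
    have h : update (E x []).2 k [] = (E x []).2 :=
      (congrArg (update _ k) (hk x []).symm).trans (update_eq_self k _)
    simp [Program.forEach, hb, hk, h]
  | cons a l ih =>
    obtain ⟨n, hn, h⟩ := hP x a l hx
    obtain ⟨n', hn', h'⟩ := ih _ (hJ _ _ _ hx)
    refine ⟨n + n' + 1, ?_, .head le_top ?_
      ((StackProgram.Path.relabelled (M' := (Program.forEach k set b P).code)
        .inr (some (.inl ())) (fun _ => rfl) h).trans
        h')⟩
    · rw [List.length_cons, Nat.succ_mul]; omega
    · simp [Program.forEach, hb, hk, hu, hv, relabelCfg]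

theorem bound_space (h : P.Runs s t ⊤ s') :
    P.Runs s t ((height s.2 + P.pushBound * t : ℕ) : ℕ∞) s' := by
  obtain ⟨n, hn, h⟩ := h
  refine ⟨n, hn, (h.height_bound P.pushes_le_pushBound).mono ?_⟩
  exact_mod_cast Nat.add_le_add_left (Nat.mul_le_mul_left _ hn) _

end Runs

end Combinators

end Program

/-! ### Machines as programs -/

attribute [local instance] FinTM2.kFin

/-- The program of a machine. -/
def machineProgram (tm : FinTM2) : Program tm.Γ tm.σ :=
  @Program.mk _ _ _ tm.Λ tm.ΛFin tm.main tm.m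

/-- `Computes tm l t m l'`: the machine `tm` turns the input `l` into the output `l'`, in time `t`
and space `m`. -/
def Computes (tm : FinTM2) (l : List (tm.Γ tm.k₀)) (t : ℕ) (m : ℕ∞) (l' : List (tm.Γ tm.k₁)) :
    Prop :=
  (machineProgram tm).Runs (tm.initialState, single tm.k₀ l) t m
    (tm.initialState, single tm.k₁ l')

section Computes

variable {tm : FinTM2} {l : List (tm.Γ tm.k₀)} {l' : List (tm.Γ tm.k₁)} {t : ℕ} {m : ℕ∞}

theorem dite_eq_single {K : Type} {Γ : K → Type} [DecidableEq K] (k₀ : K) (s : List (Γ k₀))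
    (d : ∀ k, Decidable (k = k₀)) :
    (fun k => @dite (List (Γ k)) (k = k₀) (d k) (fun h => by rw [h]; exact s) fun _ => []) =
      single k₀ s := by
  funext k
  by_cases h : k = k₀
  · subst h
    simp
  · simp [single, h]

theorem initList_eq (tm : FinTM2) (s : List (tm.Γ tm.k₀)) :
    initList tm s = ⟨some tm.main, tm.initialState, single tm.k₀ s⟩ :=
  congrArg (Cfg.mk _ _) (dite_eq_single tm.k₀ s fun k => tm.kDecidableEq k tm.k₀)

theorem haltList_eq (tm : FinTM2) (s : List (tm.Γ tm.k₁)) :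
    haltList tm s = ⟨none, tm.initialState, single tm.k₁ s⟩ :=
  congrArg (Cfg.mk _ _) (dite_eq_single tm.k₁ s fun k => tm.kDecidableEq k tm.k₁)

namespace Computes

theorem of_outputs (h : TM2Outputs tm l (some l'))
    (hm : ∀ c, StateTransition.Reaches tm.step (initList tm l) c →
      (Complexity.cfgSpace tm c : ℕ∞) ≤ m) : Computes tm l h.steps m l' := by
  rw [initList_eq] at hm
  exact ⟨h.steps, le_rfl, Path.of_iterate_eq hm <|
    (congrArg (fun c => (flip bind tm.step)^[h.steps] (some c)) (initList_eq tm l)).symm.trans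
      (h.evals_in_steps.trans (congrArg some (haltList_eq tm l')))⟩

theorem of_outputsInTime (h : TM2OutputsInTime tm l (some l') t) : Computes tm l t ⊤ l' :=
  (of_outputs h.toEvalsTo fun _ _ => le_top).mono_time h.steps_le_m

theorem outputsInTime (h : Computes tm l t m l') :
    Nonempty (TM2OutputsInTime tm l (some l') t) := by
  obtain ⟨n, hn, h⟩ := h
  exact ⟨⟨⟨n, (congrArg (fun c => (flip bind tm.step)^[n] (some c)) (initList_eq tm l)).trans
    (h.iterate_eq.trans (congrArg some (haltList_eq tm l')).symm)⟩, hn⟩⟩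

theorem cfgSpace_le (h : Computes tm l t m l') {c : tm.Cfg}
    (hc : StateTransition.Reaches tm.step (initList tm l) c) :
    (Complexity.cfgSpace tm c : ℕ∞) ≤ m := by
  obtain ⟨n, hn, h⟩ := h
  rw [initList_eq] at hc
  exact h.reaches_height_le hc

theorem length_output_le (h : Computes tm l t m l') : (l'.length : ℕ∞) ≤ m := by
  obtain ⟨n, -, h⟩ := h
  simpa only [height_single] using h.height_le_right

end Computes

end Computes

/-! ### Programs with a register and subroutines -/

section Stacks

variable {K : Type} {Γ : K → Type} {ι : Type} {sub : ι → FinTM2}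

/-- The stacks `Γ` of a program together with the stacks of its subroutines. -/
abbrev CombinedStack (Γ : K → Type) (sub : ι → FinTM2) : K ⊕ (Σ i, (sub i).K) → Type
  | .inl k => Γ k
  | .inr j => (sub j.1).Γ j.2

/-- The contents `S` of the own stacks together with the contents `T` of the stacks of the
subroutines. -/
def join (S : ∀ k, List (Γ k)) (T : ∀ i k, List ((sub i).Γ k)) :
    ∀ j, List (CombinedStack Γ sub j)
  | .inl k => S k
  | .inr ⟨i, k⟩ => T i k

theorem height_join [Fintype K] [Fintype ι] (S : ∀ k, List (Γ k))
    (T : ∀ i k, List ((sub i).Γ k)) : height (join S T) = height S + ∑ i, height (T i) := by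
  simp only [height, Fintype.sum_sum_type, Fintype.sum_sigma]
  rfl

/-- The contents of the stacks of the subroutines when only the `i`-th subroutine is not idle. -/
def running [DecidableEq ι] (i : ι) (T : ∀ k, List ((sub i).Γ k)) : ∀ i k, List ((sub i).Γ k) :=
  update (fun _ _ => []) i T

@[simp]
theorem running_self [DecidableEq ι] (i : ι) (T : ∀ k, List ((sub i).Γ k)) : running i T i = T :=
  update_self ..

@[simp]
theorem update_running [DecidableEq ι] (i : ι) (T T' : ∀ k, List ((sub i).Γ k)) :
    update (running i T) i T' = running i T' := update_idem ..

theorem height_join_running [Fintype K] [Fintype ι] [DecidableEq ι] (S : ∀ k, List (Γ k)) (i : ι)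
    (T : ∀ k, List ((sub i).Γ k)) : height (join S (running i T)) = height S + height T := by
  rw [height_join, Finset.sum_eq_single i (fun j _ hj => ?_) (by simp), running_self]
  simp [running, update_of_ne hj, height]

variable [DecidableEq K] [DecidableEq ι]

theorem update_join_inl (S : ∀ k, List (Γ k)) (T : ∀ i k, List ((sub i).Γ k)) (k : K)
    (l : List (Γ k)) : update (join S T) (.inl k) l = join (update S k l) T := by
  funext j
  rcases j with j | j
  · by_cases h : j = k
    · subst h
      exact (update_self (Sum.inl j) _ (join S T)).trans (update_self j l S).symm
    · have h_join : update (join S T) (.inl k) l (.inl j) = S j :=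
        update_of_ne (fun h' => h (Sum.inl_injective h')) _ _
      have h_own : update S k l j = S j := update_of_ne h _ _
      exact h_join.trans h_own.symm
  · exact update_of_ne Sum.inr_ne_inl _ _

theorem join_single (k : K) (l : List (Γ k)) :
    join (single k l) (fun i k => ([] : List ((sub i).Γ k))) = single (.inl k) l := by
  have h_nil : join (fun k => ([] : List (Γ k))) (fun i k => ([] : List ((sub i).Γ k))) =
      fun _ => [] := by
    funext j
    rcases j with j | j <;> rfl
  rw [single, ← update_join_inl, h_nil, single]

theorem update_join_inr (S : ∀ k, List (Γ k)) (T : ∀ i k, List ((sub i).Γ k)) (i : ι)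
    (k : (sub i).K) (l : List ((sub i).Γ k)) :
    update (join S T) (.inr ⟨i, k⟩) l = join S (update T i (update (T i) k l)) := by
  funext j
  rcases j with j | ⟨i', j⟩
  · exact update_of_ne Sum.inl_ne_inr _ _
  · by_cases hi : i' = i
    · subst hi
      by_cases h : j = k
      · subst h
        exact (update_self (f := join S T) ..).trans
          ((congrFun (update_self i' _ T) j).trans (update_self j l _)).symm
      · exact (update_of_ne (by simpa using h) _ (join S T)).trans
          ((congrFun (update_self i' _ T) j).trans (update_of_ne h l _)).symm
    · exact (update_of_ne (fun h => hi (congrArg Sigma.fst (Sum.inr_injective h))) _ _).trans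
        (congrFun (update_of_ne hi _ T) j).symm

theorem running_single_nil (i : ι) (k : (sub i).K) :
    running i (single k []) = fun _ _ => [] := by
  simp [running, single_nil]

theorem update_join_running (S : ∀ k, List (Γ k)) (i : ι) (k : (sub i).K)
    (l l' : List ((sub i).Γ k)) :
    update (join S (running i (single k l))) (.inr ⟨i, k⟩) l' =
      join S (running i (single k l')) := by
  rw [update_join_inr]
  simp

end Stacks

section Subroutine

variable {K : Type} (Γ : K → Type) (σ : Type) {ι : Type} (sub : ι → FinTM2) [DecidableEq ι]
  {Λ : Type}

/-- A statement of the `i`-th subroutine as a statement of the calling program. -/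
def subroutineStmt (i : ι) : Stmt (sub i).Γ Λ (sub i).σ →
    Stmt (CombinedStack Γ sub) Λ (σ × ∀ i, (sub i).σ)
  | .push k g q => .push (.inr ⟨i, k⟩) (fun v => g (v.2 i)) (subroutineStmt i q)
  | .peek k g q =>
      .peek (.inr ⟨i, k⟩) (fun v a => (v.1, update v.2 i (g (v.2 i) a))) (subroutineStmt i q)
  | .pop k g q =>
      .pop (.inr ⟨i, k⟩) (fun v a => (v.1, update v.2 i (g (v.2 i) a))) (subroutineStmt i q)
  | .load g q => .load (fun v => (v.1, update v.2 i (g (v.2 i)))) (subroutineStmt i q)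
  | .branch g q₁ q₂ =>
      .branch (fun v => g (v.2 i)) (subroutineStmt i q₁) (subroutineStmt i q₂)
  | .goto l => .goto fun v => l (v.2 i)
  | .halt => .halt

/-- Run the `i`-th subroutine. -/
def subroutine (i : ι) : Program (CombinedStack Γ sub) (σ × ∀ i, (sub i).σ) :=
  ⟨(machineProgram (sub i)).Label, (machineProgram (sub i)).entry,
    fun l => subroutineStmt Γ σ sub i ((machineProgram (sub i)).code l)⟩

variable {Γ σ sub} [DecidableEq K]

theorem stepAux_subroutineStmt (i : ι) (q : Stmt (sub i).Γ Λ (sub i).σ) (v : σ)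
    (w : ∀ i, (sub i).σ) (w' : (sub i).σ) (S : ∀ k, List (Γ k)) (T : ∀ i k, List ((sub i).Γ k))
    (T' : ∀ k, List ((sub i).Γ k)) :
    stepAux (subroutineStmt Γ σ sub i q) (v, update w i w') (join S (update T i T')) =
      ⟨(stepAux q w' T').l, (v, update w i (stepAux q w' T').var),
        join S (update T i (stepAux q w' T').stk)⟩ := by
  have h_top (T' k) : join S (update T i T') (.inr ⟨i, k⟩) = T' k := by
    change update T i T' i k = T' k
    rw [update_self]
  have h_update (T') (k : (sub i).K) (l : List ((sub i).Γ k)) :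
      update (join S (update T i T')) (.inr ⟨i, k⟩) l = join S (update T i (update T' k l)) := by
    rw [update_join_inr, update_self, update_idem]
  induction q generalizing w' T' with
  | push k g q ih => simp_all [subroutineStmt, stepAux]
  | peek k g q ih => simp_all [subroutineStmt, stepAux]
  | pop k g q ih => simp_all [subroutineStmt, stepAux]
  | load g q ih => simp_all [subroutineStmt, stepAux]
  | branch g q₁ q₂ ih₁ ih₂ =>
    simp only [subroutineStmt, stepAux, update_self]
    cases g w'
    · exact ih₂ _ _
    · exact ih₁ _ _
  | goto l => simp [subroutineStmt, stepAux]
  | halt => rfl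

end Subroutine

section Register

variable {K : Type} (Γ : K → Type) (τ : Type) {ι : Type} (sub : ι → FinTM2)

/-- The internal state of a program with subroutines: a register for the last popped symbol, the
variables of the program, and the internal states of the subroutines. -/
abbrev RegState : Type := (Option (Σ k, Γ k) × τ) × ∀ i, (sub i).σ

/-- A program with the stacks `Γ` and the variables `τ` that may call the subroutines `sub`. -/
abbrev RegProgram : Type 1 := Program (CombinedStack Γ sub) (RegState Γ τ sub)

variable {Γ τ sub}

/-- The memory in which the own part is `s`, the register is empty, the subroutines are in their
initial states and their stacks are `T`. -/
def memWith (sub : ι → FinTM2) (s : Mem Γ τ) (T : ∀ i k, List ((sub i).Γ k)) :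
    Mem (CombinedStack Γ sub) (RegState Γ τ sub) :=
  (((none, s.1), fun i => (sub i).initialState), join s.2 T)

/-- The memory in which the own part is `s` and the rest is idle. -/
abbrev idleMem (sub : ι → FinTM2) (s : Mem Γ τ) :
    Mem (CombinedStack Γ sub) (RegState Γ τ sub) :=
  memWith sub s fun _ _ => []

theorem height_idleMem [Fintype K] [Fintype ι] (s : Mem Γ τ) :
    height (idleMem sub s).2 = height s.2 :=
  (height_join s.2 _).trans (by simp [height])

variable [DecidableEq K]

/-- The last popped symbol, if it belongs to the stack `k`. -/
def popped (k : K) (v : RegState Γ τ sub) : Option (Γ k) :=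
  v.1.1.bind fun a => if h : a.1 = k then some (h ▸ a.2) else none

/-- Store a symbol of the stack `k` in the register. -/
def setPopped (k : K) (v : RegState Γ τ sub) (a : Option (Γ k)) : RegState Γ τ sub :=
  ((a.map (Sigma.mk k), v.1.2), v.2)

@[simp]
theorem popped_setPopped (k : K) (v : RegState Γ τ sub) (a : Option (Γ k)) :
    popped k (setPopped k v a) = a := by
  cases a <;> simp [popped, setPopped]

namespace RegProgram

/-- Empty the register. -/
def forget : RegProgram Γ τ sub := .ofStmt (.load (fun v => ((none, v.1.2), v.2)) .halt)

/-- Push a symbol. -/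
def push (k : K) (a : Γ k) : RegProgram Γ τ sub := .ofStmt (.push (.inl k) (fun _ => a) .halt)

/-- Change the variables. -/
def assign (f : τ → τ) : RegProgram Γ τ sub :=
  .ofStmt (.load (fun v => ((v.1.1, f v.1.2), v.2)) .halt)

/-- Do nothing. -/
def skip : RegProgram Γ τ sub := .ofStmt .halt

/-- Push the symbols of a list. -/
def pushList (k : K) : List (Γ k) → RegProgram Γ τ sub
  | [] => skip
  | a :: l => .seq (push k a) (pushList k l)

/-- Choose the program to be run by the values of the variables. -/
def switch [Fintype τ] (P : τ → RegProgram Γ τ sub) : RegProgram Γ τ sub :=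
  .select (fun v => v.1.2) P

/-- Empty the register and run the program chosen by its former contents. -/
def casePopped (k : K) [Fintype (Γ k)] (P : Option (Γ k) → RegProgram Γ τ sub) :
    RegProgram Γ τ sub :=
  .select (popped k) fun a => forget.seq (P a)

/-- Pop a symbol and run the program chosen by it. -/
def pop (k : K) [Fintype (Γ k)] (P : Option (Γ k) → RegProgram Γ τ sub) : RegProgram Γ τ sub :=
  .seq (.ofStmt (.pop (.inl k) (setPopped k) .halt)) (casePopped k P)

/-- Pop all the symbols of the stack `j` and run the program `P (g a)` for each symbol `a`. -/
def forAllAt (j : K ⊕ Σ i, (sub i).K) {k : K} [Fintype (Γ k)] (g : CombinedStack Γ sub j → Γ k)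
    (P : Γ k → RegProgram Γ τ sub) : RegProgram Γ τ sub :=
  .forEach j (fun v a => setPopped k v (a.map g)) (fun v => (popped k v).isSome)
    (casePopped k fun a => a.elim skip P)

/-- Pop all the symbols of a stack and run the program `P a` for each symbol `a`. -/
def forAll (k : K) [Fintype (Γ k)] (P : Γ k → RegProgram Γ τ sub) : RegProgram Γ τ sub :=
  forAllAt (.inl k) id P

/-- Pop all the symbols of a stack. -/
def clear (k : K) [Fintype (Γ k)] : RegProgram Γ τ sub := forAll k fun _ => skip

/-- Move the symbols of the stack `k` to the stack `k'`, one by one and renamed by `g`. -/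
def move (k k' : K) [Fintype (Γ k)] (g : Γ k → Γ k') : RegProgram Γ τ sub :=
  forAll k fun a => push k' (g a)

/-- Move the contents of the stack `k` to the input stack of the `i`-th subroutine. -/
def loadInput (i : ι) {k : K} [Fintype (Γ k)] (g : Γ k → (sub i).Γ (sub i).k₀) :
    RegProgram Γ τ sub :=
  forAll k fun a => .ofStmt (.push (.inr ⟨i, (sub i).k₀⟩) (fun _ => g a) .halt)

/-- Move the contents of the output stack of the `i`-th subroutine to the stack `k`. -/
def unloadOutput (i : ι) {k : K} [Fintype (Γ k)] (g : (sub i).Γ (sub i).k₁ → Γ k) :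
    RegProgram Γ τ sub :=
  forAllAt (.inr ⟨i, (sub i).k₁⟩) g (push k)

/-- Call the `i`-th subroutine on the reversed contents of the stack `k`, and move its output to the
stack `k'`. -/
def call [DecidableEq ι] (i : ι) {k k' : K} [Fintype (Γ k)] [Fintype (Γ k')]
    (g : Γ k → (sub i).Γ (sub i).k₀) (g' : (sub i).Γ (sub i).k₁ → Γ k') : RegProgram Γ τ sub :=
  (loadInput i g).seq <|
    (subroutine Γ (Option (Σ k, Γ k) × τ) sub i).seq (unloadOutput i g')

variable [Fintype K] [Fintype ι] [DecidableEq ι]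

/-- `P.DoesWithin s t m r`: started with the own memory `s` and otherwise idle, the program `P`
ends with the own memory `r` and otherwise idle, in time `t` and space `m`. -/
def DoesWithin (P : RegProgram Γ τ sub) (s : Mem Γ τ) (t : ℕ) (m : ℕ∞) (r : Mem Γ τ) : Prop :=
  P.Runs (idleMem sub s) t m (idleMem sub r)

/-- `DoesWithin` without a bound for the space. -/
abbrev Does (P : RegProgram Γ τ sub) (s : Mem Γ τ) (t : ℕ) (s' : Mem Γ τ) : Prop :=
  P.DoesWithin s t ⊤ s'

theorem runs_casePopped {k : K} [Fintype (Γ k)] {P : Option (Γ k) → RegProgram Γ τ sub}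
    {v : RegState Γ τ sub} {S : ∀ j, List (CombinedStack Γ sub j)} {t : ℕ}
    {s : Mem (CombinedStack Γ sub) (RegState Γ τ sub)} (a : Option (Γ k))
    (h : (P a).Runs (((none, v.1.2), v.2), S) t ⊤ s) :
    (casePopped k P).Runs (setPopped k v a, S) (t + 2) ⊤ s := by
  have h_forget : (forget : RegProgram Γ τ sub).Runs (setPopped k v a, S) 1 ⊤
    (((none, v.1.2), v.2), S) := .ofStmt rfl
  refine Program.Runs.mono_time (.select ?_) (by omega : 1 + t + 1 ≤ _)
  rw [popped_setPopped]
  exact h_forget.seq h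

/-- `E x l` is the memory when `x` has been computed so far and `l` is what remains on the stack;
`J` is an invariant. -/
theorem runs_forAllAt {j : K ⊕ Σ i, (sub i).K} {k : K} [Fintype (Γ k)]
    {g : CombinedStack Γ sub j → Γ k} {P : Γ k → RegProgram Γ τ sub} {β : Type*}
    (E : β → List (CombinedStack Γ sub j) → Mem Γ τ × ∀ i k, List ((sub i).Γ k))
    (f : β → CombinedStack Γ sub j → β) (J : β → List (CombinedStack Γ sub j) → Prop) {T : ℕ}
    (hk : ∀ x l, join (E x l).1.2 (E x l).2 j = l)
    (hu : ∀ x a l, update (join (E x (a :: l)).1.2 (E x (a :: l)).2) j l =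
      join (E x l).1.2 (E x l).2)
    (hv : ∀ x a l, (E x (a :: l)).1.1 = (E x l).1.1)
    (hJ : ∀ x a l, J x (a :: l) → J (f x a) l)
    (hP : ∀ x a l, J x (a :: l) →
      (P (g a)).Runs (memWith sub (E x l).1 (E x l).2) T ⊤
        (memWith sub (E (f x a) l).1 (E (f x a) l).2))
    (x : β) (l : List (CombinedStack Γ sub j)) (hx : J x l) :
    (forAllAt j g P).Runs (memWith sub (E x l).1 (E x l).2) (l.length * (T + 3) + 1) ⊤
      (memWith sub (E (l.foldl f x) []).1 (E (l.foldl f x) []).2) :=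
  Program.Runs.forEach (fun x l => memWith sub (E x l).1 (E x l).2) f J hk hu
    (fun x a l => by simp only [memWith, hv]) (fun v a => by simp) hJ
    (fun x a l h => runs_casePopped (some (g a)) (hP x a l h)) x l hx

variable {P Q : RegProgram Γ τ sub} {s s' s'' : Mem Γ τ} {t t' : ℕ} {m m' : ℕ∞}

namespace DoesWithin

theorem mono (h : P.DoesWithin s t m s') (ht : t ≤ t') (hm : m ≤ m') : P.DoesWithin s t' m' s' :=
  Program.Runs.mono h ht hm

theorem mono_time (h : P.DoesWithin s t m s') (ht : t ≤ t') : P.DoesWithin s t' m s' :=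
  h.mono ht le_rfl

theorem congr (h : P.DoesWithin s t m s') (hs : s' = s'') (ht : t ≤ t') :
    P.DoesWithin s t' m s'' :=
  hs ▸ h.mono_time ht

theorem seq (h : P.DoesWithin s t m s') (h' : Q.DoesWithin s' t' m s'') :
    DoesWithin (Program.seq P Q) s (t + t') m s'' :=
  Program.Runs.seq h h'

theorem height_le_right (h : P.DoesWithin s t m s') : (height s'.2 : ℕ∞) ≤ m := by
  obtain ⟨_, _, h⟩ := h
  exact (Nat.cast_le.2 (height_idleMem (sub := sub) s').ge).trans h.height_le_right

theorem loop_false {b : τ → Bool} (hb : b s.1 = false) (hm : (height s.2 : ℕ∞) ≤ m) :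
    DoesWithin (Program.loop (fun v => b v.1.2) P) s 1 m s :=
  Program.Runs.loop_false hb ((Nat.cast_le.2 (height_idleMem (sub := sub) s).le).trans hm)

theorem loop_true {b : τ → Bool} (hb : b s.1 = true) (h : P.DoesWithin s t m s')
    (h' : DoesWithin (Program.loop (fun v => b v.1.2) P) s' t' m s'') :
    DoesWithin (Program.loop (fun v => b v.1.2) P) s (t + t' + 1) m s'' :=
  Program.Runs.loop_true hb h h'

theorem switch [Fintype τ] {P : τ → RegProgram Γ τ sub} (h : (P s.1).DoesWithin s t m s') :
    (switch P).DoesWithin s (t + 1) m s' :=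
  Program.Runs.select h

end DoesWithin

namespace Does

theorem doesWithin (h : P.Does s t s') :
    P.DoesWithin s t ((height s.2 + P.pushBound * t : ℕ) : ℕ∞) s' := by
  have := Program.Runs.bound_space h
  rwa [height_idleMem] at this

theorem height_le (h : P.Does s t s') : height s'.2 ≤ height s.2 + P.pushBound * t :=
  Nat.cast_le.1 h.doesWithin.height_le_right

theorem push (k : K) (a : Γ k) (s : Mem Γ τ) :
    (push k a : RegProgram Γ τ sub).Does s 1 (s.1, update s.2 k (a :: s.2 k)) :=
  .ofStmt (congrArg (Cfg.mk _ _) (update_join_inl ..))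

theorem assign (f : τ → τ) (s : Mem Γ τ) :
    (assign f : RegProgram Γ τ sub).Does s 1 (f s.1, s.2) :=
  .ofStmt rfl

theorem skip (s : Mem Γ τ) : (skip : RegProgram Γ τ sub).Does s 1 s := .ofStmt rfl

theorem pushList (k : K) (l : List (Γ k)) (s : Mem Γ τ) :
    (pushList k l : RegProgram Γ τ sub).Does s (l.length + 1)
      (s.1, update s.2 k (l.reverse ++ s.2 k)) := by
  induction l generalizing s with
  | nil => simpa [RegProgram.pushList] using skip s
  | cons a l ih =>
    have := ((push k a s).seq (ih _)).mono_time (t' := (a :: l).length + 1) (by simp; omega)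
    simpa [RegProgram.pushList] using this

theorem pop {k : K} [Fintype (Γ k)] {P : Option (Γ k) → RegProgram Γ τ sub}
    (l : List (Γ k)) (hl : s.2 k = l) (h : (P l.head?).Does (s.1, update s.2 k l.tail) t s') :
    (pop k P).Does s (t + 3) s' := by
  subst hl
  have h_pop : (Program.ofStmt (.pop (.inl k) (setPopped k) .halt) : RegProgram Γ τ sub).Runs
      (idleMem sub s) 1 ⊤ (setPopped k (idleMem sub s).1 (s.2 k).head?,
        join (update s.2 k (s.2 k).tail) fun _ _ => []) :=
    .ofStmt (congrArg (Cfg.mk _ _) (update_join_inl ..))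
  exact (h_pop.seq (runs_casePopped _ h)).mono_time (by omega)

/-- `E x l` is the memory when `x` has been computed so far and `l` is what remains on the stack;
`J` is an invariant. -/
theorem forAll_of_invariant {k : K} [Fintype (Γ k)] {P : Γ k → RegProgram Γ τ sub} {β : Type*}
    (E : β → List (Γ k) → Mem Γ τ) (f : β → Γ k → β) (J : β → List (Γ k) → Prop) {T : ℕ}
    (hk : ∀ x l, (E x l).2 k = l) (hu : ∀ x a l, update (E x (a :: l)).2 k l = (E x l).2)
    (hv : ∀ x a l, (E x (a :: l)).1 = (E x l).1)
    (hJ : ∀ x a l, J x (a :: l) → J (f x a) l)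
    (hP : ∀ x a l, J x (a :: l) → (P a).Does (E x l) T (E (f x a) l))
    (x : β) (l : List (Γ k)) (hx : J x l) :
    (forAll k P).Does (E x l) (l.length * (T + 3) + 1) (E (l.foldl f x) []) :=
  runs_forAllAt (j := .inl k) (g := id) (fun x l => (E x l, fun _ _ => [])) f J hk
    (fun x a l => (update_join_inl ..).trans (congrArg (fun S => join S _) (hu x a l))) hv hJ hP
    x l hx

theorem forAll {k : K} [Fintype (Γ k)] {P : Γ k → RegProgram Γ τ sub} {β : Type*}
    (E : β → List (Γ k) → Mem Γ τ) (f : β → Γ k → β) {T : ℕ}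
    (hk : ∀ x l, (E x l).2 k = l) (hu : ∀ x a l, update (E x (a :: l)).2 k l = (E x l).2)
    (hv : ∀ x a l, (E x (a :: l)).1 = (E x l).1)
    (hP : ∀ x a l, (P a).Does (E x l) T (E (f x a) l)) (x : β) (l : List (Γ k)) :
    (forAll k P).Does (E x l) (l.length * (T + 3) + 1) (E (l.foldl f x) []) :=
  forAll_of_invariant E f (fun _ _ => True) hk hu hv (fun _ _ _ _ => trivial)
    (fun x a l _ => hP x a l) x l trivial

theorem clear {k : K} [Fintype (Γ k)] (s : Mem Γ τ) :
    (clear k : RegProgram Γ τ sub).Does s ((s.2 k).length * 4 + 1) (s.1, update s.2 k []) := by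
  have := forAll (sub := sub) (k := k) (P := fun _ => RegProgram.skip)
    (E := fun (_ : Unit) l => (s.1, update s.2 k l)) (fun _ _ => ()) (T := 1)
    (fun _ _ => update_self ..) (fun _ _ _ => update_idem ..) (fun _ _ _ => rfl)
    (fun _ _ _ => skip _) () (s.2 k)
  rwa [update_eq_self] at this

theorem move {k k' : K} [Fintype (Γ k)] (hk : k ≠ k') (g : Γ k → Γ k') (s : Mem Γ τ) :
    (move k k' g : RegProgram Γ τ sub).Does s ((s.2 k).length * 4 + 1)
      (s.1, update (update s.2 k []) k' ((s.2 k).reverse.map g ++ s.2 k')) := by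
  have := forAll (sub := sub) (k := k) (P := fun a => RegProgram.push k' (g a))
    (E := fun x l => (s.1, update (update s.2 k l) k' x)) (fun x a => g a :: x) (T := 1)
    (fun _ _ => by simp [update_of_ne hk])
    (fun _ _ _ => by rw [update_comm hk, update_idem, update_comm hk])
    (fun _ _ _ => rfl) (fun x a l => (push k' (g a) _).congr (by simp) le_rfl) (s.2 k') (s.2 k)
  rw [update_eq_self, update_comm hk, update_eq_self] at this
  exact this.congr (by simp [List.foldl_flip_cons_eq_append, update_comm hk]) le_rfl

end Does

section Call

theorem runs_subroutine {i : ι} {l : List ((sub i).Γ (sub i).k₀)} {t : ℕ} {m : ℕ}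
    {l' : List ((sub i).Γ (sub i).k₁)} (h : Computes (sub i) l t m l') (s : Mem Γ τ) :
    (subroutine Γ (Option (Σ k, Γ k) × τ) sub i).Runs
      (memWith sub s (running i (single (sub i).k₀ l))) t (height s.2 + m : ℕ)
      (memWith sub s (running i (single (sub i).k₁ l'))) := by
  obtain ⟨n, hn, h⟩ := h
  refine ⟨n, hn, ?_⟩
  have := h.map (M' := (subroutine Γ (Option (Σ k, Γ k) × τ) sub i).code)
    (m' := (height s.2 + m : ℕ))
    (fun c => ⟨c.l, ((none, s.1), update (fun i => (sub i).initialState) i c.var),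
      join s.2 (running i c.stk)⟩) ?_ ?_
  · dsimp only at this
    rwa [update_eq_self] at this
  · rintro ⟨l, v, S⟩ d hd
    cases l with
    | none => cases hd
    | some l =>
      cases hd
      exact congrArg some (stepAux_subroutineStmt ..)
  · intro c hc
    have := height_join_running s.2 i c.stk
    rw [Nat.cast_le] at hc ⊢
    exact this.trans_le (Nat.add_le_add_left hc _)

theorem runs_load (i : ι) {k : K} [Fintype (Γ k)] (g : Γ k → (sub i).Γ (sub i).k₀)
    (s : Mem Γ τ) :
    (loadInput i g).Runs (idleMem sub s) ((s.2 k).length * 4 + 1) ⊤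
      (memWith sub (s.1, update s.2 k [])
        (running i (single (sub i).k₀ ((s.2 k).reverse.map g)))) := by
  have := runs_forAllAt (sub := sub) (j := .inl k) (g := id)
    (P := fun a => .ofStmt (.push (.inr ⟨i, (sub i).k₀⟩) (fun _ => g a) .halt))
    (fun x l => ((s.1, update s.2 k l), running i (single (sub i).k₀ x)))
    (fun x a => g a :: x) (fun _ _ => True) (T := 1) (fun _ _ => update_self ..)
    (fun _ _ _ => by rw [update_join_inl, update_idem]) (fun _ _ _ => rfl)
    (fun _ _ _ _ => trivial)
    (fun x a l _ => .ofStmt (congrArg (Cfg.mk _ _) ?_)) [] (s.2 k) trivial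
  · rw [update_eq_self, running_single_nil, List.foldl_flip_cons_eq_append, List.append_nil,
      ← List.map_reverse] at this
    exact this
  · simp only [memWith, join, running_self, single_self, update_join_running, id_eq]

theorem runs_unload (i : ι) {k : K} [Fintype (Γ k)] (g : (sub i).Γ (sub i).k₁ → Γ k)
    (s : Mem Γ τ) (l : List ((sub i).Γ (sub i).k₁)) :
    (unloadOutput i g).Runs (memWith sub s (running i (single (sub i).k₁ l)))
      (l.length * 4 + 1) ⊤ (idleMem sub (s.1, update s.2 k (l.reverse.map g ++ s.2 k))) := by
  have := runs_forAllAt (sub := sub) (j := .inr ⟨i, (sub i).k₁⟩) (g := g)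
    (P := push k)
    (fun x l => ((s.1, update s.2 k x), running i (single (sub i).k₁ l)))
    (fun x a => g a :: x) (fun _ _ => True) (T := 1) (fun x l => ?_)
    (fun _ _ _ => update_join_running ..) (fun _ _ _ => rfl)
    (fun _ _ _ _ => trivial)
    (fun x a l _ => .ofStmt (congrArg (Cfg.mk _ _) ?_)) (s.2 k) l trivial
  · rw [update_eq_self, running_single_nil, List.foldl_flip_cons_eq_append,
      ← List.map_reverse] at this
    exact this
  · simp only [join, running_self, single_self]
  · simp only [memWith, join, update_join_inl, update_self, update_idem]

theorem exists_doesWithin_call (i : ι) {k k' : K} [Fintype (Γ k)] [Fintype (Γ k')]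
    (g : Γ k → (sub i).Γ (sub i).k₀) (g' : (sub i).Γ (sub i).k₁ → Γ k') :
    ∃ C : ℕ, ∀ (s : Mem Γ τ) (S : ∀ k, List (Γ k)) (t m : ℕ) (l' : List ((sub i).Γ (sub i).k₁)),
      Computes (sub i) ((s.2 k).reverse.map g) t m l' → update s.2 k [] = S →
      (call i g g').DoesWithin s (t + C * (height s.2 + m + 1)) (C * (height s.2 + m + 1) : ℕ)
        (s.1, update S k' (l'.reverse.map g' ++ S k')) := by
  let B := (loadInput i g : RegProgram Γ τ sub).pushBound +
    (unloadOutput i g' : RegProgram Γ τ sub).pushBound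
  refine ⟨5 * B + 10, fun s S t m l' h hS => ?_⟩
  subst hS
  have h_load := (runs_load i g s).bound_space
  have h_sub := runs_subroutine h (s.1, update s.2 k [])
  have h_unload := (runs_unload i g' (s.1, update s.2 k []) l').bound_space
  have h_output : l'.length ≤ m := by exact_mod_cast h.length_output_le
  have h_height := height_update s.2 k []
  rw [List.length_nil] at h_height
  rw [height_idleMem] at h_load
  rw [memWith, height_join_running, height_single] at h_unload
  have h_pushes (b x : ℕ) (hb : b ≤ B) (hx : x ≤ height s.2 + m) :
      b * (x * 4 + 1) ≤ 5 * (B * (height s.2 + m + 1)) :=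
    (Nat.mul_le_mul hb (by omega : x * 4 + 1 ≤ 5 * (height s.2 + m + 1))).trans_eq (by ring)
  have h_load_pushes := h_pushes _ (s.2 k).length (Nat.le_add_right _ _) (by omega)
  have h_unload_pushes := h_pushes _ l'.length (Nat.le_add_left _ _) (by omega)
  have h_const : (5 * B + 10) * (height s.2 + m + 1) =
    5 * (B * (height s.2 + m + 1)) + 10 * (height s.2 + m + 1) := by ring
  rw [h_const]
  dsimp only at h_sub h_unload
  exact ((h_load.mono le_rfl (Nat.cast_le.2 (by omega))).seq
    ((h_sub.mono le_rfl (Nat.cast_le.2 (by omega))).seq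
      (h_unload.mono le_rfl (Nat.cast_le.2 (by omega))))).mono_time (by omega)

end Call

end RegProgram

end Register

end StackProgram

/-! ### Polynomial bounds -/

/-- A function with a polynomial upper bound. -/
def PolyBounded (f : ℕ → ℕ) : Prop := ∃ p : Polynomial ℕ, ∀ n, f n ≤ p.eval n

theorem monotone_eval_nat (p : Polynomial ℕ) : Monotone fun n => p.eval n := by
  intro m n h
  simp only [Polynomial.eval_eq_sum, Polynomial.sum]
  gcongr

namespace PolyBounded

variable {f g : ℕ → ℕ}

theorem const (c : ℕ) : PolyBounded fun _ => c := ⟨.C c, fun n => by simp⟩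

theorem id : PolyBounded fun n => n := ⟨.X, fun n => by simp⟩

theorem add (hf : PolyBounded f) (hg : PolyBounded g) : PolyBounded fun n => f n + g n := by
  obtain ⟨p, hp⟩ := hf
  obtain ⟨q, hq⟩ := hg
  exact ⟨p + q, fun n => by simpa using Nat.add_le_add (hp n) (hq n)⟩

theorem mul (hf : PolyBounded f) (hg : PolyBounded g) : PolyBounded fun n => f n * g n := by
  obtain ⟨p, hp⟩ := hf
  obtain ⟨q, hq⟩ := hg
  exact ⟨p * q, fun n => by simpa using Nat.mul_le_mul (hp n) (hq n)⟩

theorem eval_comp (p : Polynomial ℕ) (hf : PolyBounded f) : PolyBounded fun n => p.eval (f n) := by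
  obtain ⟨q, hq⟩ := hf
  exact ⟨p.comp q, fun n => by simpa using monotone_eval_nat p (hq n)⟩

end PolyBounded

/-! ### Machines with prescribed alphabets -/

namespace Complexity

open Turing StackProgram Function

attribute [local instance] FinTM2.kFin

/-- `ComputesOn M x t m y`: the machine `M` turns the input `x` into the output `y`, in time `t` and
space `m`. -/
def ComputesOn {Γ Γ' : Type} (M : TM2ComputableAux Γ Γ') (x : List Γ) (t : ℕ) (m : ℕ∞)
    (y : List Γ') : Prop :=
  Computes M.tm (x.map M.inputAlphabet.symm) t m (y.map M.outputAlphabet.symm)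

section ComputesOn

variable {Γ Γ' : Type} {M : TM2ComputableAux Γ Γ'}

theorem ComputesOn.mono {x : List Γ} {t t' : ℕ} {m m' : ℕ∞} {y : List Γ'}
    (h : ComputesOn M x t m y) (ht : t ≤ t') (hm : m ≤ m') : ComputesOn M x t' m' y :=
  Program.Runs.mono h ht hm

variable {α β : Type} {ea : α → List Γ} {eb : β → List Γ'} {f : α → β}

theorem ComputesOn.length_le {x : List Γ} {t : ℕ} {m : ℕ∞} {y : List Γ'}
    (h : ComputesOn M x t m y) : (y.length : ℕ∞) ≤ m := by
  simpa only [List.length_map] using Computes.length_output_le h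

theorem exists_computesOn_of_polyTime (h : Nonempty (TM2ComputableInPolyTime ea eb f)) :
    ∃ (M : TM2ComputableAux Γ Γ') (p : Polynomial ℕ), ∀ a,
      ComputesOn M (ea a) (p.eval (ea a).length) (p.eval (ea a).length : ℕ) (eb (f a)) := by
  obtain ⟨M⟩ := h
  let B := (machineProgram M.tm).pushBound
  refine ⟨M.toTM2ComputableAux, M.time + (.X + .C B * M.time), fun a => ?_⟩
  have := (Computes.of_outputsInTime (M.outputsFun a)).bound_space
  rw [height_single, List.length_map] at this
  simp only [Polynomial.eval_add, Polynomial.eval_mul, Polynomial.eval_X, Polynomial.eval_C]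
  exact this.mono (Nat.le_add_right _ _) (Nat.cast_le.2 (Nat.le_add_left _ _))

theorem polyTime_of_computesOn {T : ℕ → ℕ} (hT : PolyBounded T)
    (h : ∀ a, ComputesOn M (ea a) (T (ea a).length) ⊤ (eb (f a))) :
    Nonempty (TM2ComputableInPolyTime ea eb f) := by
  obtain ⟨p, hp⟩ := hT
  exact ⟨⟨M, p, fun a => ((h a).mono (hp _) le_rfl).outputsInTime.some⟩⟩

end ComputesOn

section Classes

variable {Γ : Type} {A : Language Γ}

open Classical in
theorem exists_computesOn_of_mem_PSPACE (h : A ∈ PSPACE Γ) :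
    ∃ (M : TM2ComputableAux Γ Bool) (p : Polynomial ℕ),
      ∀ x, ∃ t, ComputesOn M x t (p.eval x.length : ℕ) [decide (x ∈ A)] := by
  obtain ⟨M, p, hp⟩ := h
  exact ⟨M.toTM2ComputableAux, p, fun x =>
    ⟨_, .of_outputs (M.outputsFun x) fun c hc => by exact_mod_cast hp x c hc⟩⟩

open Classical in
theorem mem_PSPACE_of_computesOn {M : TM2ComputableAux Γ Bool} {s : ℕ → ℕ} (hs : PolyBounded s)
    (h : ∀ x, ∃ t, ComputesOn M x t (s x.length) [decide (x ∈ A)]) : A ∈ PSPACE Γ := by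
  obtain ⟨p, hp⟩ := hs
  choose t ht using h
  refine ⟨⟨M, fun x => (ht x).outputsInTime.some.toTM2Outputs⟩, p, fun x c hc => ?_⟩
  exact Nat.cast_le.1 (((ht x).cfgSpace_le hc).trans (Nat.cast_le.2 (hp _)))

end Classes

end Complexity

namespace StackProgram

open Turing Function Complexity

attribute [local instance] FinTM2.kFin FinTM2.σFin

namespace RegProgram

variable {K : Type} {Γ : K → Type} {τ : Type} {ι : Type} {sub : ι → FinTM2} [DecidableEq K]
  [Fintype K] [DecidableEq ι] [Fintype ι]

/-- The machine that runs the program `P` with the initial values `v` of the variables, the input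
stack `k₀` and the output stack `k₁`. -/
def machine [∀ k, Fintype (Γ k)] [Fintype τ] (P : RegProgram Γ τ sub) (v : τ) (k₀ k₁ : K) :
    TM2ComputableAux (Γ k₀) (Γ k₁) where
  tm :=
    { K := K ⊕ Σ i, (sub i).K
      k₀ := .inl k₀
      k₁ := .inl k₁
      Γ := CombinedStack Γ sub
      Λ := P.Label
      main := P.entry
      σ := RegState Γ τ sub
      initialState := ((none, v), fun i => (sub i).initialState)
      Γk₀Fin := inferInstanceAs (Fintype (Γ k₀))
      m := P.code }
  inputAlphabet := .refl _
  outputAlphabet := .refl _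

theorem DoesWithin.computesOn [∀ k, Fintype (Γ k)] [Fintype τ] {P : RegProgram Γ τ sub} {v : τ}
    {k₀ k₁ : K} {x : List (Γ k₀)} {y : List (Γ k₁)} {t : ℕ} {m : ℕ∞}
    (h : P.DoesWithin (v, single k₀ x) t m (v, single k₁ y)) :
    ComputesOn (P.machine v k₀ k₁) x t m y := by
  have h_idle (k : K) (l : List (Γ k)) : idleMem sub ((v, single k l) : Mem Γ τ) =
      (((none, v), fun i => (sub i).initialState), single (Sum.inl k) l) :=
    congrArg (Prod.mk _) (join_single k l)
  rw [DoesWithin, h_idle, h_idle, ← List.map_id x, ← List.map_id y] at h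
  exact h

end RegProgram

attribute [local instance] FinTM2.kFin

namespace RegProgram

section SingleStack

variable {K : Type} {Γ : K → Type} {τ : Type} {ι : Type} {sub : ι → FinTM2} [DecidableEq K]
  [Fintype K] [DecidableEq ι] [Fintype ι] {k k' : K} [Fintype (Γ k)]

theorem Does.move_single (hk : k ≠ k') (g : Γ k → Γ k') (v : τ) (l : List (Γ k)) :
    (RegProgram.move k k' g : RegProgram Γ τ sub).Does (v, single k l) (l.length * 4 + 1)
      (v, single k' (l.reverse.map g)) := by
  have := move (sub := sub) hk g (v, single k l)
  dsimp only at this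
  rw [single_self] at this
  refine this.congr (congrArg (Prod.mk v) ?_) le_rfl
  rw [update_single, single_nil]
  simp [single, update_of_ne hk.symm]

theorem exists_doesWithin_move_single (hk : k ≠ k') (g : Γ k → Γ k') :
    ∃ C : ℕ, ∀ (v : τ) (l : List (Γ k)),
      (RegProgram.move k k' g : RegProgram Γ τ sub).DoesWithin (v, single k l)
        (C * (l.length + 1)) (C * (l.length + 1) : ℕ) (v, single k' (l.reverse.map g)) := by
  refine ⟨5 * (move k k' g : RegProgram Γ τ sub).pushBound + 5, fun v l => ?_⟩
  have := (Does.move_single (sub := sub) hk g v l).doesWithin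
  refine Program.Runs.mono this (by nlinarith) (Nat.cast_le.2 ?_)
  rw [height_single]
  nlinarith

theorem exists_doesWithin_call_single [Fintype (Γ k')] (i : ι) (g : Γ k → (sub i).Γ (sub i).k₀)
    (g' : (sub i).Γ (sub i).k₁ → Γ k') :
    ∃ C : ℕ, ∀ (v : τ) (l : List (Γ k)) (t m : ℕ) (l' : List ((sub i).Γ (sub i).k₁)),
      Computes (sub i) (l.reverse.map g) t m l' →
      (call i g g' : RegProgram Γ τ sub).DoesWithin (v, single k l) (t + C * (l.length + m + 1))
        (C * (l.length + m + 1) : ℕ) (v, single k' (l'.reverse.map g')) := by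
  obtain ⟨C, hC⟩ := exists_doesWithin_call (Γ := Γ) (τ := τ) i g g'
  refine ⟨C, fun v l t m l' h => ?_⟩
  have := hC (v, single k l) _ t m l' (by simpa only [single_self] using h)
    ((update_single k l []).trans (single_nil k))
  rwa [height_single, List.append_nil] at this

end SingleStack

end RegProgram

/-- The stacks of the machine that composes two functions. -/
inductive CompStack
  | inp | inp' | mid | res | out
  deriving DecidableEq

instance : Fintype CompStack where
  elems := {.inp, .inp', .mid, .res, .out}
  complete k := by cases k <;> decide

/-- The alphabets of the stacks of the machine that composes two functions. -/
abbrev CompStack.Alphabet (Γ Γ' Γ'' : Type) : CompStack → Type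
  | .inp | .inp' => Γ
  | .mid => Γ'
  | .res | .out => Γ''

instance {Γ Γ' Γ'' : Type} [Fintype Γ] [Fintype Γ'] [Fintype Γ''] (k : CompStack) :
    Fintype (CompStack.Alphabet Γ Γ' Γ'' k) := by
  cases k <;> exact inferInstance

section Comp

variable {Γ₁ Γ₂ Γ₃ : Type} (M : TM2ComputableAux Γ₁ Γ₂) (M' : TM2ComputableAux Γ₂ Γ₃)

/-- The subroutines of the program that composes two functions. -/
abbrev compSubroutine : Bool → FinTM2
  | true => M'.tm
  | false => M.tm

/-- The program that composes the functions of two machines. -/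
def compProgram [Fintype Γ₁] [Fintype Γ₂] [Fintype Γ₃] :
    RegProgram (CompStack.Alphabet Γ₁ Γ₂ Γ₃) Unit (compSubroutine M M') :=
  .seq (RegProgram.move .inp .inp' id) <|
  .seq (RegProgram.call (k := .inp') (k' := .mid) false M.inputAlphabet.symm M.outputAlphabet) <|
  .seq (RegProgram.call (k := .mid) (k' := .res) true M'.inputAlphabet.symm M'.outputAlphabet) <|
  RegProgram.move .res .out id

theorem exists_doesWithin_compProgram [Fintype Γ₁] [Fintype Γ₂] [Fintype Γ₃] :
    ∃ C : ℕ, ∀ (x : List Γ₁) (y : List Γ₂) (z : List Γ₃) (t t' m m' : ℕ),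
      ComputesOn M x t m y → ComputesOn M' y t' m' z →
      (compProgram (Γ₃ := Γ₃) M M').DoesWithin ((), single .inp x)
        (t + t' + C * (x.length + m + m' + 1)) (C * (x.length + m + m' + 1) : ℕ)
        ((), single .out z) := by
  obtain ⟨C₁, h_start⟩ := RegProgram.exists_doesWithin_move_single
    (Γ := CompStack.Alphabet Γ₁ Γ₂ Γ₃) (τ := Unit) (sub := compSubroutine M M')
    (k := .inp) (k' := .inp') (by decide) id
  obtain ⟨C₂, h_first⟩ := RegProgram.exists_doesWithin_call_single
    (Γ := CompStack.Alphabet Γ₁ Γ₂ Γ₃) (τ := Unit) (sub := compSubroutine M M')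
    (k := .inp') (k' := .mid) false M.inputAlphabet.symm M.outputAlphabet
  obtain ⟨C₃, h_second⟩ := RegProgram.exists_doesWithin_call_single
    (Γ := CompStack.Alphabet Γ₁ Γ₂ Γ₃) (τ := Unit) (sub := compSubroutine M M')
    (k := .mid) (k' := .res) true M'.inputAlphabet.symm M'.outputAlphabet
  obtain ⟨C₄, h_end⟩ := RegProgram.exists_doesWithin_move_single
    (Γ := CompStack.Alphabet Γ₁ Γ₂ Γ₃) (τ := Unit) (sub := compSubroutine M M')
    (k := .res) (k' := .out) (by decide) id
  refine ⟨C₁ + C₂ + C₃ + C₄, fun x y z t t' m m' h h' => ?_⟩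
  have h₁ := h_start () x
  have h₂ := h_first () x.reverse t m (y.map M.outputAlphabet.symm)
    (by rwa [List.reverse_reverse])
  have h₃ := h_second () y.reverse t' m' (z.map M'.outputAlphabet.symm)
    (by rwa [List.reverse_reverse])
  have h₄ := h_end () z.reverse
  have h_mid : y.length ≤ m := by simpa using h.length_output_le
  have h_out : z.length ≤ m' := by simpa using h'.length_output_le
  simp only [List.length_reverse, List.map_reverse, List.map_map, Equiv.self_comp_symm, List.map_id,
    List.reverse_reverse] at h₁ h₂ h₃ h₄
  have h_const : (C₁ + C₂ + C₃ + C₄) * (x.length + m + m' + 1) =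
    C₁ * (x.length + m + m' + 1) + C₂ * (x.length + m + m' + 1) + C₃ * (x.length + m + m' + 1) +
      C₄ * (x.length + m + m' + 1) := by ring
  have h_le (C n : ℕ) (hn : n ≤ x.length + m + m' + 1) := Nat.mul_le_mul_left C hn
  have hC₁ := h_le C₁ (x.length + 1) (by omega)
  have hC₂ := h_le C₂ (x.length + m + 1) (by omega)
  have hC₃ := h_le C₃ (y.length + m' + 1) (by omega)
  have hC₄ := h_le C₄ (z.length + 1) (by omega)
  rw [h_const]
  refine RegProgram.DoesWithin.mono_time
    ((h₁.mono hC₁ (Nat.cast_le.2 ?_)).seq <| (h₂.mono le_rfl (Nat.cast_le.2 ?_)).seq <|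
      (h₃.mono le_rfl (Nat.cast_le.2 ?_)).seq <| h₄.mono le_rfl (Nat.cast_le.2 ?_)) ?_
  all_goals omega

theorem exists_computesOn_comp [Finite Γ₁] [Finite Γ₂] [Finite Γ₃] :
    ∃ (N : TM2ComputableAux Γ₁ Γ₃) (C : ℕ), ∀ (x : List Γ₁) (y : List Γ₂) (z : List Γ₃)
      (t t' m m' : ℕ), ComputesOn M x t m y → ComputesOn M' y t' m' z →
      ComputesOn N x (t + t' + C * (x.length + m + m' + 1))
        (C * (x.length + m + m' + 1) : ℕ) z := by
  have := Fintype.ofFinite Γ₁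
  have := Fintype.ofFinite Γ₂
  have := Fintype.ofFinite Γ₃
  obtain ⟨C, hC⟩ := exists_doesWithin_compProgram (Γ₃ := Γ₃) M M'
  exact ⟨(compProgram M M').machine () .inp .out, C, fun x y z t t' m m' h h' =>
    (hC x y z t t' m m' h h').computesOn⟩

end Comp

end StackProgram

namespace Complexity

open Turing StackProgram Polynomial

section Comp

variable {Γ Γ' Γ'' : Type} [Finite Γ] [Finite Γ'] [Finite Γ'']

theorem polyTime_comp {α β γ : Type} {ea : α → List Γ} {eb : β → List Γ'} {ec : γ → List Γ''}
    {f : α → β} {g : β → γ} (hg : Nonempty (TM2ComputableInPolyTime eb ec g))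
    (hf : Nonempty (TM2ComputableInPolyTime ea eb f)) :
    Nonempty (TM2ComputableInPolyTime ea ec (g ∘ f)) := by
  obtain ⟨M, p, hM⟩ := exists_computesOn_of_polyTime hf
  obtain ⟨M', q, hM'⟩ := exists_computesOn_of_polyTime hg
  obtain ⟨N, C, hN⟩ := exists_computesOn_comp M M'
  have h_eval : PolyBounded fun n => q.eval (p.eval n) := (PolyBounded.id.eval_comp p).eval_comp q
  refine polyTime_of_computesOn (M := N)
    (T := fun n => p.eval n + q.eval (p.eval n) + C * (n + p.eval n + q.eval (p.eval n) + 1))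
    (((PolyBounded.id.eval_comp p).add h_eval).add <| (PolyBounded.const C).mul <|
      ((PolyBounded.id.add (PolyBounded.id.eval_comp p)).add h_eval).add (.const 1)) fun a => ?_
  have h_le := monotone_eval_nat q (Nat.cast_le.1 (hM a).length_le)
  exact (hN _ _ _ _ _ _ _ (hM a) ((hM' (f a)).mono h_le (Nat.cast_le.2 h_le))).mono le_rfl le_top

/-- The inverse image of a language under a function between words. -/
def preimage {Γ Γ' : Type} (f : List Γ → List Γ') (A : Language Γ') : Language Γ := {x | f x ∈ A}

theorem mem_preimage {Γ Γ' : Type} {f : List Γ → List Γ'} {A : Language Γ'} {x : List Γ} :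
    x ∈ preimage f A ↔ f x ∈ A :=
  Iff.rfl

variable {A : Language Γ'} {f : List Γ → List Γ'}

theorem preimage_mem_PTIME (hA : A ∈ PTIME Γ') (hf : Nonempty (TM2ComputableInPolyTime id id f)) :
    preimage f A ∈ PTIME Γ :=
  polyTime_comp hA hf

theorem preimage_mem_PSPACE (hA : A ∈ PSPACE Γ')
    (hf : Nonempty (TM2ComputableInPolyTime id id f)) :
    preimage f A ∈ PSPACE Γ := by
  obtain ⟨M, p, hM⟩ := exists_computesOn_of_polyTime hf
  obtain ⟨M', q, hM'⟩ := exists_computesOn_of_mem_PSPACE hA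
  obtain ⟨N, C, hN⟩ := exists_computesOn_comp M M'
  refine mem_PSPACE_of_computesOn (M := N)
    (s := fun n => C * (n + p.eval n + q.eval (p.eval n) + 1))
    ((PolyBounded.const C).mul <| ((PolyBounded.id.add (PolyBounded.id.eval_comp p)).add
      ((PolyBounded.id.eval_comp p).eval_comp q)).add (.const 1)) fun x => ?_
  obtain ⟨t, ht⟩ := hM' (f x)
  have h_le := monotone_eval_nat q (Nat.cast_le.1 (hM x).length_le)
  exact ⟨_, hN _ _ _ _ _ _ _ (hM x) (ht.mono le_rfl (Nat.cast_le.2 h_le))⟩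

end Comp

/-! ### Transformations of inputs with certificates -/

open RegProgram Function

section Parts

variable {Γ : Type}

/-- The input in a word that consists of an input and a certificate. -/
def inputPart (z : List (Γ ⊕ Bool)) : List Γ := z.filterMap Sum.getLeft?

/-- The certificate in a word that consists of an input and a certificate. -/
def certificatePart (z : List (Γ ⊕ Bool)) : List Bool := z.filterMap Sum.getRight?

theorem inputPart_withCertificate (x : List Γ) (w : List Bool) :
    inputPart (withCertificate x w) = x := by
  simp [inputPart, withCertificate, Function.comp_def]

theorem certificatePart_withCertificate (x : List Γ) (w : List Bool) :
    certificatePart (withCertificate x w) = w := by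
  simp [certificatePart, withCertificate, Function.comp_def]

theorem length_inputPart_add_length_certificatePart (z : List (Γ ⊕ Bool)) :
    (inputPart z).length + (certificatePart z).length = z.length := by
  induction z with
  | nil => rfl
  | cons s z ih =>
    cases s <;> simp only [inputPart, certificatePart, List.filterMap_cons, Sum.getLeft?_inl,
      Sum.getRight?_inl, Sum.getLeft?_inr, Sum.getRight?_inr, List.length_cons] at ih ⊢ <;> omega

end Parts

/-- The stacks of a machine that transforms an input and its certificate. -/
inductive CertStack
  | inp | inp' | word | cert | aux | word' | cert' | out | arg | acc | sum | tmp
  deriving DecidableEq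

instance : Fintype CertStack where
  elems := {.inp, .inp', .word, .cert, .aux, .word', .cert', .out, .arg, .acc, .sum, .tmp}
  complete k := by cases k <;> decide

/-- The alphabets of the stacks of a machine that transforms an input over `Γ` and its certificate
into an input over `Γ'` and its certificate. The last four stacks hold numbers in unary. -/
abbrev CertStack.Alphabet (Γ Γ' : Type) : CertStack → Type
  | .inp | .inp' => Γ ⊕ Bool
  | .word | .aux => Γ
  | .cert | .cert' => Bool
  | .word' => Γ'
  | .out => Γ' ⊕ Bool
  | .arg | .acc | .sum | .tmp => Unit

instance {Γ Γ' : Type} [Fintype Γ] [Fintype Γ'] (k : CertStack) :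
    Fintype (CertStack.Alphabet Γ Γ' k) := by
  cases k <;> exact inferInstance

section CertProgram

variable {Γ Γ' : Type} {ι : Type} {sub : ι → FinTM2}

/-- A program that transforms an input and its certificate. -/
abbrev CertProgram (Γ Γ' : Type) {ι : Type} (sub : ι → FinTM2) : Type 1 :=
  RegProgram (CertStack.Alphabet Γ Γ') Unit sub

/-- The stacks that hold an input and a certificate, and a transformed input and certificate. -/
def certStacks (x : List Γ) (w : List Bool) (y : List Γ') (w' : List Bool) :
    ∀ k, List (CertStack.Alphabet Γ Γ' k)
  | .word => x
  | .cert => w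
  | .word' => y
  | .cert' => w'
  | _ => []

/-- Push a symbol to the stack for the input or to the stack for the certificate. -/
def sortSymbol : Γ ⊕ Bool → CertProgram Γ Γ' sub
  | .inl a => push .word a
  | .inr b => push .cert b

/-- Separate an input from its certificate. -/
def splitInput [Fintype Γ] : CertProgram Γ Γ' sub :=
  (RegProgram.move .inp .inp' id).seq <|
    forAll .inp' sortSymbol

/-- Combine a transformed input and its certificate, both reversed, into a single word. -/
def joinOutput [Fintype Γ'] : CertProgram Γ Γ' sub :=
  (RegProgram.move .cert' .out Sum.inr).seq (RegProgram.move .word' .out Sum.inl)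

variable [Fintype ι] [DecidableEq ι]

theorem does_splitInput [Fintype Γ] (z : List (Γ ⊕ Bool)) :
    (splitInput : CertProgram Γ Γ' sub).Does ((), single .inp z) (z.length * 8 + 2)
      ((), certStacks (inputPart z) (certificatePart z) [] []) := by
  have h_sort := Does.forAll (Γ := CertStack.Alphabet Γ Γ') (sub := sub) (τ := Unit) (T := 1)
    (k := .inp') (P := sortSymbol)
    (fun z l => ((), update (certStacks (inputPart z) (certificatePart z) [] []) .inp' l))
    (fun z s => s :: z) (fun _ _ => rfl) (fun _ _ _ => update_idem ..) (fun _ _ _ => rfl)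
    (fun z s l => by
      cases s <;> exact (Does.push _ _ _).congr
        (Prod.ext rfl (funext fun k => by cases k <;> rfl)) le_rfl)
    [] z.reverse
  have h_move := Does.move_single (Γ := CertStack.Alphabet Γ Γ') (sub := sub) (τ := Unit)
    (k := .inp) (k' := .inp') (by decide) id () z
  have h_empty : single (Γ := CertStack.Alphabet Γ Γ') .inp' z.reverse =
    update (certStacks [] [] [] []) .inp' z.reverse := funext fun k => by cases k <;> rfl
  rw [List.map_id, h_empty] at h_move
  refine (h_move.seq h_sort).congr (Prod.ext rfl (funext fun k => ?_)) ?_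
  · rw [List.foldl_flip_cons_eq_append']
    cases k <;> simp [certStacks]
  · rw [List.length_reverse]
    omega

theorem does_joinOutput [Fintype Γ'] (y : List Γ') (w : List Bool) :
    (joinOutput : CertProgram Γ Γ' sub).Does ((), certStacks [] [] y.reverse w.reverse)
      (y.length * 4 + w.length * 4 + 2) ((), single .out (withCertificate y w)) := by
  refine ((Does.move (by decide) _ _).seq (Does.move (by decide) _ _)).congr ?_ ?_
  · refine Prod.ext rfl (funext fun k => ?_)
    cases k <;> simp [certStacks, single, withCertificate]
  · simp [certStacks]
    omega

theorem height_certStacks (x : List Γ) (w : List Bool) (y : List Γ') (w' : List Bool) :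
    height (certStacks x w y w') = x.length + w.length + y.length + w'.length := by
  simp [height, certStacks, Finset.univ, Fintype.elems]
  omega

theorem polyTime_of_certProgram [Finite Γ] [Finite Γ'] {F : List Γ → List Bool → List Γ'}
    {G : List Γ → List Bool → List Bool} (P : CertProgram Γ Γ' sub) {T : ℕ → ℕ}
    (hT : PolyBounded T)
    (h : ∀ x w, P.Does ((), certStacks x w [] []) (T (x.length + w.length))
      ((), certStacks [] [] (F x w).reverse (G x w).reverse)) :
    Nonempty (TM2ComputableInPolyTime (id : List (Γ ⊕ Bool) → _) (id : List (Γ' ⊕ Bool) → _)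
      fun z => withCertificate (F (inputPart z) (certificatePart z))
        (G (inputPart z) (certificatePart z))) := by
  have := Fintype.ofFinite Γ
  have := Fintype.ofFinite Γ'
  refine polyTime_of_computesOn
    (M := RegProgram.machine (splitInput.seq (P.seq joinOutput)) () CertStack.inp CertStack.out)
    (T := fun n => n * 8 + 2 + (T n + ((n + P.pushBound * T n) * 4 + 2)))
    (((PolyBounded.id.mul (.const 8)).add (.const 2)).add <| hT.add <|
      ((PolyBounded.id.add ((PolyBounded.const _).mul hT)).mul (.const 4)).add (.const 2))
    fun z => RegProgram.DoesWithin.computesOn ?_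
  set x := inputPart z
  set w := certificatePart z
  have h_length : x.length + w.length = z.length := length_inputPart_add_length_certificatePart z
  have h_output := h x w
  have h_height := Does.height_le h_output
  simp only [height_certStacks, List.length_reverse, List.length_nil, h_length] at h_height
  rw [h_length] at h_output
  refine DoesWithin.mono_time (DoesWithin.seq (does_splitInput z)
    (DoesWithin.seq h_output (does_joinOutput _ _))) ?_
  simp only [id_eq]
  omega

end CertProgram

/-! ### Unary arithmetic -/

section Unary

variable {Γ Γ' : Type} {ι : Type} {sub : ι → FinTM2}

/-- The stacks `S` with the numbers `n`, `a`, `s`, `t` on the four stacks for numbers. -/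
def unaryStacks (S : ∀ k, List (CertStack.Alphabet Γ Γ' k)) (n a s t : ℕ) :
    ∀ k, List (CertStack.Alphabet Γ Γ' k)
  | .arg => List.replicate n ()
  | .acc => List.replicate a ()
  | .sum => List.replicate s ()
  | .tmp => List.replicate t ()
  | k => S k

/-- Add `arg` to `sum`. -/
def addArg : CertProgram Γ Γ' sub :=
  (forAll .arg fun _ => (push .sum ()).seq (push .tmp ())).seq (RegProgram.move .tmp .arg id)

/-- Multiply `acc` by `arg`. -/
def mulArg : CertProgram Γ Γ' sub :=
  (forAll .acc fun _ => addArg).seq (RegProgram.move .sum .acc id)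

theorem replicate_length_unit (l : List Unit) : List.replicate l.length () = l :=
  (List.eq_replicate_of_mem fun _ _ => rfl).symm

theorem foldl_replicate_add (m n x : ℕ) :
    (List.replicate m ()).foldl (fun x _ => x + n) x = x + m * n := by
  induction m generalizing x with
  | zero => simp
  | succ m ih => rw [List.replicate_succ, List.foldl_cons, ih]; ring

variable [Fintype ι] [DecidableEq ι]

theorem does_addArg (S : ∀ k, List (CertStack.Alphabet Γ Γ' k)) (n a s : ℕ) :
    (addArg : CertProgram Γ Γ' sub).Does ((), unaryStacks S n a s 0) (n * 9 + 2)
      ((), unaryStacks S n a (s + n) 0) := by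
  have h_loop := Does.forAll (Γ := CertStack.Alphabet Γ Γ') (τ := Unit) (sub := sub) (T := 2)
    (k := .arg) (P := fun _ => (push .sum ()).seq (push .tmp ()))
    (fun x (l : List Unit) => ((), unaryStacks S l.length a (s + x) x)) (fun x _ => x + 1)
    (fun _ l => replicate_length_unit l) (fun x _ l => funext fun k => by
      cases k <;> first | rfl | exact (replicate_length_unit l).symm)
    (fun _ _ _ => rfl)
    (fun x _ l => DoesWithin.congr ((Does.push _ _ _).seq (Does.push _ _ _))
      (Prod.ext rfl (funext fun k => by cases k <;> rfl)) le_rfl)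
    0 (List.replicate n ())
  rw [foldl_replicate_add, List.length_replicate, Nat.zero_add, Nat.mul_one] at h_loop
  refine (h_loop.seq (Does.move (by decide) _ _)).congr (Prod.ext rfl (funext fun k => ?_)) ?_
  · cases k <;> simp [unaryStacks]
  · simp only [unaryStacks, List.length_replicate]
    omega

theorem does_mulArg (S : ∀ k, List (CertStack.Alphabet Γ Γ' k)) (n a : ℕ) :
    (mulArg : CertProgram Γ Γ' sub).Does ((), unaryStacks S n a 0 0) (a * (n * 13 + 5) + 2)
      ((), unaryStacks S n (a * n) 0 0) := by
  have h_loop := Does.forAll (Γ := CertStack.Alphabet Γ Γ') (τ := Unit) (sub := sub)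
    (k := .acc) (P := fun _ => addArg)
    (fun x (l : List Unit) => ((), unaryStacks S n l.length x 0)) (fun x _ => x + n)
    (fun _ l => replicate_length_unit l) (fun x _ l => funext fun k => by
      cases k <;> first | rfl | exact (replicate_length_unit l).symm)
    (fun _ _ _ => rfl) (fun x _ l => does_addArg S n l.length x) 0 (List.replicate a ())
  rw [foldl_replicate_add, List.length_replicate, Nat.zero_add] at h_loop
  refine (h_loop.seq (Does.move (by decide) _ _)).congr (Prod.ext rfl (funext fun k => ?_)) ?_
  · cases k <;> simp [unaryStacks]
  · simp only [unaryStacks, List.length_replicate]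
    exact le_of_eq (by ring)

theorem exists_does_eval (q : Polynomial ℕ) :
    ∃ (P : CertProgram Γ Γ' sub) (p : Polynomial ℕ), ∀ S n,
      P.Does ((), unaryStacks S n 0 0 0) (p.eval n) ((), unaryStacks S n (q.eval n) 0 0) := by
  induction q using Polynomial.recOnHorner with
  | M0 => exact ⟨skip, 1, fun S n => by simpa using Does.skip ((), unaryStacks S n 0 0 0)⟩
  | MC q a _ _ ih =>
    obtain ⟨P, p, h⟩ := ih
    refine ⟨P.seq (pushList .acc (List.replicate a ())), p + .C (a + 1), fun S n => ?_⟩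
    refine DoesWithin.congr ((h S n).seq (Does.pushList _ _ _))
      (Prod.ext rfl (funext fun k => ?_)) ?_
    · cases k <;> try rfl
      simp [unaryStacks, Nat.add_comm]
    · simp
  | MX q _ ih =>
    obtain ⟨P, p, h⟩ := ih
    refine ⟨P.seq mulArg, p + (q * (.X * 13 + 5) + 2), fun S n => ?_⟩
    exact DoesWithin.congr ((h S n).seq (does_mulArg S n _)) (by simp) (by simp)

end Unary

/-! ### Nondeterministic polynomial time -/

section Truncate

variable {Γ : Type} {ι : Type} {sub : ι → FinTM2}

/-- Copy the input and count its symbols in `arg`. -/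
def countInput [Fintype Γ] : CertProgram Γ Γ sub :=
  forAll .word fun a => (push .word' a).seq (push .arg ())

/-- Copy a bit of the certificate, if there is one. -/
def copyBit : Option Bool → CertProgram Γ Γ sub
  | some b => push .cert' b
  | none => skip

/-- Copy as many bits of the certificate as the number `acc` tells. -/
def takeBits : CertProgram Γ Γ sub := forAll .acc fun _ => pop .cert copyBit

variable [Fintype ι] [DecidableEq ι]

theorem does_countInput [Fintype Γ] (x : List Γ) (w : List Bool) :
    (countInput : CertProgram Γ Γ sub).Does ((), certStacks x w [] []) (x.length * 5 + 1)
      ((), unaryStacks (certStacks [] w x.reverse []) x.length 0 0 0) := by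
  have h_loop := Does.forAll (Γ := CertStack.Alphabet Γ Γ) (τ := Unit) (sub := sub) (T := 1 + 1)
    (k := .word) (P := fun a => (push .word' a).seq (push .arg ()))
    (fun y (l : List Γ) => ((), unaryStacks (certStacks l w y []) y.length 0 0 0))
    (fun y a => a :: y) (fun _ _ => rfl) (fun _ _ _ => funext fun k => by cases k <;> rfl)
    (fun _ _ _ => rfl)
    (fun y a l => DoesWithin.congr ((Does.push _ _ _).seq (Does.push _ _ _))
      (Prod.ext rfl (funext fun k => by cases k <;> rfl)) le_rfl) [] x
  have h_start : unaryStacks (certStacks x w [] []) 0 0 0 0 =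
    certStacks (Γ' := Γ) x w [] [] := funext fun k => by cases k <;> rfl
  rw [List.foldl_flip_cons_eq_append', List.append_nil, List.length_reverse, List.length_nil,
    h_start] at h_loop
  exact h_loop

theorem does_pop_copyBit (y : List Γ) (w : List Bool) (n m i : ℕ) :
    (pop .cert copyBit : CertProgram Γ Γ sub).Does
      ((), unaryStacks (certStacks [] (w.drop i) y (w.take i).reverse) n m 0 0) (1 + 3)
      ((), unaryStacks (certStacks [] (w.drop (i + 1)) y (w.take (i + 1)).reverse) n m 0 0) := by
  refine Does.pop (w.drop i) rfl ?_
  rw [List.head?_drop, List.tail_drop, List.take_add_one]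
  cases w[i]? with
  | none =>
    refine DoesWithin.congr (Does.skip _) (Prod.ext rfl (funext fun k => ?_)) le_rfl
    cases k <;> simp [unaryStacks, certStacks]
  | some b =>
    refine DoesWithin.congr (Does.push _ _ _) (Prod.ext rfl (funext fun k => ?_)) le_rfl
    cases k <;> simp [unaryStacks, certStacks]

theorem does_takeBits (y : List Γ) (w : List Bool) (n m : ℕ) :
    (takeBits : CertProgram Γ Γ sub).Does ((), unaryStacks (certStacks [] w y []) n m 0 0)
      (m * 7 + 1)
      ((), unaryStacks (certStacks [] (w.drop m) y (w.take m).reverse) n 0 0 0) := by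
  have h_loop := Does.forAll (Γ := CertStack.Alphabet Γ Γ) (τ := Unit) (sub := sub)
    (k := .acc) (P := fun _ => pop .cert copyBit)
    (fun i (l : List Unit) =>
      ((), unaryStacks (certStacks [] (w.drop i) y (w.take i).reverse) n l.length 0 0))
    (fun i _ => i + 1) (fun _ l => replicate_length_unit l) (fun _ _ l => funext fun k => by
      cases k <;> first | rfl | exact (replicate_length_unit l).symm)
    (fun _ _ _ => rfl) (fun i _ l => does_pop_copyBit y w n l.length i) 0 (List.replicate m ())
  rw [foldl_replicate_add, List.length_replicate, Nat.zero_add, Nat.mul_one] at h_loop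
  exact h_loop

theorem polyTime_truncate [Finite Γ] (q : Polynomial ℕ) :
    Nonempty (TM2ComputableInPolyTime (id : List (Γ ⊕ Bool) → _) id fun z : List (Γ ⊕ Bool) =>
      withCertificate (inputPart z)
        ((certificatePart z).take (q.eval (inputPart z).length))) := by
  have := Fintype.ofFinite Γ
  obtain ⟨E, p, hE⟩ := exists_does_eval (Γ := Γ) (Γ' := Γ) (sub := Empty.rec) q
  refine polyTime_of_certProgram (F := fun x _ => x) (G := fun x w => w.take (q.eval x.length))
    (countInput.seq <| E.seq <| takeBits.seq <| (clear .cert).seq (clear .arg))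
    (T := fun n => n * 13 + p.eval n + q.eval n * 7 + 4) ?_ fun x w => ?_
  · exact (((PolyBounded.id.mul (.const 13)).add (.eval_comp p .id)).add
      ((PolyBounded.eval_comp q .id).mul (.const 7))).add (.const 4)
  have h := (does_countInput x w).seq <| (hE _ _).seq <| (does_takeBits _ w _ _).seq <|
    (Does.clear (k := CertStack.cert) _).seq (Does.clear (k := CertStack.arg) _)
  refine h.congr (Prod.ext rfl (funext fun k => ?_)) ?_
  · cases k <;> simp [unaryStacks, certStacks]
  · have h_p := monotone_eval_nat p (Nat.le_add_right x.length w.length)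
    have h_q := monotone_eval_nat q (Nat.le_add_right x.length w.length)
    simp only [unaryStacks, certStacks, update_of_ne, List.length_drop, List.length_replicate,
      ne_eq, reduceCtorEq, not_false_eq_true] at h_p h_q ⊢
    omega

end Truncate

attribute [local instance] FinTM2.kFin

section NP

variable {Γ Γ' : Type} [Finite Γ]

theorem exists_verifier_of_mem_NP {A : Language Γ} (hA : A ∈ NP Γ) :
    ∃ R ∈ PTIME (Γ ⊕ Bool), ∃ q : Polynomial ℕ,
      (∀ x ∈ A, ∃ w : List Bool, w.length ≤ q.eval x.length ∧ withCertificate x w ∈ R) ∧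
      ∀ x w, withCertificate x w ∈ R → x ∈ A := by
  obtain ⟨R, hR, q, hq⟩ := hA
  refine ⟨_, preimage_mem_PTIME hR (polyTime_truncate q), q, fun x hx => ?_, fun x w hw => ?_⟩
  · obtain ⟨w, hw, hxw⟩ := (hq x).1 hx
    refine ⟨w, hw, ?_⟩
    rwa [mem_preimage, inputPart_withCertificate, certificatePart_withCertificate,
      List.take_of_length_le hw]
  · rw [mem_preimage, inputPart_withCertificate, certificatePart_withCertificate] at hw
    exact (hq x).2 ⟨_, List.length_take_le _ _, hw⟩

variable [Finite Γ']

theorem polyTime_mapInput {f : List Γ → List Γ'} (hf : Nonempty (TM2ComputableInPolyTime id id f)) :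
    Nonempty (TM2ComputableInPolyTime (id : List (Γ ⊕ Bool) → _) (id : List (Γ' ⊕ Bool) → _)
      fun z => withCertificate (f (inputPart z)) (certificatePart z)) := by
  have := Fintype.ofFinite Γ
  have := Fintype.ofFinite Γ'
  obtain ⟨M, p, hM⟩ := exists_computesOn_of_polyTime hf
  let sub : Unit → FinTM2 := fun _ => M.tm
  obtain ⟨C, h_call⟩ := exists_doesWithin_call (Γ := CertStack.Alphabet Γ Γ') (τ := Unit)
    (sub := sub) (k := .aux) (k' := .word') () M.inputAlphabet.symm M.outputAlphabet
  refine polyTime_of_certProgram (sub := sub) (F := fun x _ => f x) (G := fun _ w => w)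
    ((RegProgram.move .word .aux id).seq <|
      .seq (call (k := .aux) (k' := .word') () M.inputAlphabet.symm M.outputAlphabet) <|
      RegProgram.move .cert .cert' id)
    (T := fun n => n * 4 + 1 + (p.eval n + C * (n + p.eval n + 1) + (n * 4 + 1)))
    (((PolyBounded.id.mul (.const 4)).add (.const 1)).add <|
      ((PolyBounded.id.eval_comp p).add <| (PolyBounded.const C).mul <|
        (PolyBounded.id.add (PolyBounded.id.eval_comp p)).add (.const 1)).add <|
      (PolyBounded.id.mul (.const 4)).add (.const 1)) fun x w => ?_
  have h_start := (Does.move (Γ := CertStack.Alphabet Γ Γ') (τ := Unit) (sub := sub) (k := .word)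
    (k' := .aux) (by decide) id ((), certStacks x w [] [])).congr
    (s'' := ((), update (certStacks [] w [] []) .aux x.reverse))
    (Prod.ext rfl (funext fun k => by cases k <;> simp [certStacks])) le_rfl
  have h_compute := h_call ((), update (certStacks [] w [] []) .aux x.reverse)
    (certStacks [] w [] []) (p.eval x.length) (p.eval x.length)
    ((f x).map M.outputAlphabet.symm) (by
      simp only [update_self, List.reverse_reverse]
      exact hM x)
    (funext fun k => by cases k <;> simp [certStacks])
  have h_end := Does.move (Γ := CertStack.Alphabet Γ Γ') (τ := Unit) (sub := sub) (k := .cert)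
    (k' := .cert') (by decide) id ((), certStacks [] w (f x).reverse [])
  have h_height : height (update (certStacks (Γ' := Γ') [] w [] []) .aux x.reverse) =
      x.length + w.length := by
    simp [height, certStacks, Finset.univ, Fintype.elems, Nat.add_comm]
  have h_p := monotone_eval_nat p (Nat.le_add_right x.length w.length)
  refine (h_start.seq <| ((h_compute.mono le_rfl le_top).congr ?_ le_rfl).seq h_end).congr ?_ ?_
  · refine Prod.ext rfl (funext fun k => ?_)
    cases k <;> simp [certStacks, Function.comp_def]
  · refine Prod.ext rfl (funext fun k => ?_)
    cases k <;> simp [certStacks]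
  · simp only [h_height]
    gcongr
    · exact Nat.le_add_right _ _
    · exact Nat.le_add_left _ _

theorem preimage_mem_NP {A : Language Γ'} {f : List Γ → List Γ'} (hA : A ∈ NP Γ')
    (hf : Nonempty (TM2ComputableInPolyTime id id f)) : preimage f A ∈ NP Γ := by
  obtain ⟨R, hR, q, h_complete, h_sound⟩ := exists_verifier_of_mem_NP hA
  obtain ⟨M, p, hM⟩ := exists_computesOn_of_polyTime hf
  refine ⟨_, preimage_mem_PTIME hR (polyTime_mapInput hf), q.comp p, fun x => ⟨fun hx => ?_, ?_⟩⟩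
  · obtain ⟨w, hw, hxw⟩ := h_complete _ hx
    refine ⟨w, hw.trans ?_, ?_⟩
    · rw [Polynomial.eval_comp]
      exact monotone_eval_nat q (Nat.cast_le.1 (hM x).length_le)
    · rwa [mem_preimage, inputPart_withCertificate, certificatePart_withCertificate]
  · rintro ⟨w, -, hw⟩
    rw [mem_preimage, inputPart_withCertificate, certificatePart_withCertificate] at hw
    exact h_sound _ _ hw

end NP

section Marks

variable {Γ : Type}

/-- The words over `Γ` whose symbols can be marked with bits such that the marked word belongs to
`C`. -/
def markedProjection (C : Language (Γ × Bool)) : Language Γ := {x | ∃ a ∈ C, a.map Prod.fst = x}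

/-- Mark the symbols of a word with the bits of a list, and with `false` where the list is too
short. -/
def attachMarks : List Γ → List Bool → List (Γ × Bool)
  | [], _ => []
  | a :: x, w => (a, w.headD false) :: attachMarks x w.tail

theorem map_fst_attachMarks (x : List Γ) (w : List Bool) :
    (attachMarks x w).map Prod.fst = x := by
  induction x generalizing w with
  | nil => rfl
  | cons a x ih => exact congrArg (a :: ·) (ih _)

theorem attachMarks_map_append (a : List (Γ × Bool)) (w : List Bool) :
    attachMarks (a.map Prod.fst) (a.map Prod.snd ++ w) = a := by
  induction a with
  | nil => rfl
  | cons s a ih => exact congrArg (s :: ·) ih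

theorem foldl_attachMarks (x : List Γ) (w : List Bool) (y : List (Γ × Bool)) :
    x.foldl (fun z a => ((a, z.2.headD false) :: z.1, z.2.tail)) (y, w) =
      ((attachMarks x w).reverse ++ y, w.drop x.length) := by
  induction x generalizing w y with
  | nil => rfl
  | cons a x ih =>
    rw [List.foldl_cons, ih]
    simp [attachMarks]

/-- Mark each symbol of the input with a bit of the certificate. -/
def markWord [Fintype Γ] {ι : Type} {sub : ι → FinTM2} : CertProgram Γ (Γ × Bool) sub :=
  forAll .word fun a => pop .cert fun b => push .word' (a, b.getD false)

theorem does_markWord [Fintype Γ] {ι : Type} [Fintype ι] [DecidableEq ι] {sub : ι → FinTM2}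
    (x : List Γ) (w : List Bool) :
    (markWord : CertProgram Γ (Γ × Bool) sub).Does ((), certStacks x w [] [])
      (x.length * (1 + 3 + 3) + 1)
      ((), certStacks [] (w.drop x.length) (attachMarks x w).reverse []) := by
  have h_loop := Does.forAll (Γ := CertStack.Alphabet Γ (Γ × Bool)) (τ := Unit) (sub := sub)
    (k := .word) (P := fun a => pop .cert fun b => push .word' (a, b.getD false)) (T := 1 + 3)
    (fun (z : List (Γ × Bool) × List Bool) l => ((), certStacks l z.2 z.1 []))
    (fun z a => ((a, z.2.headD false) :: z.1, z.2.tail)) (fun _ _ => rfl)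
    (fun _ _ _ => funext fun k => by cases k <;> rfl) (fun _ _ _ => rfl)
    (fun z a l => Does.pop z.2 rfl <| (Does.push _ _ _).congr
      (Prod.ext rfl (funext fun k => by cases k <;> simp [certStacks])) le_rfl)
    ([], w) x
  rw [foldl_attachMarks, List.append_nil] at h_loop
  exact h_loop

theorem polyTime_attachMarks [Finite Γ] :
    Nonempty (TM2ComputableInPolyTime (id : List (Γ ⊕ Bool) → _) (id : List (Γ × Bool ⊕ Bool) → _)
      fun z => withCertificate (attachMarks (inputPart z) (certificatePart z))
        ((certificatePart z).drop (inputPart z).length)) := by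
  have := Fintype.ofFinite Γ
  refine polyTime_of_certProgram (sub := Empty.rec) (F := attachMarks)
    (G := fun x w => w.drop x.length) (markWord.seq (RegProgram.move .cert .cert' id))
    (T := fun n => n * (1 + 3 + 3) + 1 + (n * 4 + 1))
    (((PolyBounded.id.mul (.const _)).add (.const 1)).add <|
      (PolyBounded.id.mul (.const 4)).add (.const 1)) fun x w => ?_
  refine ((does_markWord x w).seq (Does.move (by decide) _ _)).congr ?_ ?_
  · refine Prod.ext rfl (funext fun k => ?_)
    cases k <;> simp [certStacks]
  · simp only [certStacks, List.length_drop]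
    omega

theorem markedProjection_mem_NP [Finite Γ] {C : Language (Γ × Bool)} (hC : C ∈ NP (Γ × Bool)) :
    markedProjection C ∈ NP Γ := by
  obtain ⟨R, hR, q, h_complete, h_sound⟩ := exists_verifier_of_mem_NP hC
  refine ⟨_, preimage_mem_PTIME hR polyTime_attachMarks, .X + q, fun x => ⟨?_, ?_⟩⟩
  · rintro ⟨a, ha, rfl⟩
    obtain ⟨w, hw, haw⟩ := h_complete a ha
    refine ⟨a.map Prod.snd ++ w, by simpa using hw, ?_⟩
    rw [mem_preimage, inputPart_withCertificate, certificatePart_withCertificate,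
      attachMarks_map_append, List.length_map, ← List.length_map (f := Prod.snd), List.drop_left]
    exact haw
  · rintro ⟨w, -, hw⟩
    rw [mem_preimage, inputPart_withCertificate, certificatePart_withCertificate] at hw
    exact ⟨_, h_sound _ _ hw, map_fst_attachMarks x w⟩

end Marks

/-! ### Search through all markings -/

section Counter

variable {Γ : Type}

/-- The marks of a word as a binary number, the first mark being the least significant digit. -/
def markValue : List (Γ × Bool) → ℕ
  | [] => 0
  | s :: a => s.2.toNat + 2 * markValue a

/-- Add a carry to the binary number that is given by the marks of a word; the second component is
the resulting carry. -/
def addCarry : Bool → List (Γ × Bool) → List (Γ × Bool) × Bool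
  | c, [] => ([], c)
  | c, s :: a => ((s.1, xor s.2 c) :: (addCarry (c && s.2) a).1, (addCarry (c && s.2) a).2)

theorem map_fst_addCarry (c : Bool) (a : List (Γ × Bool)) :
    (addCarry c a).1.map Prod.fst = a.map Prod.fst := by
  induction a generalizing c with
  | nil => rfl
  | cons s a ih => simp [addCarry, ih]

theorem length_addCarry (c : Bool) (a : List (Γ × Bool)) :
    (addCarry c a).1.length = a.length := by
  simpa using congrArg List.length (map_fst_addCarry c a)

theorem markValue_addCarry (c : Bool) (a : List (Γ × Bool)) :
    markValue (addCarry c a).1 + 2 ^ a.length * (addCarry c a).2.toNat =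
      markValue a + c.toNat := by
  induction a generalizing c with
  | nil => simp [addCarry, markValue]
  | cons s a ih =>
    have h_tail := ih (c && s.2)
    have h_digit : (xor s.2 c).toNat + 2 * (c && s.2).toNat = s.2.toNat + c.toNat := by
      cases s.2 <;> cases c <;> rfl
    simp only [addCarry, markValue, List.length_cons, pow_succ]
    linarith

theorem foldl_addCarry (c : Bool) (a z : List (Γ × Bool)) :
    a.foldl (fun z s => ((s.1, xor s.2 z.2) :: z.1, z.2 && s.2)) (z, c) =
      ((addCarry c a).1.reverse ++ z, (addCarry c a).2) := by
  induction a generalizing c z with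
  | nil => rfl
  | cons s a ih =>
    rw [List.foldl_cons, ih]
    simp [addCarry]

theorem markValue_lt (a : List (Γ × Bool)) : markValue a < 2 ^ a.length := by
  induction a with
  | nil => exact Nat.one_pos
  | cons s a ih =>
    have := Bool.toNat_le s.2
    rw [markValue, List.length_cons, pow_succ]
    omega

theorem markValue_injective {a a' : List (Γ × Bool)} (h : a.map Prod.fst = a'.map Prod.fst)
    (h_value : markValue a = markValue a') : a = a' := by
  induction a generalizing a' with
  | nil => simpa using h
  | cons s a ih =>
    obtain _ | ⟨s', a'⟩ := a'
    · cases h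
    obtain ⟨h_head, h_tail⟩ := List.cons.inj h
    have := Bool.toNat_le s.2
    have := Bool.toNat_le s'.2
    simp only [markValue] at h_value
    have h_digit : s.2.toNat = s'.2.toNat := by omega
    have h_mark : s.2 = s'.2 := by
      cases h : s.2 <;> cases h' : s'.2 <;> simp_all
    rw [Prod.ext h_head h_mark, ih h_tail (by omega)]

theorem markValue_map_false (x : List Γ) : markValue (x.map fun s => (s, false)) = 0 := by
  induction x with
  | nil => rfl
  | cons s x ih => simp [markValue, ih]

/-- Some marking of the word that is marked in `a` is in the language and not before `a`. -/
def HasMarkingFrom (A : Language (Γ × Bool)) (a : List (Γ × Bool)) : Prop :=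
  ∃ a' ∈ A, a'.map Prod.fst = a.map Prod.fst ∧ markValue a ≤ markValue a'

theorem HasMarkingFrom.exists_lt {A : Language (Γ × Bool)} {a : List (Γ × Bool)} (ha : a ∉ A)
    (h : HasMarkingFrom A a) :
    ∃ a' ∈ A, a'.map Prod.fst = a.map Prod.fst ∧ markValue a < markValue a' := by
  obtain ⟨a', ha', h_fst, h_le⟩ := h
  exact ⟨a', ha', h_fst, h_le.lt_of_ne fun h => ha (markValue_injective h_fst h.symm ▸ ha')⟩

theorem not_hasMarkingFrom {A : Language (Γ × Bool)} {a : List (Γ × Bool)} (ha : a ∉ A)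
    (h_carry : (addCarry true a).2 = true) : ¬ HasMarkingFrom A a := fun h => by
  obtain ⟨a', -, h_fst, h_lt⟩ := h.exists_lt ha
  have h_value := markValue_addCarry true a
  have h_length : a'.length = a.length := by simpa using congrArg List.length h_fst
  have h_bound := markValue_lt a'
  rw [h_carry, Bool.toNat_true, mul_one] at h_value
  rw [h_length] at h_bound
  omega

theorem hasMarkingFrom_addCarry {A : Language (Γ × Bool)} {a : List (Γ × Bool)} (ha : a ∉ A)
    (h_carry : ¬ (addCarry true a).2 = true) :
    HasMarkingFrom A (addCarry true a).1 ↔ HasMarkingFrom A a := by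
  have h_value := markValue_addCarry true a
  rw [Bool.eq_false_of_not_eq_true h_carry, Bool.toNat_false, mul_zero, add_zero,
    Bool.toNat_true] at h_value
  constructor
  · rintro ⟨a', ha', h_fst, h_le⟩
    exact ⟨a', ha', h_fst.trans (map_fst_addCarry true a), by omega⟩
  · intro h
    obtain ⟨a', ha', h_fst, h_lt⟩ := h.exists_lt ha
    exact ⟨a', ha', h_fst.trans (map_fst_addCarry true a).symm, by omega⟩

theorem hasMarkingFrom_map_false {A : Language (Γ × Bool)} {x : List Γ} :
    HasMarkingFrom A (x.map fun s => (s, false)) ↔ x ∈ markedProjection A := by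
  simp only [HasMarkingFrom, markValue_map_false, Nat.zero_le, and_true, List.map_map,
    Function.comp_def, List.map_id']
  rfl

end Counter

/-- The states of the search: going on, adding the carry `1` to the marks, having found a marking,
and having tried all the markings. -/
inductive SearchState
  | searching | carrying | found | failed
  deriving DecidableEq

instance : Fintype SearchState where
  elems := {.searching, .carrying, .found, .failed}
  complete v := by cases v <;> decide

/-- The state of a search that is going on. -/
def SearchState.isSearching : SearchState → Bool
  | .searching => true
  | _ => false

/-- The stacks of a machine that searches through all markings of a word. -/
inductive SearchStack
  | inp | marked | marked' | query | answer | out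
  deriving DecidableEq

instance : Fintype SearchStack where
  elems := {.inp, .marked, .marked', .query, .answer, .out}
  complete k := by cases k <;> decide

/-- The alphabets of the stacks of a machine that searches through all markings of a word. -/
abbrev SearchStack.Alphabet (Γ : Type) : SearchStack → Type
  | .inp => Γ
  | .marked | .marked' | .query => Γ × Bool
  | .answer | .out => Bool

instance {Γ : Type} [Fintype Γ] (k : SearchStack) : Fintype (SearchStack.Alphabet Γ k) := by
  cases k <;> exact inferInstance

section Search

/-- A program for the search through all markings of a word. -/
abbrev SearchProgram (Γ : Type) {ι : Type} (sub : ι → FinTM2) : Type 1 :=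
  RegProgram (SearchStack.Alphabet Γ) SearchState sub

variable {Γ : Type} {ι : Type} {sub : ι → FinTM2}

/-- Mark all the symbols of the input with `false`. -/
def startSearch [Fintype Γ] : SearchProgram Γ sub :=
  (RegProgram.move .inp .marked' fun s => (s, false)).seq (RegProgram.move .marked' .marked id)

/-- Copy the marked word. -/
def copyMarked [Fintype Γ] : SearchProgram Γ sub :=
  (forAll .marked fun s => (push .marked' s).seq (push .query s)).seq
    (RegProgram.move .marked' .marked id)

/-- Add the carry to a mark. -/
def carryMark (s : Γ × Bool) : SearchState → SearchProgram Γ sub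
  | .carrying => (push .marked' (s.1, !s.2)).seq <|
      assign fun _ => if s.2 then .carrying else .searching
  | _ => push .marked' s

/-- Go on to the next marking. -/
def nextMarking [Fintype Γ] : SearchProgram Γ sub :=
  (assign fun _ => .carrying).seq <| (forAll .marked fun s => switch (carryMark s)).seq <|
    (RegProgram.move .marked' .marked id).seq <|
      assign fun v => if v = .carrying then .failed else .searching

/-- Stop if the answer is positive, and go on to the next marking otherwise. -/
def processAnswer [Fintype Γ] : Option Bool → SearchProgram Γ sub
  | some true => assign fun _ => .found
  | _ => nextMarking

/-- Output the result of the search. -/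
def finishSearch [Fintype Γ] : SearchProgram Γ sub :=
  (clear .marked).seq <| (switch fun v => push .out (decide (v = .found))).seq <|
    assign fun _ => .searching

/-- The contents of the stacks while the marked word is being read. -/
def searchStacks (a a' q : List (Γ × Bool)) : ∀ k, List (SearchStack.Alphabet Γ k)
  | .marked => a
  | .marked' => a'
  | .query => q
  | .inp | .answer | .out => []

theorem searchStacks_nil (a : List (Γ × Bool)) : searchStacks a [] [] = single .marked a :=
  funext fun k => by cases k <;> simp [searchStacks, single]

/-- The state that remembers a carry. -/
def carryState (c : Bool) : SearchState := if c then .carrying else .searching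

/-- The memory after the marking `a` has been replaced by the next one, if there is one. -/
def nextMem (a : List (Γ × Bool)) : Mem (SearchStack.Alphabet Γ) SearchState :=
  (if (addCarry true a).2 then .failed else .searching, single .marked (addCarry true a).1)

open Classical in
/-- The memory after the marking `a` has been tried. -/
noncomputable def searchStep (A : Language (Γ × Bool)) (a : List (Γ × Bool)) :
    Mem (SearchStack.Alphabet Γ) SearchState :=
  if a ∈ A then (.found, single .marked a) else nextMem a

variable [Fintype ι] [DecidableEq ι]

section Loop

variable {A : Language (Γ × Bool)} {P : SearchProgram Γ sub} {n : ℕ} {m : ℕ∞}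

theorem exists_doesWithin_loop (hP : ∀ a : List (Γ × Bool), a.length = n →
      ∃ t, P.DoesWithin (.searching, single .marked a) t m (searchStep A a))
    (a : List (Γ × Bool)) (ha : a.length = n) :
    ∃ (t : ℕ) (v : SearchState) (a' : List (Γ × Bool)),
      (v = .found ↔ HasMarkingFrom A a) ∧
      DoesWithin (Program.loop (fun v => v.1.2.isSearching) P)
        (.searching, single .marked a) t m (v, single .marked a') := by
  induction h_rest : 2 ^ n - markValue a using Nat.strong_induction_on generalizing a with
  | _ d ih =>
    obtain ⟨t, h_step⟩ := hP a ha
    rw [searchStep] at h_step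
    split_ifs at h_step with h_mem
    · exact ⟨_, .found, a, iff_of_true rfl ⟨a, h_mem, rfl, le_rfl⟩,
        .loop_true (b := SearchState.isSearching) rfl h_step
          (.loop_false rfl h_step.height_le_right)⟩
    rw [nextMem] at h_step
    have h_value := markValue_addCarry true a
    split_ifs at h_step with h_carry
    · exact ⟨_, .failed, _, iff_of_false (by decide) (not_hasMarkingFrom h_mem h_carry),
        .loop_true (b := SearchState.isSearching) rfl h_step
          (.loop_false rfl h_step.height_le_right)⟩
    · have h_lt := markValue_lt a
      simp only [h_carry, ha, Bool.toNat_false, Bool.toNat_true, mul_zero, add_zero] at h_value h_lt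
      obtain ⟨t', v, a', hv, h_loop⟩ := ih _ (by omega) (addCarry true a).1
        ((length_addCarry true a).trans ha) rfl
      exact ⟨_, v, a', hv.trans (hasMarkingFrom_addCarry h_mem h_carry),
        .loop_true (b := SearchState.isSearching) rfl h_step h_loop⟩

end Loop

variable [Fintype Γ]

theorem does_startSearch (x : List Γ) :
    (startSearch : SearchProgram Γ sub).Does (.searching, single .inp x) (x.length * 8 + 2)
      (.searching, single .marked (x.map fun s => (s, false))) := by
  refine DoesWithin.congr ((Does.move_single (Γ := SearchStack.Alphabet Γ) (k := .inp)
    (k' := .marked') (by decide) _ _ _).seq (Does.move_single (Γ := SearchStack.Alphabet Γ)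
    (k := .marked') (k' := .marked) (by decide) _ _ _)) ?_ ?_
  · simp
  · simp only [List.length_reverse, List.length_map]
    omega

theorem does_copyMarked (v : SearchState) (a : List (Γ × Bool)) :
    (copyMarked : SearchProgram Γ sub).Does (v, single .marked a) (a.length * 9 + 2)
      (v, searchStacks a [] a.reverse) := by
  have h_loop := Does.forAll (Γ := SearchStack.Alphabet Γ) (τ := SearchState) (sub := sub)
    (k := .marked) (P := fun s => (push .marked' s).seq (push .query s)) (T := 1 + 1)
    (fun z l => (v, searchStacks l z z)) (fun z s => s :: z) (fun _ _ => rfl)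
    (fun _ _ _ => funext fun k => by cases k <;> rfl) (fun _ _ _ => rfl)
    (fun z s l => DoesWithin.congr ((Does.push _ _ _).seq (Does.push _ _ _))
      (Prod.ext rfl (funext fun k => by cases k <;> rfl)) le_rfl) [] a
  rw [List.foldl_flip_cons_eq_append', List.append_nil, searchStacks_nil] at h_loop
  refine (h_loop.seq (Does.move (Γ := SearchStack.Alphabet Γ) (k := .marked') (k' := .marked)
    (by decide) id _)).congr (Prod.ext rfl (funext fun k => ?_)) ?_
  · cases k <;> simp [searchStacks]
  · simp only [searchStacks, List.length_reverse]
    omega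

theorem does_carryMarks (c : Bool) (a : List (Γ × Bool)) :
    (forAll .marked fun s => switch (carryMark s) : SearchProgram Γ sub).Does
      (carryState c, single .marked a) (a.length * 6 + 1)
      (carryState (addCarry c a).2, searchStacks [] (addCarry c a).1.reverse []) := by
  have h_loop := Does.forAll (Γ := SearchStack.Alphabet Γ) (τ := SearchState) (sub := sub)
    (k := .marked) (P := fun s => switch (carryMark s)) (T := 1 + 1 + 1)
    (fun (z : List (Γ × Bool) × Bool) l => (carryState z.2, searchStacks l z.1 []))
    (fun z s => ((s.1, xor s.2 z.2) :: z.1, z.2 && s.2)) (fun _ _ => rfl)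
    (fun _ _ _ => funext fun k => by cases k <;> rfl) (fun _ _ _ => rfl)
    (fun z s l => DoesWithin.switch (by
      obtain ⟨z, _ | _⟩ := z
      · refine (Does.push _ _ _).congr (Prod.ext rfl (funext fun k => ?_)) (Nat.le_succ 1)
        cases k <;> simp [searchStacks]
      · refine DoesWithin.congr ((Does.push _ _ _).seq (Does.assign _ _))
          (Prod.ext ?_ (funext fun k => ?_)) le_rfl
        · simp [carryState]
        · cases k <;> simp [searchStacks])) ([], c) a
  rw [foldl_addCarry, List.append_nil] at h_loop
  rwa [← searchStacks_nil]

theorem does_nextMarking (v : SearchState) (a : List (Γ × Bool)) :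
    (nextMarking : SearchProgram Γ sub).Does (v, single .marked a) (a.length * 10 + 4)
      (nextMem a) := by
  refine DoesWithin.congr ((Does.assign _ _).seq <| (does_carryMarks true a).seq <|
    (Does.move (Γ := SearchStack.Alphabet Γ) (k := .marked') (k' := .marked)
    (by decide) id _).seq (Does.assign _ _)) (Prod.ext ?_ (funext fun k => ?_)) ?_
  · cases h : (addCarry true a).2 <;> simp [nextMem, carryState, h]
  · cases k <;> simp [searchStacks, nextMem, single]
  · simp only [searchStacks, List.length_reverse, length_addCarry]
    omega

open Classical in
theorem does_processAnswer (A : Language (Γ × Bool)) (a : List (Γ × Bool)) :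
    (pop .answer processAnswer : SearchProgram Γ sub).Does
      (.searching, update (single .marked a) .answer [decide (a ∈ A)]) (a.length * 10 + 7)
      (searchStep A a) := by
  have h_pop : update (update (single .marked a) .answer [decide (a ∈ A)]) .answer [] =
      (single .marked a : ∀ k, List (SearchStack.Alphabet Γ k)) :=
    funext fun k => by cases k <;> simp [single]
  refine Does.pop (Γ := SearchStack.Alphabet Γ) (τ := SearchState) [decide (a ∈ A)] rfl ?_
  rw [List.tail_cons, List.head?_cons, h_pop]
  by_cases h : a ∈ A
  · rw [decide_eq_true h, searchStep, if_pos h]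
    exact (Does.assign _ _).mono_time (by omega)
  · rw [decide_eq_false h, searchStep, if_neg h]
    exact does_nextMarking _ _

theorem does_finishSearch (v : SearchState) (a : List (Γ × Bool)) :
    (finishSearch : SearchProgram Γ sub).Does (v, single .marked a) (a.length * 4 + 4)
      (.searching, single .out [decide (v = .found)]) := by
  have h_clear := Does.clear (Γ := SearchStack.Alphabet Γ) (sub := sub) (k := .marked)
    (v, single .marked a)
  have h_push : (switch fun v => push .out (decide (v = .found)) : SearchProgram Γ sub).Does
      (v, single .marked []) (1 + 1) (v, single .out [decide (v = .found)]) :=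
    DoesWithin.switch <| (Does.push _ _ _).congr
      (Prod.ext rfl (funext fun k => by cases k <;> simp [single])) le_rfl
  simp only [single_self, update_single] at h_clear
  exact DoesWithin.mono_time (h_clear.seq (h_push.seq (Does.assign _ _))) (by omega)

/-- Ask the machine `M` whether the present marking is in the language, and go on to the next one
if it is not. -/
def tryMarking (M : TM2ComputableAux (Γ × Bool) Bool) :
    SearchProgram Γ fun _ : Unit => M.tm :=
  copyMarked.seq <| .seq
    (call (k := .query) (k' := .answer) () M.inputAlphabet.symm M.outputAlphabet)
    (pop .answer processAnswer)

open Classical in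
theorem exists_doesWithin_tryMarking (M : TM2ComputableAux (Γ × Bool) Bool) :
    ∃ B : ℕ, ∀ (A : Language (Γ × Bool)) (a : List (Γ × Bool)) (t m : ℕ),
      ComputesOn M a t m [decide (a ∈ A)] →
      ∃ t', (tryMarking M).DoesWithin (.searching, single .marked a) t'
        (B * (a.length + m + 1) : ℕ) (searchStep A a) := by
  let sub : Unit → FinTM2 := fun _ => M.tm
  obtain ⟨B, h_call⟩ := exists_doesWithin_call (Γ := SearchStack.Alphabet Γ) (τ := SearchState)
    (sub := sub) (k := .query) (k' := .answer) () M.inputAlphabet.symm M.outputAlphabet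
  refine ⟨9 * (copyMarked : SearchProgram Γ sub).pushBound +
    10 * (pop .answer processAnswer : SearchProgram Γ sub).pushBound + 2 * B + 2,
    fun A a t m h => ?_⟩
  have h_copy := (does_copyMarked (sub := sub) .searching a).doesWithin
  have h_compute := h_call (.searching, searchStacks a [] a.reverse) (single .marked a) t m
    ([decide (a ∈ A)].map M.outputAlphabet.symm) (by
      simp only [searchStacks, List.reverse_reverse]
      exact h) (by
      rw [← searchStacks_nil]
      exact funext fun k => by cases k <;> simp [searchStacks])
  have h_answer := (does_processAnswer (sub := sub) A a).doesWithin
  have h_copied : height (searchStacks a [] a.reverse) = 2 * a.length := by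
    simp [height, searchStacks, Finset.univ, Fintype.elems, two_mul]
  have h_answered : height (update (single .marked a : ∀ k, List (SearchStack.Alphabet Γ k)) .answer
      [decide (a ∈ A)]) = a.length + 1 := by
    rw [← height_single (Γ := SearchStack.Alphabet Γ) .marked a]
    simpa [single] using height_update (single .marked a : ∀ k, List (SearchStack.Alphabet Γ k))
      .answer [decide (a ∈ A)]
  simp only [height_single, h_copied] at h_copy h_compute
  rw [h_answered] at h_answer
  have h_compute' := DoesWithin.congr h_compute
    (s'' := (.searching, update (single .marked a) .answer [decide (a ∈ A)]))
    (by simp [single]) le_rfl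
  refine ⟨_, (Program.Runs.mono h_copy le_rfl (Nat.cast_le.2 ?_)).seq
    ((Program.Runs.mono h_compute' le_rfl (Nat.cast_le.2 ?_)).seq
      (Program.Runs.mono h_answer le_rfl (Nat.cast_le.2 ?_)))⟩
  all_goals nlinarith

open Classical in
theorem markedProjection_mem_PSPACE {Γ : Type} [Finite Γ] {C : Language (Γ × Bool)}
    (hC : C ∈ PSPACE (Γ × Bool)) :
    markedProjection C ∈ PSPACE Γ := by
  have := Fintype.ofFinite Γ
  obtain ⟨M, p, hM⟩ := exists_computesOn_of_mem_PSPACE hC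
  obtain ⟨B, h_try⟩ := exists_doesWithin_tryMarking M
  let start : SearchProgram Γ fun _ : Unit => M.tm := startSearch
  let finish : SearchProgram Γ fun _ : Unit => M.tm := finishSearch
  let space (n : ℕ) : ℕ := B * (n + p.eval n + 1)
  have h_space : PolyBounded space :=
    (PolyBounded.const B).mul ((PolyBounded.id.add (PolyBounded.id.eval_comp p)).add (.const 1))
  let program : SearchProgram Γ fun _ : Unit => M.tm :=
    start.seq <| .seq (.loop (fun v => v.1.2.isSearching) (tryMarking M)) finish
  refine mem_PSPACE_of_computesOn (M := program.machine .searching .inp .out)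
    (s := fun n => n + start.pushBound * (n * 8 + 2) + space n +
      (space n + finish.pushBound * (space n * 4 + 4)))
    (((PolyBounded.id.add ((PolyBounded.const _).mul
      ((PolyBounded.id.mul (.const 8)).add (.const 2)))).add h_space).add <|
      h_space.add ((PolyBounded.const _).mul ((h_space.mul (.const 4)).add (.const 4))))
    fun x => ?_
  obtain ⟨t, v, a, hv, h_loop⟩ := exists_doesWithin_loop (A := C) (m := (space x.length : ℕ))
    (P := tryMarking M) (fun a (ha : a.length = x.length) => by
      obtain ⟨t, ht⟩ := hM a
      simpa only [ha] using h_try C a t _ ht) (x.map fun s => (s, false)) (List.length_map _)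
  have h_start := (does_startSearch (sub := fun _ : Unit => M.tm) x).doesWithin
  have h_finish := (does_finishSearch (sub := fun _ : Unit => M.tm) v a).doesWithin
  have h_length := h_loop.height_le_right
  simp only [height_single, Nat.cast_le] at h_start h_finish h_length
  have h_found : decide (v = .found) = decide (x ∈ markedProjection C) := by
    rw [decide_eq_decide, hv, hasMarkingFrom_map_false]
  rw [h_found] at h_finish
  have h_mono := Nat.mul_le_mul_left finish.pushBound
    (Nat.add_le_add_right (Nat.mul_le_mul_right 4 h_length) 4)
  refine ⟨_, DoesWithin.computesOn (P := program) <|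
    (Program.Runs.mono h_start le_rfl (Nat.cast_le.2 ?_)).seq
      ((h_loop.mono le_rfl (Nat.cast_le.2 ?_)).seq
        (Program.Runs.mono h_finish le_rfl (Nat.cast_le.2 ?_)))⟩
  · dsimp only [start]
    omega
  · omega
  · dsimp only [finish] at h_mono ⊢
    omega

end Search

end Complexity

namespace ParametricGrammar

/-! ### Productive nonterminals -/

section Productive

variable {T N : Type*}

/-- The nonterminals from which words can be derived by means of the rules `A → α` with `R A α`. -/
inductive Productive (R : N → List (Symbol T N) → Prop) : N → Prop
  | intro (A : N) (α : List (Symbol T N)) (h : R A α)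
      (hα : ∀ B, .nonterminal B ∈ α → Productive R B) : Productive R A

theorem Productive.mono {R R' : N → List (Symbol T N) → Prop} (h : ∀ A α, R A α → R' A α) {A : N}
    (hA : Productive R A) : Productive R' A := by
  induction hA with
  | intro A α hR _ ih => exact .intro A α (h _ _ hR) ih

end Productive

section Derivations

variable {L : FirstOrder.Language.{u, v}} {D : Type w} [L.Structure D]

/-- The rules whose guard can be satisfied for the interpretation `X` of the parameters. -/
def Grammar.Enabled (G : Grammar L) (X : Ident → D) (A : Ident)
    (α : List (Symbol (Ident ⊕ Ident) Ident)) : Prop :=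
  ∃ r ∈ G.productions, r.lhs = A ∧ r.rhs = α ∧ ∃ Y : Ident → D, r.guard.Realize (Sum.elim X Y)

theorem Grammar.productive_of_derives (G : Grammar L) (X : Ident → D)
    {s : List (Symbol D Ident)} {word : List D}
    (h : Relation.ReflTransGen (G.Produces X) s (word.map Symbol.terminal)) {B : Ident}
    (hB : .nonterminal B ∈ s) : Productive (G.Enabled X) B := by
  induction h using Relation.ReflTransGen.head_induction_on generalizing B with
  | refl => simp at hB
  | head h _ ih =>
    obtain ⟨r, hr, Y, hY, h⟩ := h
    obtain ⟨p, q, rfl, rfl⟩ := h.exists_parts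
    simp only [List.append_assoc, List.mem_append, List.mem_singleton] at hB ih
    rcases hB with hB | hB | hB
    · exact ih (.inl hB)
    · obtain rfl : B = r.lhs := Symbol.nonterminal.inj hB
      refine .intro _ r.rhs ⟨r, hr, rfl, rfl, Y, hY⟩ fun B hB => ih (.inr (.inl ?_))
      exact List.mem_map.2 ⟨_, hB, rfl⟩
    · exact ih (.inr (.inr hB))

theorem Grammar.derives_append (G : Grammar L) (X : Ident → D) {s t : List (Symbol D Ident)}
    (h : Relation.ReflTransGen (G.Produces X) s t) (p q : List (Symbol D Ident)) :
    Relation.ReflTransGen (G.Produces X) (p ++ (s ++ q)) (p ++ (t ++ q)) := by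
  refine h.lift (fun s => p ++ (s ++ q)) fun s t h => ?_
  obtain ⟨r, hr, Y, hY, h⟩ := h
  exact ⟨r, hr, Y, hY, (h.append_right q).append_left p⟩

theorem Grammar.exists_derives_map (G : Grammar L) (X Y : Ident → D)
    (α : List (Symbol (Ident ⊕ Ident) Ident))
    (h : ∀ B, .nonterminal B ∈ α → ∃ word : List D,
      Relation.ReflTransGen (G.Produces X) [.nonterminal B] (word.map Symbol.terminal)) :
    ∃ word : List D, Relation.ReflTransGen (G.Produces X) (α.map (instSymbol X Y))
      (word.map Symbol.terminal) := by
  induction α with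
  | nil => exact ⟨[], .refl⟩
  | cons y α ih =>
    obtain ⟨word, hw⟩ := ih fun B hB => h B (by simp [hB])
    obtain ⟨word', hw'⟩ : ∃ word' : List D, Relation.ReflTransGen (G.Produces X)
        [instSymbol X Y y] (word'.map Symbol.terminal) := by
      cases y with
      | terminal t => exact ⟨[Sum.elim X Y t], .refl⟩
      | nonterminal B => exact h B (by simp)
    refine ⟨word' ++ word, ?_⟩
    have h₁ := G.derives_append X hw' [] (α.map (instSymbol X Y))
    have h₂ := G.derives_append X hw (word'.map Symbol.terminal) []
    simp only [List.append_nil, List.nil_append] at h₁ h₂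
    rw [List.map_append]
    exact h₁.trans h₂

theorem Grammar.exists_derives (G : Grammar L) (X : Ident → D) {A : Ident}
    (h : Productive (G.Enabled X) A) : ∃ word : List D,
      Relation.ReflTransGen (G.Produces X) [.nonterminal A] (word.map Symbol.terminal) := by
  induction h with
  | intro A α hR _ ih =>
    obtain ⟨r, hr, rfl, rfl, Y, hY⟩ := hR
    obtain ⟨word, hw⟩ := G.exists_derives_map X Y r.rhs ih
    refine ⟨word, .head ⟨r, hr, Y, hY, ?_⟩ hw⟩
    simpa [Production.inst] using ContextFreeRule.Rewrites.head (r := r.inst X Y) []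

theorem Grammar.language_nonempty_iff (G : Grammar L) :
    Set.Nonempty (G.language D : Set (List D)) ↔
      ∃ X : Ident → D, Productive (G.Enabled X) G.start := by
  constructor
  · rintro ⟨word, h⟩
    obtain ⟨X, h⟩ := Set.mem_iUnion.1 h
    exact ⟨X, G.productive_of_derives X h (by simp)⟩
  · rintro ⟨X, h⟩
    obtain ⟨word, h⟩ := G.exists_derives X h
    exact ⟨word, Set.mem_iUnion.2 ⟨X, h⟩⟩

end Derivations

/-! ### Parentheses and renaming in texts -/

/-- `closes d g`: in the text `g` the parentheses are closed with the last token and not before, if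
`d + 1` parentheses are open at the beginning. -/
def closes : ℕ → List Tok → Bool
  | _, [] => false
  | d, .lpar :: g => closes (d + 1) g
  | 0, .rpar :: g => g.isEmpty
  | d + 1, .rpar :: g => closes d g
  | d, _ :: g => closes d g

/-- A parenthesized text. -/
def Balanced (g : List Tok) : Prop := ∃ g', g = .lpar :: g' ∧ closes 0 g' = true

theorem closes_append {g : List Tok} {d : ℕ} (h : closes d g = true) (e : ℕ) (r : List Tok) :
    closes (d + e + 1) (g ++ r) = closes e r := by
  induction g generalizing d with
  | nil => simp [closes] at h
  | cons t g ih =>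
    cases t <;> try exact ih h
    case lpar => simpa [closes, Nat.add_right_comm] using ih h
    case rpar =>
      cases d with
      | zero =>
        obtain rfl : g = [] := by simpa [closes] using h
        simp [closes]
      | succ d => simpa [closes, Nat.add_right_comm] using ih h

theorem closes_unique {u v : List Tok} {d : ℕ} (hu : closes d u = true) (hv : closes d v = true)
    {r r' : List Tok} (h : u ++ r = v ++ r') : u = v := by
  induction u generalizing v d with
  | nil => simp [closes] at hu
  | cons t u ih =>
    cases v with
    | nil => simp [closes] at hv
    | cons t' v =>
      simp only [List.cons_append, List.cons.injEq] at h
      obtain ⟨rfl, h⟩ := h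
      congr 1
      cases t <;> try exact ih hu hv h
      case rpar =>
        cases d with
        | zero =>
          obtain rfl : u = [] := by simpa [closes] using hu
          obtain rfl : v = [] := by simpa [closes] using hv
          rfl
        | succ d => exact ih hu hv h

theorem Balanced.unique {u v : List Tok} (hu : Balanced u) (hv : Balanced v) {r r' : List Tok}
    (h : u ++ r = v ++ r') : u = v := by
  obtain ⟨u, rfl, hu⟩ := hu
  obtain ⟨v, rfl, hv⟩ := hv
  simp only [List.cons_append, List.cons.injEq, true_and] at h
  rw [closes_unique hu hv h]

/-- A text that contains matching parentheses only. -/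
def Neutral (g : List Tok) : Prop := ∀ d r, closes d (g ++ r) = closes d r

theorem Balanced.neutral {g : List Tok} (h : Balanced g) : Neutral g := by
  obtain ⟨g, rfl, h⟩ := h
  intro d r
  simpa [closes] using closes_append h d r

theorem Neutral.append {g g' : List Tok} (h : Neutral g) (h' : Neutral g') : Neutral (g ++ g') :=
  fun d r => by rw [List.append_assoc, h, h']

theorem Neutral.balanced {g : List Tok} (h : Neutral g) : Balanced (.lpar :: (g ++ [.rpar])) :=
  ⟨_, rfl, by rw [h]; rfl⟩

theorem neutral_singleton {t : Tok} (h : t ≠ .lpar) (h' : t ≠ .rpar) : Neutral [t] := by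
  intro d r
  cases t <;> simp_all [closes]

theorem neutral_nil : Neutral [] := fun _ _ => rfl

theorem neutral_of_forall {g : List Tok} (h : ∀ t ∈ g, t ≠ .lpar ∧ t ≠ .rpar) : Neutral g := by
  induction g with
  | nil => exact neutral_nil
  | cons t g ih =>
    exact (neutral_singleton (h t (by simp)).1 (h t (by simp)).2).append
      (ih fun t ht => h t (by simp [ht]))

/-- Put the prefix `p` before the names of local variables. -/
def rename (p : List Bool) (g : List Tok) : List Tok :=
  g.flatMap fun t => if t = .loc then .loc :: p.map .bit else [t]

/-- The prefix for the names of local variables in the rule number `i`. -/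
def rulePrefix (i : ℕ) : List Bool := List.replicate i true ++ [false]

theorem rename_append (p : List Bool) (g g' : List Tok) :
    rename p (g ++ g') = rename p g ++ rename p g' := List.flatMap_append

theorem rename_cons (p : List Bool) (t : Tok) (g : List Tok) :
    rename p (t :: g) = (if t = .loc then .loc :: p.map .bit else [t]) ++ rename p g := rfl

theorem closes_rename (p : List Bool) (d : ℕ) (g : List Tok) :
    closes d (rename p g) = closes d g := by
  induction g generalizing d with
  | nil => rfl
  | cons t g ih =>
    cases t <;> try exact ih _
    case loc =>
      have h : Neutral (p.map Tok.bit) := neutral_of_forall fun t ht => by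
        obtain ⟨b, _, rfl⟩ := List.mem_map.1 ht
        simp
      simpa [rename_cons, closes, h d] using ih d
    case rpar =>
      cases d with
      | zero => cases g with
        | nil => rfl
        | cons t g => simp [rename_cons, closes]; split <;> simp
      | succ d => exact ih d

theorem Balanced.rename {g : List Tok} (h : Balanced g) (p : List Bool) :
    Balanced (rename p g) := by
  obtain ⟨g, rfl, h⟩ := h
  exact ⟨ParametricGrammar.rename p g, rfl, by rwa [closes_rename]⟩

open FirstOrder FirstOrder.Language

/-! ### Encodings of formulas -/

section Encoding

variable {L : FirstOrder.Language.{u, v}} (c : SymbolCoding L)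

theorem neutral_encodeIdent (a : List Bool) : Neutral (encodeIdent a) :=
  neutral_of_forall fun t ht => by
    rcases List.mem_append.1 ht with h | h
    · obtain ⟨b, _, rfl⟩ := List.mem_map.1 h
      simp
    · simp_all

theorem neutral_encodeAtom (a : Ident ⊕ Ident) : Neutral (encodeAtom a) := by
  cases a with
  | inl a => exact (neutral_singleton (t := .param) nofun nofun).append (neutral_encodeIdent a)
  | inr a => exact (neutral_singleton (t := .loc) nofun nofun).append (neutral_encodeIdent a)

theorem Neutral.flatten {l : List (List Tok)} (h : ∀ g ∈ l, Neutral g) : Neutral l.flatten := by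
  induction l with
  | nil => exact neutral_nil
  | cons g l ih => exact (h g (by simp)).append (ih fun g hg => h g (by simp [hg]))

theorem neutral_encodeTerm {n : ℕ} (t : L.Term ((Ident ⊕ Ident) ⊕ Fin n)) :
    Neutral (encodeTerm c t) := by
  induction t with
  | var x =>
    cases x with
    | inl a => exact neutral_encodeAtom a
    | inr i => exact (neutral_singleton (t := .bound) nofun nofun).append (neutral_encodeIdent _)
  | func f ts ih =>
    rw [encodeTerm]
    refine ((neutral_singleton (t := .func) nofun nofun).append (neutral_encodeIdent _)).append
      (Neutral.flatten fun g hg => ?_)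
    obtain ⟨i, rfl⟩ := (List.mem_ofFn' _ _).1 hg
    exact ih i

theorem balanced_encodeFormula {n : ℕ} (φ : L.BoundedFormula (Ident ⊕ Ident) n) :
    Balanced (encodeFormula c φ) := by
  induction φ with
  | falsum => exact ⟨_, rfl, rfl⟩
  | equal t₁ t₂ =>
    exact (((neutral_singleton (t := .eq) nofun nofun).append (neutral_encodeTerm c t₁)).append
      (neutral_encodeTerm c t₂)).balanced
  | rel R ts =>
    refine (((neutral_singleton (t := .rel) nofun nofun).append (neutral_encodeIdent _)).append
      (Neutral.flatten fun g hg => ?_)).balanced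
    obtain ⟨i, rfl⟩ := (List.mem_ofFn' _ _).1 hg
    exact neutral_encodeTerm c _
  | imp φ ψ ih₁ ih₂ =>
    exact (((neutral_singleton (t := .imp) nofun nofun).append ih₁.neutral).append
      ih₂.neutral).balanced
  | all φ ih => exact ((neutral_singleton (t := .all) nofun nofun).append ih.neutral).balanced

theorem encodeFormula_ne_nil {n : ℕ} (φ : L.BoundedFormula (Ident ⊕ Ident) n) :
    encodeFormula c φ ≠ [] := by
  obtain ⟨g, hg, -⟩ := balanced_encodeFormula c φ
  rw [hg]
  exact List.cons_ne_nil _ _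

/-- Put the prefix `p` before the name of a local variable. -/
def renameAtom (p : List Bool) : Ident ⊕ Ident → Ident ⊕ Ident := Sum.map id (p ++ ·)

/-- Put the prefix `p` before the names of the local variables of a term. -/
def renameTerm (p : List Bool) {n : ℕ} (t : L.Term ((Ident ⊕ Ident) ⊕ Fin n)) :
    L.Term ((Ident ⊕ Ident) ⊕ Fin n) := t.relabel (Sum.map (renameAtom p) id)

/-- Put the prefix `p` before the names of the local variables of a formula. -/
def renameFormula (p : List Bool) {n : ℕ} (φ : L.BoundedFormula (Ident ⊕ Ident) n) :
    L.BoundedFormula (Ident ⊕ Ident) n :=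
  φ.mapTermRel (fun _ => renameTerm p) (fun _ => id) (fun _ => id)

theorem rename_eq_self (p : List Bool) {g : List Tok} (h : .loc ∉ g) : rename p g = g := by
  induction g with
  | nil => rfl
  | cons t g ih =>
    rw [List.mem_cons, not_or] at h
    rw [rename_cons, if_neg (Ne.symm h.1), ih h.2, List.singleton_append]

theorem rename_encodeIdent (p a : List Bool) : rename p (encodeIdent a) = encodeIdent a :=
  rename_eq_self p (by simp [encodeIdent])

theorem rename_flatten (p : List Bool) (l : List (List Tok)) :
    rename p l.flatten = (l.map (rename p)).flatten := by
  induction l with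
  | nil => rfl
  | cons g l ih => rw [List.flatten_cons, rename_append, ih, List.map_cons, List.flatten_cons]

theorem encodeTerm_renameTerm (p : List Bool) {n : ℕ} (t : L.Term ((Ident ⊕ Ident) ⊕ Fin n)) :
    encodeTerm c (renameTerm p t) = rename p (encodeTerm c t) := by
  induction t with
  | var x =>
    rcases x with (a | a) | i
    · change Tok.param :: encodeIdent a = Tok.param :: rename p (encodeIdent a)
      rw [rename_encodeIdent]
    · change Tok.loc :: encodeIdent (p ++ a) = Tok.loc :: (p.map .bit ++ rename p (encodeIdent a))
      rw [rename_encodeIdent]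
      simp [encodeIdent]
    · change Tok.bound :: encodeIdent _ = Tok.bound :: rename p (encodeIdent _)
      rw [rename_encodeIdent]
      rfl
  | func f ts ih =>
    rw [renameTerm, Term.relabel, encodeTerm, encodeTerm, rename_append, rename_cons,
      rename_encodeIdent, rename_flatten, List.map_ofFn]
    simp only [reduceCtorEq, if_false, List.singleton_append]
    congr 3
    exact funext ih

theorem encodeFormula_renameFormula (p : List Bool) {n : ℕ}
    (φ : L.BoundedFormula (Ident ⊕ Ident) n) :
    encodeFormula c (renameFormula p φ) = rename p (encodeFormula c φ) := by
  induction φ with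
  | falsum => rfl
  | equal t₁ t₂ =>
    rw [renameFormula, BoundedFormula.mapTermRel, encodeFormula, encodeFormula,
      encodeTerm_renameTerm, encodeTerm_renameTerm, rename_append, rename_append, rename_append]
    rfl
  | rel R ts =>
    rw [renameFormula, BoundedFormula.mapTermRel, encodeFormula, encodeFormula,
      rename_append, rename_append, rename_append, rename_flatten, rename_encodeIdent,
      List.map_ofFn]
    simp only [encodeTerm_renameTerm]
    rfl
  | imp φ ψ ih₁ ih₂ =>
    change [Tok.lpar, Tok.imp] ++ encodeFormula c (renameFormula p φ) ++
      encodeFormula c (renameFormula p ψ) ++ [Tok.rpar] = _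
    rw [encodeFormula, ih₁, ih₂, rename_append, rename_append, rename_append]
    rfl
  | all φ ih =>
    change [Tok.lpar, Tok.all] ++ encodeFormula c (renameFormula p φ) ++ [Tok.rpar] = _
    rw [encodeFormula, ih, rename_append, rename_append]
    rfl

theorem isQF_renameFormula (p : List Bool) {n : ℕ} {φ : L.BoundedFormula (Ident ⊕ Ident) n}
    (h : φ.IsQF) : (renameFormula p φ).IsQF := by
  induction h with
  | falsum => exact .falsum
  | of_isAtomic h =>
    cases h with
    | equal t₁ t₂ => exact (BoundedFormula.IsAtomic.equal _ _).isQF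
    | rel R ts => exact (BoundedFormula.IsAtomic.rel R _).isQF
  | imp _ _ ih₁ ih₂ => exact ih₁.imp ih₂

theorem realize_renameFormula {D : Type w} [L.Structure D] (p : List Bool)
    (φ : GuardFormula L) (x : Ident ⊕ Ident → D) :
    Formula.Realize (renameFormula p φ : GuardFormula L) x ↔
      φ.Realize (x ∘ renameAtom p) := by
  refine BoundedFormula.realize_mapTermRel_id (fun n t xs => ?_) (fun _ _ _ => rfl)
  rw [renameTerm, Term.realize_relabel]
  congr 1
  ext (i | i) <;> rfl

theorem eq_cons_of_rename_eq_cons {p : List Bool} {g r' : List Tok} {t : Tok} (ht : t ≠ .loc)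
    (h : rename p g = t :: r') : ∃ r, g = t :: r ∧ rename p r = r' := by
  cases g with
  | nil => cases h
  | cons t' g =>
    rw [rename_cons] at h
    split at h
    · injection h with h
      exact absurd h.symm ht
    · injection h with h h'
      exact ⟨g, by rw [h], h'⟩

theorem eq_cons_of_rename_eq_loc {p : List Bool} {g r' : List Tok}
    (h : rename p g = .loc :: r') : ∃ r, g = .loc :: r ∧ p.map .bit ++ rename p r = r' := by
  cases g with
  | nil => cases h
  | cons t' g =>
    rw [rename_cons] at h
    split at h
    · next h₀ =>
      injection h with h h'
      exact ⟨g, by rw [h₀], h'⟩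
    · injection h with h h'
      contradiction

theorem exists_of_rename_eq_encodeIdent {p : List Bool} {w : List Bool} {g r' : List Tok}
    (h : rename p g = encodeIdent w ++ r') : ∃ r, g = encodeIdent w ++ r ∧ rename p r = r' := by
  induction w generalizing g with
  | nil => exact eq_cons_of_rename_eq_cons nofun h
  | cons b w ih =>
    obtain ⟨r, rfl, h₁⟩ := eq_cons_of_rename_eq_cons (t := .bit b) nofun h
    obtain ⟨r, rfl, h₂⟩ := ih h₁
    exact ⟨r, rfl, h₂⟩

theorem exists_of_append_eq_encodeIdent {p y : List Bool} {z r : List Tok}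
    (h : p.map .bit ++ z = encodeIdent y ++ r) :
    ∃ y', y = p ++ y' ∧ z = encodeIdent y' ++ r := by
  induction p generalizing y with
  | nil => exact ⟨y, rfl, h⟩
  | cons b p ih =>
    cases y with
    | nil => cases h
    | cons b' y =>
      injection h with h₁ h₂
      injection h₁ with h₁
      obtain ⟨y', rfl, h⟩ := ih h₂
      exact ⟨y', by rw [h₁]; rfl, h⟩

theorem exists_of_rename_eq_encodeTerms {p : List Bool} {n k : ℕ}
    (ts' : Fin k → L.Term ((Ident ⊕ Ident) ⊕ Fin n))
    (ih : ∀ i {g r' : List Tok}, rename p g = encodeTerm c (ts' i) ++ r' →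
      ∃ t r, g = encodeTerm c t ++ r ∧ ts' i = renameTerm p t ∧ rename p r = r')
    {g r' : List Tok}
    (h : rename p g = (List.ofFn fun i => encodeTerm c (ts' i)).flatten ++ r') :
    ∃ ts : Fin k → L.Term ((Ident ⊕ Ident) ⊕ Fin n), ∃ r,
      g = (List.ofFn fun i => encodeTerm c (ts i)).flatten ++ r ∧
        ts' = (fun i => renameTerm p (ts i)) ∧ rename p r = r' := by
  induction k generalizing g with
  | zero => exact ⟨ts', g, by simp, funext fun i => i.elim0, by simpa using h⟩
  | succ k ihk =>
    rw [List.ofFn_succ, List.flatten_cons, List.append_assoc] at h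
    obtain ⟨t, r, rfl, h₁, h₂⟩ := ih 0 h
    obtain ⟨ts, r, rfl, h₃, h₄⟩ := ihk (fun i => ts' i.succ) (fun i => ih i.succ) h₂
    refine ⟨Fin.cons t ts, r, ?_, ?_, h₄⟩
    · simp [List.ofFn_succ]
    · funext i
      refine Fin.cases h₁ (fun i => ?_) i
      simpa using congrFun h₃ i

theorem exists_of_rename_eq_encodeTerm {p : List Bool} {n : ℕ}
    (t' : L.Term ((Ident ⊕ Ident) ⊕ Fin n)) {g r' : List Tok}
    (h : rename p g = encodeTerm c t' ++ r') :
    ∃ t r, g = encodeTerm c t ++ r ∧ t' = renameTerm p t ∧ rename p r = r' := by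
  induction t' generalizing g r' with
  | var x =>
    rcases x with (a | a) | i
    · obtain ⟨r, rfl, h₁⟩ := eq_cons_of_rename_eq_cons (t := .param) nofun h
      obtain ⟨r, rfl, h₂⟩ := exists_of_rename_eq_encodeIdent h₁
      exact ⟨.var (.inl (.inl a)), r, rfl, rfl, h₂⟩
    · obtain ⟨r, rfl, h₁⟩ := eq_cons_of_rename_eq_loc h
      obtain ⟨y, rfl, h₂⟩ := exists_of_append_eq_encodeIdent h₁
      obtain ⟨r, rfl, h₃⟩ := exists_of_rename_eq_encodeIdent h₂
      exact ⟨.var (.inl (.inr y)), r, rfl, rfl, h₃⟩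
    · obtain ⟨r, rfl, h₁⟩ := eq_cons_of_rename_eq_cons (t := .bound) nofun h
      obtain ⟨r, rfl, h₂⟩ := exists_of_rename_eq_encodeIdent h₁
      exact ⟨.var (.inr i), r, rfl, rfl, h₂⟩
  | @func l f ts ih =>
    rw [encodeTerm, List.append_assoc] at h
    obtain ⟨r, rfl, h₁⟩ := eq_cons_of_rename_eq_cons (t := .func) nofun h
    obtain ⟨r, rfl, h₂⟩ := exists_of_rename_eq_encodeIdent h₁
    obtain ⟨ts, r, rfl, rfl, h₃⟩ := exists_of_rename_eq_encodeTerms c ts (fun i => ih i) h₂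
    exact ⟨.func f ts, r, by simp [encodeTerm], rfl, h₃⟩

theorem exists_of_rename_eq_encodeFormula_append_of_isAtomic {p : List Bool} {n : ℕ}
    {φ' : L.BoundedFormula (Ident ⊕ Ident) n} (hφ : φ'.IsAtomic) {g r' : List Tok}
    (h : rename p g = encodeFormula c φ' ++ r') :
    ∃ (φ : L.BoundedFormula (Ident ⊕ Ident) n) (r : List Tok), φ.IsAtomic ∧
      g = encodeFormula c φ ++ r ∧ φ' = renameFormula p φ ∧ rename p r = r' := by
  cases hφ with
  | equal t₁ t₂ =>
    rw [Term.bdEqual, encodeFormula] at h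
    simp only [List.append_assoc, List.cons_append, List.nil_append] at h
    obtain ⟨r, rfl, h₁⟩ := eq_cons_of_rename_eq_cons (t := .lpar) nofun h
    obtain ⟨r, rfl, h₂⟩ := eq_cons_of_rename_eq_cons (t := .eq) nofun h₁
    obtain ⟨t₁, r, rfl, rfl, h₃⟩ := exists_of_rename_eq_encodeTerm c _ h₂
    obtain ⟨t₂, r, rfl, rfl, h₄⟩ := exists_of_rename_eq_encodeTerm c _ h₃
    obtain ⟨r, rfl, h₅⟩ := eq_cons_of_rename_eq_cons (t := .rpar) nofun h₄
    exact ⟨.equal t₁ t₂, r, .equal _ _, by simp [encodeFormula], rfl, h₅⟩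
  | rel R ts =>
    rw [Relations.boundedFormula, encodeFormula] at h
    simp only [List.append_assoc, List.cons_append, List.nil_append] at h
    obtain ⟨r, rfl, h₁⟩ := eq_cons_of_rename_eq_cons (t := .lpar) nofun h
    obtain ⟨r, rfl, h₂⟩ := eq_cons_of_rename_eq_cons (t := .rel) nofun h₁
    obtain ⟨r, rfl, h₃⟩ := exists_of_rename_eq_encodeIdent h₂
    obtain ⟨ts, r, rfl, rfl, h₄⟩ := exists_of_rename_eq_encodeTerms c ts
      (fun i => exists_of_rename_eq_encodeTerm c _) h₃
    obtain ⟨r, rfl, h₅⟩ := eq_cons_of_rename_eq_cons (t := .rpar) nofun h₄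
    exact ⟨.rel R ts, r, .rel _ _, by simp [encodeFormula], rfl, h₅⟩

theorem exists_of_rename_eq_encodeFormula_append {p : List Bool} {n : ℕ}
    {φ' : L.BoundedFormula (Ident ⊕ Ident) n} (hφ : φ'.IsQF) {g r' : List Tok}
    (h : rename p g = encodeFormula c φ' ++ r') :
    ∃ (φ : L.BoundedFormula (Ident ⊕ Ident) n) (r : List Tok), φ.IsQF ∧
      g = encodeFormula c φ ++ r ∧ φ' = renameFormula p φ ∧ rename p r = r' := by
  induction hφ generalizing g r' with
  | falsum =>
    obtain ⟨r, rfl, h₁⟩ := eq_cons_of_rename_eq_cons (t := .lpar) nofun h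
    obtain ⟨r, rfl, h₂⟩ := eq_cons_of_rename_eq_cons (t := .bot) nofun h₁
    obtain ⟨r, rfl, h₃⟩ := eq_cons_of_rename_eq_cons (t := .rpar) nofun h₂
    exact ⟨.falsum, r, .falsum, rfl, rfl, h₃⟩
  | of_isAtomic hφ =>
    obtain ⟨φ, r, hφ, h⟩ := exists_of_rename_eq_encodeFormula_append_of_isAtomic c hφ h
    exact ⟨φ, r, hφ.isQF, h⟩
  | imp _ _ ih₁ ih₂ =>
    rw [encodeFormula] at h
    simp only [List.append_assoc, List.cons_append, List.nil_append] at h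
    obtain ⟨r, rfl, h₁⟩ := eq_cons_of_rename_eq_cons (t := .lpar) nofun h
    obtain ⟨r, rfl, h₂⟩ := eq_cons_of_rename_eq_cons (t := .imp) nofun h₁
    obtain ⟨φ₁, r, hq₁, rfl, rfl, h₃⟩ := ih₁ h₂
    obtain ⟨φ₂, r, hq₂, rfl, rfl, h₄⟩ := ih₂ h₃
    obtain ⟨r, rfl, h₅⟩ := eq_cons_of_rename_eq_cons (t := .rpar) nofun h₄
    exact ⟨.imp φ₁ φ₂, r, hq₁.imp hq₂, by simp [encodeFormula], rfl, h₅⟩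

theorem exists_of_rename_eq_encodeFormula {p : List Bool} {n : ℕ}
    {φ' : L.BoundedFormula (Ident ⊕ Ident) n} (hφ : φ'.IsQF) {g : List Tok}
    (h : rename p g = encodeFormula c φ') :
    ∃ φ : L.BoundedFormula (Ident ⊕ Ident) n, φ.IsQF ∧ g = encodeFormula c φ ∧
      φ' = renameFormula p φ := by
  obtain ⟨φ, r, hq, rfl, rfl, h₁⟩ := exists_of_rename_eq_encodeFormula_append c hφ (r' := [])
    (by rw [h, List.append_nil])
  obtain rfl : r = [] := by
    cases r with
    | nil => rfl
    | cons t r =>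
      rw [rename_cons] at h₁
      split at h₁ <;> cases h₁
  exact ⟨φ, hq, by simp, rfl⟩

theorem eq_imp_of_encodeFormula_eq {n : ℕ} {ψ : L.BoundedFormula (Ident ⊕ Ident) n}
    (hψ : ψ.IsQF) {u v : List Tok} (hu : Balanced u)
    (h : encodeFormula c ψ = [.lpar, .imp] ++ (u ++ (v ++ [.rpar]))) :
    ∃ ψ₁ ψ₂ : L.BoundedFormula (Ident ⊕ Ident) n, ψ₁.IsQF ∧ ψ₂.IsQF ∧ ψ = ψ₁.imp ψ₂ ∧
      encodeFormula c ψ₁ = u ∧ encodeFormula c ψ₂ = v := by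
  cases hψ with
  | falsum => simp [encodeFormula] at h
  | of_isAtomic hφ =>
    cases hφ with
    | equal t₁ t₂ => simp [Term.bdEqual, encodeFormula] at h
    | rel R ts => simp [Relations.boundedFormula, encodeFormula] at h
  | @imp ψ₁ ψ₂ h₁ h₂ =>
    refine ⟨ψ₁, ψ₂, h₁, h₂, rfl, ?_⟩
    rw [encodeFormula] at h
    simp only [List.append_assoc, List.append_cancel_left_eq] at h
    obtain rfl := (balanced_encodeFormula c ψ₁).unique hu h
    exact ⟨rfl, by simpa using h⟩

theorem eq_falsum_of_encodeFormula_eq {n : ℕ} {ψ : L.BoundedFormula (Ident ⊕ Ident) n}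
    (h : encodeFormula c ψ = [.lpar, .bot, .rpar]) : ψ = .falsum := by
  cases ψ <;> simp [encodeFormula] at h ⊢

end Encoding

/-! ### Translating an annotated grammar into a formula -/

/-- The position of a scan within the text of a grammar. -/
inductive Mode
  | start
  | top
  | lhs
  | rhs
  | sym (nt : Bool)
  | gstart
  | guard
  | fail
  deriving DecidableEq, Fintype

/-- A step of a scan. -/
inductive Action
  | goto (m : Mode)
  | collect (b : Bool)
  | checkStart
  | beginRule (b : Bool)
  | saveLhs
  | commit
  | checkSym
  | dropSym
  | openGuard
  | emit (t : Tok)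
  | nest
  | unnest
  | emitLoc

/-- The action at a token, depending on whether the token is marked. Only the mark of the token
`Tok.rule` matters: it selects the rule that begins there. -/
def action (marked : Bool) : Mode → Tok → Action
  | .start, .bit b => .collect b
  | .start, .fin => .checkStart
  | .top, .rule => .beginRule marked
  | .lhs, .bit b => .collect b
  | .lhs, .fin => .saveLhs
  | .rhs, .param => .goto (.sym false)
  | .rhs, .loc => .goto (.sym false)
  | .rhs, .nonterm => .goto (.sym true)
  | .rhs, .guard => .commit
  | .sym _, .bit b => .collect b
  | .sym true, .fin => .checkSym
  | .sym false, .fin => .dropSym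
  | .gstart, .lpar => .openGuard
  | .guard, .lpar => .nest
  | .guard, .rpar => .unnest
  | .guard, .loc => .emitLoc
  | .guard, t => .emit t
  | _, _ => .goto .fail

/-- The state of a scan. The words `cur` and `out`, and the elements of `prod`, are reversed. -/
structure Scan where
  mode : Mode := .start
  /-- The present rule is selected, and the nonterminals met so far on its right-hand side are
  productive. -/
  ok : Bool := false
  /-- The present rule is selected. -/
  sel : Bool := false
  /-- The start symbol is productive. -/
  good : Bool := false
  /-- The present identifier. -/
  cur : List Bool := []
  /-- The left-hand side of the present rule. -/
  lhs : List Bool := []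
  /-- The nonterminals that are known to be productive. -/
  prod : List (List Bool) := []
  /-- The number of parentheses of the present guard that are open, except the outermost one. -/
  depth : ℕ := 0
  /-- The number of rules that have been read. -/
  idx : ℕ := 0
  /-- The formula that is being written. -/
  out : List Tok := []

/-- The text that precedes a guard `φ` in the formula; the argument tells whether the rule is
selected. The formula is a chain of implications `φ₁ → φ₂ → ⋯ → ⊥`, and the guard of a rule that is
not selected enters it in the form `⊥ → φ`. -/
def guardPrefix : Bool → List Tok
  | true => [.lpar, .imp]
  | false => [.lpar, .imp, .lpar, .imp, .lpar, .bot, .rpar]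

/-- The text that follows a guard in the formula; see `guardPrefix`. -/
def guardSuffix : Bool → List Tok
  | true => []
  | false => [.rpar]

/-- The effect of an action. -/
def Scan.apply (s : Scan) : Action → Scan
  | .goto m => { s with mode := m }
  | .collect b => { s with cur := b :: s.cur }
  | .checkStart => { s with mode := .top, good := decide (s.cur ∈ s.prod), cur := [] }
  | .beginRule b =>
      { s with mode := .lhs, ok := b, sel := b, out := (guardPrefix b).reverse ++ s.out }
  | .saveLhs => { s with mode := .rhs, lhs := s.cur.reverse ++ s.lhs, cur := [] }
  | .commit =>
      { s with mode := .gstart, prod :=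
          if s.ok then s.lhs.reverse :: s.prod else s.prod, lhs := [] }
  | .checkSym => { s with mode := .rhs, ok := s.ok && decide (s.cur ∈ s.prod), cur := [] }
  | .dropSym => { s with mode := .rhs, cur := [] }
  | .openGuard => { s with mode := .guard, out := .lpar :: s.out }
  | .emit t => { s with out := t :: s.out }
  | .nest => { s with out := .lpar :: s.out, depth := s.depth + 1 }
  | .unnest =>
      if s.depth = 0 then
        { s with
          mode := .top
          idx := s.idx + 1
          out := (guardSuffix s.sel).reverse ++ .rpar :: s.out }
      else { s with out := .rpar :: s.out, depth := s.depth - 1 }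
  | .emitLoc =>
      { s with out := .bit false :: (List.replicate s.idx (.bit true) ++ .loc :: s.out) }

/-- Read one annotated token. -/
def Scan.next (s : Scan) (t : Tok × Bool) : Scan := s.apply (action t.2 s.mode t.1)

/-- The beginning of a scan in which the nonterminals `prod` are known to be productive. The formula
is the negation of a chain of implications. -/
def Scan.init (prod : List (List Bool)) : Scan := { prod := prod, out := [.imp, .lpar] }

/-- One scan, which keeps only the list of productive nonterminals of the scan before it. -/
def Scan.pass (a : List (Tok × Bool)) (s : Scan) : Scan := a.foldl Scan.next (Scan.init s.prod)

/-- The text that follows the `n` guards in the formula. -/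
def closing (n : ℕ) : List Tok :=
  [.lpar, .bot, .rpar] ++ List.replicate n .rpar ++ [.lpar, .bot, .rpar, .rpar]

/-- The result of repeated scans. Each scan finds a new productive nonterminal unless all of them
are known already, so that `a.length` scans suffice. -/
def finalScan (a : List (Tok × Bool)) : Scan := (Scan.pass a)^[a.length] {}

/-- The formula that a scan leaves: the conjunction of the guards of the selected rules if the start
symbol has been found to be productive, and otherwise the empty word, which is not a formula. -/
def Scan.formula (s : Scan) : List Tok :=
  if s.mode = .top ∧ s.good = true then s.out.reverse ++ closing s.idx else []

/-- The translation of an annotated grammar into a formula. -/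
def reduction (a : List (Tok × Bool)) : List Tok := (finalScan a).formula

/-- The total length of the words in a scan, except the output. -/
def Scan.weight (s : Scan) : ℕ :=
  s.cur.length + s.lhs.length + (s.prod.map fun e => e.length + 1).sum + s.depth + s.idx

theorem Scan.weight_next (s : Scan) (t : Tok × Bool) : (s.next t).weight ≤ s.weight + 1 := by
  unfold Scan.next
  cases action t.2 s.mode t.1 <;> simp only [Scan.apply, Scan.weight, List.length_cons,
    List.length_nil, List.length_append, List.length_reverse]
  case commit =>
    cases s.ok <;> simp only [if_true, Bool.false_eq_true, if_false, List.map_cons, List.sum_cons,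
      List.length_reverse] <;> omega
  case unnest => split <;> dsimp only <;> omega
  all_goals omega

theorem Scan.length_out_next (s : Scan) (t : Tok × Bool) :
    (s.next t).out.length ≤ s.out.length + s.weight + 7 := by
  have h_prefix : ∀ b, (guardPrefix b).length ≤ 7 := by decide
  have h_suffix : ∀ b, (guardSuffix b).length ≤ 1 := by decide
  unfold Scan.next
  cases action t.2 s.mode t.1 <;> simp only [Scan.apply, Scan.weight, List.length_cons,
    List.length_append, List.length_reverse, List.length_replicate]
  case beginRule b =>
    have := h_prefix b
    omega
  case unnest =>
    have := h_suffix s.sel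
    split <;> simp only [List.length_append, List.length_reverse, List.length_cons] <;> omega
  all_goals omega

theorem Scan.weight_foldl_next (a : List (Tok × Bool)) (s : Scan) :
    (a.foldl Scan.next s).weight ≤ s.weight + a.length := by
  induction a generalizing s with
  | nil => rfl
  | cons t a ih =>
    have h_step := s.weight_next t
    have h_rest := ih (s.next t)
    simp only [List.foldl_cons, List.length_cons]
    omega

theorem Scan.length_out_foldl_next (a : List (Tok × Bool)) (s : Scan) :
    (a.foldl Scan.next s).out.length ≤ s.out.length + a.length * (s.weight + a.length + 7) := by
  induction a generalizing s with
  | nil => simp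
  | cons t a ih =>
    have h_weight := s.weight_next t
    have h_out := s.length_out_next t
    simp only [List.foldl_cons, List.length_cons]
    calc _ ≤ _ := ih (s.next t)
      _ ≤ s.out.length + s.weight + 7 + a.length * (s.weight + 1 + a.length + 7) := by gcongr
      _ ≤ _ := by nlinarith

theorem Scan.weight_init (s : Scan) : (Scan.init s.prod).weight ≤ s.weight := by
  simp only [Scan.init, Scan.weight, List.length_nil]
  omega

theorem Scan.weight_pass (a : List (Tok × Bool)) (s : Scan) :
    (s.pass a).weight ≤ s.weight + a.length :=
  (Scan.weight_foldl_next a _).trans (Nat.add_le_add_right s.weight_init _)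

theorem Scan.length_out_pass (a : List (Tok × Bool)) (s : Scan) :
    (s.pass a).out.length ≤ 2 + a.length * (s.weight + a.length + 7) := by
  refine (Scan.length_out_foldl_next a _).trans ?_
  gcongr
  · rfl
  · exact s.weight_init

theorem Scan.weight_iterate_pass (a : List (Tok × Bool)) (n : ℕ) :
    ((Scan.pass a)^[n] {}).weight ≤ n * a.length := by
  induction n with
  | zero => simp [Scan.weight]
  | succ n ih =>
    rw [Function.iterate_succ_apply', Nat.succ_mul]
    exact (Scan.weight_pass a _).trans (Nat.add_le_add_right ih _)

/-- An upper bound for the length of the output of a scan of `n` tokens. -/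
def outBound (n : ℕ) : ℕ := 2 + n * (n * n + n + 7)

theorem length_out_finalScan (a : List (Tok × Bool)) :
    (finalScan a).out.length ≤ outBound a.length := by
  unfold finalScan
  cases h : a.length with
  | zero => simp
  | succ n =>
    have h_weight := Scan.weight_iterate_pass a n
    rw [Function.iterate_succ_apply']
    refine (Scan.length_out_pass a _).trans ?_
    rw [h] at h_weight ⊢
    unfold outBound
    gcongr
    nlinarith

/-! ### The effect of a scan on the text of a grammar -/

/-- Tokens without a mark. -/
def plain (w : List Tok) : List (Tok × Bool) := w.map fun t => (t, false)

theorem plain_cons (t : Tok) (w : List Tok) : plain (t :: w) = (t, false) :: plain w := rfl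

theorem plain_append (w w' : List Tok) : plain (w ++ w') = plain w ++ plain w' := List.map_append

theorem plain_encodeIdent (a : List Bool) :
    plain (encodeIdent a) = plain (a.map .bit) ++ [(.fin, false)] := plain_append _ _

theorem map_fst_plain (w : List Tok) : (plain w).map Prod.fst = w := by
  rw [plain, List.map_map]
  exact List.map_id w

/-- The text of a rule up to its right-hand side. -/
def ruleHead (b : Bool) (A : Ident) (α : List (Symbol (Ident ⊕ Ident) Ident)) :
    List (Tok × Bool) :=
  (.rule, b) :: (plain (encodeIdent A) ++ plain (α.flatMap encodeSymbol))

/-- A rule whose guard is given as a text, together with the mark that tells whether it is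
selected. -/
structure TextRule where
  sel : Bool
  lhs : Ident
  rhs : List (Symbol (Ident ⊕ Ident) Ident)
  guard : List (Tok × Bool)

namespace TextRule

/-- The text of the guard. -/
def guardText (r : TextRule) : List Tok := r.guard.map Prod.fst

/-- The rule as a text. -/
def text (r : TextRule) : List (Tok × Bool) :=
  ruleHead r.sel r.lhs r.rhs ++ (.guard, false) :: r.guard

end TextRule

/-- A grammar whose guards are given as texts. -/
def grammarText (start : Ident) (rules : List TextRule) : List (Tok × Bool) :=
  plain (encodeIdent start) ++ rules.flatMap TextRule.text

namespace Scan

theorem foldl_bits (w : List Bool) (s : Scan)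
    (h : s.mode = .start ∨ s.mode = .lhs ∨ ∃ b, s.mode = .sym b) :
    (plain (w.map .bit)).foldl next s = { s with cur := w.reverse ++ s.cur } := by
  induction w generalizing s with
  | nil => rfl
  | cons b w ih =>
    have hn : s.next (.bit b, false) = { s with cur := b :: s.cur } := by
      rcases h with h | h | ⟨b', h⟩
      · simp [next, h, action, apply]
      · simp [next, h, action, apply]
      · cases b' <;> simp [next, h, action, apply]
    rw [List.map_cons, plain_cons, List.foldl_cons, hn,
      ih { s with cur := b :: s.cur } h]
    simp

/-- A symbol is a terminal or is known to be productive. -/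
def symbolOk (p : List (List Bool)) : Symbol (Ident ⊕ Ident) Ident → Bool
  | .terminal _ => true
  | .nonterminal A => decide (A.reverse ∈ p)

theorem foldl_symbol (y : Symbol (Ident ⊕ Ident) Ident) (s : Scan) (hm : s.mode = .rhs)
    (hc : s.cur = []) :
    (plain (encodeSymbol y)).foldl next s = { s with ok := s.ok && symbolOk s.prod y } := by
  obtain ⟨mode, ok, sel, good, cur, lhs, prod, depth, idx, out⟩ := s
  subst hm hc
  rcases y with (a | a) | a <;>
    simp only [encodeSymbol, encodeAtom, plain_cons, plain_encodeIdent, List.foldl_cons,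
      List.foldl_append, List.foldl_nil, symbolOk, Bool.and_true]
  · rw [foldl_bits a _ (.inr (.inr ⟨false, rfl⟩))]
    rfl
  · rw [foldl_bits a _ (.inr (.inr ⟨false, rfl⟩))]
    rfl
  · rw [foldl_bits a _ (.inr (.inr ⟨true, rfl⟩))]
    simp [next, action, apply]

theorem foldl_symbols (l : List (Symbol (Ident ⊕ Ident) Ident)) (s : Scan) (hm : s.mode = .rhs)
    (hc : s.cur = []) :
    (plain (l.flatMap encodeSymbol)).foldl next s =
      { s with ok := s.ok && l.all (symbolOk s.prod) } := by
  induction l generalizing s with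
  | nil => simp [plain]
  | cons y l ih =>
    rw [List.flatMap_cons, plain_append, List.foldl_append, foldl_symbol y s hm hc,
      ih { s with ok := s.ok && symbolOk s.prod y } hm hc]
    simp [Bool.and_assoc]

theorem foldl_guard (g : List (Tok × Bool)) (s : Scan) (hm : s.mode = .guard)
    (h : closes s.depth (g.map Prod.fst) = true) :
    g.foldl next s =
      { s with
        mode := .top
        depth := 0
        idx := s.idx + 1
        out := (guardSuffix s.sel).reverse ++
          ((rename (rulePrefix s.idx) (g.map Prod.fst)).reverse ++ s.out) } := by
  induction g generalizing s with
  | nil => simp [closes] at h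
  | cons t g ih =>
    obtain ⟨t, b⟩ := t
    obtain ⟨mode, ok, sel, good, cur, lhs, prod, depth, idx, out⟩ := s
    subst hm
    rw [List.foldl_cons]
    cases t
    case rpar =>
      cases depth with
      | zero =>
        obtain rfl : g = [] := by simpa [closes] using h
        simp [next, action, apply, rename]
      | succ d =>
        refine (ih _ ?_ ?_).trans ?_
        · rfl
        · exact h
        · simp [next, action, apply, rename_cons]
    all_goals
      refine (ih _ ?_ ?_).trans ?_
      · rfl
      · exact h
      · simp [next, action, apply, rename_cons, rulePrefix]

/-- The productive nonterminals that are known after reading a rule. -/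
def prodStep (p : List (List Bool)) (r : TextRule) : List (List Bool) :=
  if r.sel && r.rhs.all (symbolOk p) then r.lhs.reverse :: p else p

/-- The text that is written for the rule number `i`. -/
def ruleOut (i : ℕ) (r : TextRule) : List Tok :=
  guardPrefix r.sel ++ (rename (rulePrefix i) r.guardText ++ guardSuffix r.sel)

/-- The text that is written for several rules. -/
def rulesOut : ℕ → List TextRule → List Tok
  | _, [] => []
  | i, r :: rs => ruleOut i r ++ rulesOut (i + 1) rs

/-- The state of a scan between two rules. -/
structure Resting (s : Scan) : Prop where
  mode : s.mode = .top
  cur : s.cur = []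
  lhs : s.lhs = []
  depth : s.depth = 0

theorem foldl_ruleHead (b : Bool) (A : Ident) (α : List (Symbol (Ident ⊕ Ident) Ident)) (s : Scan)
    (hs : s.Resting) :
    (ruleHead b A α).foldl next s =
      { s with
        mode := .rhs
        ok := b && α.all (symbolOk s.prod)
        sel := b
        lhs := A
        out := (guardPrefix b).reverse ++ s.out } := by
  obtain ⟨mode, ok, sel, good, cur, lhs, prod, depth, idx, out⟩ := s
  obtain ⟨rfl, rfl, rfl, rfl⟩ := hs
  have h_rule : next ⟨.top, ok, sel, good, [], [], prod, 0, idx, out⟩ (.rule, b) =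
      ⟨.lhs, b, b, good, [], [], prod, 0, idx, (guardPrefix b).reverse ++ out⟩ := rfl
  have h_fin : next ⟨.lhs, b, b, good, A.reverse ++ [], [], prod, 0, idx,
      (guardPrefix b).reverse ++ out⟩ (.fin, false) =
      ⟨.rhs, b, b, good, [], A, prod, 0, idx, (guardPrefix b).reverse ++ out⟩ := by
    simp [next, action, apply]
  rw [ruleHead, List.foldl_cons, List.foldl_append, plain_encodeIdent, List.foldl_append, h_rule,
    foldl_bits A _ (.inr (.inl rfl)), List.foldl_cons, List.foldl_nil, h_fin,
    foldl_symbols α _ rfl rfl]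

theorem foldl_rule (r : TextRule) (hr : Balanced r.guardText) (s : Scan) (hs : s.Resting) :
    r.text.foldl next s =
      { s with
        ok := r.sel && r.rhs.all (symbolOk s.prod)
        sel := r.sel
        prod := prodStep s.prod r
        idx := s.idx + 1
        out := (ruleOut s.idx r).reverse ++ s.out } := by
  rw [TextRule.text, List.foldl_append, foldl_ruleHead _ _ _ s hs]
  obtain ⟨sel', lhs', rhs, guard⟩ := r
  obtain ⟨mode, ok, sel, good, cur, lhs, prod, depth, idx, out⟩ := s
  obtain ⟨rfl, rfl, rfl, rfl⟩ := hs
  obtain ⟨g, hg, hcl⟩ := hr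
  obtain ⟨⟨t, b⟩, guard, rfl, rfl, rfl⟩ := List.map_eq_cons_iff.1 hg
  have h_open : next (next ⟨.rhs, sel' && rhs.all (symbolOk prod), sel', good, [], lhs', prod, 0,
      idx, (guardPrefix sel').reverse ++ out⟩ (.guard, false)) (.lpar, b) =
      ⟨.guard, sel' && rhs.all (symbolOk prod), sel', good, [], [],
        prodStep prod ⟨sel', lhs', rhs, (.lpar, b) :: guard⟩, 0, idx,
        .lpar :: ((guardPrefix sel').reverse ++ out)⟩ := rfl
  simp only [List.foldl_cons, h_open]
  rw [foldl_guard guard _ rfl hcl]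
  simp [ruleOut, TextRule.guardText, rename_cons]

theorem foldl_rules (rs : List TextRule) (hr : ∀ r ∈ rs, Balanced r.guardText) (s : Scan)
    (hs : s.Resting) : ∃ ok sel,
    (rs.flatMap TextRule.text).foldl next s =
      { s with
        ok := ok
        sel := sel
        prod := rs.foldl prodStep s.prod
        idx := s.idx + rs.length
        out := (rulesOut s.idx rs).reverse ++ s.out } := by
  induction rs generalizing s with
  | nil => exact ⟨s.ok, s.sel, rfl⟩
  | cons r rs ih =>
    rw [List.flatMap_cons, List.foldl_append, foldl_rule r (hr r (by simp)) s hs]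
    obtain ⟨ok, sel, h⟩ := ih (fun r h => hr r (by simp [h])) { s with
        ok := r.sel && r.rhs.all (symbolOk s.prod)
        sel := r.sel
        prod := prodStep s.prod r
        idx := s.idx + 1
        out := (ruleOut s.idx r).reverse ++ s.out } ⟨hs.1, hs.2, hs.3, hs.4⟩
    refine ⟨ok, sel, h.trans ?_⟩
    simp [rulesOut, Nat.add_comm 1, Nat.add_assoc]

theorem foldl_start (start : Ident) (p : List (List Bool)) :
    (plain (encodeIdent start)).foldl next (init p) =
      { mode := .top, good := decide (start.reverse ∈ p), prod := p, out := [.imp, .lpar] } := by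
  rw [plain_encodeIdent, List.foldl_append, foldl_bits start _ (.inl rfl)]
  simp [next, init, action, apply]

theorem pass_grammarText (start : Ident) (rs : List TextRule)
    (hr : ∀ r ∈ rs, Balanced r.guardText) (s : Scan) : ∃ ok sel,
    s.pass (grammarText start rs) =
      { mode := .top
        ok := ok
        sel := sel
        good := decide (start.reverse ∈ s.prod)
        prod := rs.foldl prodStep s.prod
        idx := rs.length
        out := (rulesOut 0 rs).reverse ++ [.imp, .lpar] } := by
  rw [pass, grammarText, List.foldl_append, foldl_start]
  obtain ⟨ok, sel, h⟩ := foldl_rules rs hr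
    { mode := .top, good := decide (start.reverse ∈ s.prod), prod := s.prod, out := [.imp, .lpar] }
    ⟨rfl, rfl, rfl, rfl⟩
  exact ⟨ok, sel, by rw [h, Nat.zero_add]⟩

end Scan

/-- The chain of implications with the premises given by the guards of the rules. -/
def chainText : ℕ → List TextRule → List Tok
  | _, [] => [.lpar, .bot, .rpar]
  | i, r :: rs => Scan.ruleOut i r ++ (chainText (i + 1) rs ++ [.rpar])

theorem chainText_eq (i : ℕ) (rs : List TextRule) :
    chainText i rs =
      Scan.rulesOut i rs ++ ([.lpar, .bot, .rpar] ++ List.replicate rs.length .rpar) := by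
  induction rs generalizing i with
  | nil => rfl
  | cons r rs ih =>
    rw [chainText, ih, Scan.rulesOut, List.length_cons, List.replicate_succ']
    simp

/-- The nonterminals that are known to be productive after `n` scans. -/
def productiveList (rs : List TextRule) (n : ℕ) : List (List Bool) :=
  (rs.foldl Scan.prodStep)^[n] []

theorem productiveList_succ (rs : List TextRule) (n : ℕ) :
    productiveList rs (n + 1) = rs.foldl Scan.prodStep (productiveList rs n) :=
  Function.iterate_succ_apply' _ _ _

theorem prod_iterate_pass (start : Ident) (rs : List TextRule)
    (hr : ∀ r ∈ rs, Balanced r.guardText) (n : ℕ) :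
    ((Scan.pass (grammarText start rs))^[n] {}).prod = productiveList rs n := by
  induction n with
  | zero => rfl
  | succ n ih =>
    obtain ⟨ok, sel, h⟩ := Scan.pass_grammarText start rs hr
      ((Scan.pass (grammarText start rs))^[n] {})
    rw [Function.iterate_succ_apply', h, productiveList_succ, ih]

theorem length_lt_length_grammarText (start : Ident) (rs : List TextRule) :
    rs.length < (grammarText start rs).length := by
  have h : rs.length ≤ (rs.flatMap TextRule.text).length := by
    induction rs with
    | nil => simp
    | cons r rs ih =>
      simp only [TextRule.text, ruleHead, List.flatMap_cons, List.length_append,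
        List.length_cons] at ih ⊢
      omega
  simp only [grammarText, List.length_append, plain, List.length_map, encodeIdent,
    List.length_singleton]
  omega

theorem reduction_grammarText (start : Ident) (rs : List TextRule)
    (hr : ∀ r ∈ rs, Balanced r.guardText) :
    reduction (grammarText start rs) =
      if start.reverse ∈ productiveList rs ((grammarText start rs).length - 1) then
        [.lpar, .imp] ++ (chainText 0 rs ++ [.lpar, .bot, .rpar, .rpar]) else [] := by
  obtain ⟨n, hn⟩ := Nat.exists_eq_add_of_lt (Nat.zero_lt_of_lt
    (length_lt_length_grammarText start rs))
  rw [Nat.zero_add] at hn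
  obtain ⟨ok, sel, h⟩ := Scan.pass_grammarText start rs hr
    ((Scan.pass (grammarText start rs))^[n] {})
  rw [prod_iterate_pass start rs hr] at h
  simp only [reduction, finalScan, hn, Function.iterate_succ_apply', h, Scan.formula, true_and,
    decide_eq_true_eq, Nat.add_sub_cancel]
  simp [chainText_eq, closing]

/-! ### Reconstructing a grammar from its text -/

/-- Remove the marks except on the tokens `Tok.rule`. -/
def clean (t : Tok × Bool) : Tok × Bool := (t.1, t.2 && decide (t.1 = .rule))

theorem map_fst_map_clean (a : List (Tok × Bool)) : (a.map clean).map Prod.fst = a.map Prod.fst :=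
  List.map_map

theorem Scan.next_clean (s : Scan) (t : Tok × Bool) : s.next (clean t) = s.next t := by
  obtain ⟨t, b⟩ := t
  rw [Scan.next, Scan.next, clean]
  generalize s.mode = m
  rcases m with _ | _ | _ | _ | nt | _ | _ | _
  case sym => cases nt <;> cases t <;> rfl
  all_goals cases t <;> first | rfl | simp [action]

theorem Scan.pass_map_clean (a : List (Tok × Bool)) (s : Scan) :
    s.pass (a.map clean) = s.pass a := by
  simp only [Scan.pass, List.foldl_map, Scan.next_clean]

theorem finalScan_map_clean (a : List (Tok × Bool)) : finalScan (a.map clean) = finalScan a := by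
  rw [finalScan, finalScan, List.length_map]
  exact congrArg (fun f => f^[a.length] _) (funext fun s => Scan.pass_map_clean a s)

theorem reduction_map_clean (a : List (Tok × Bool)) : reduction (a.map clean) = reduction a := by
  rw [reduction, reduction, finalScan_map_clean]

/-- `Parsed m d u`: the word `u` has the form that corresponds to the mode `m` of a scan, where `d`
is the number of parentheses of a guard that are open, except the outermost one. -/
inductive Parsed : Mode → ℕ → List (Tok × Bool) → Prop
  | fail (d : ℕ) (u : List (Tok × Bool)) : Parsed .fail d u
  | start (w : List Bool) : Parsed .start 0 (plain (w.map .bit))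
  | top (st : Ident) (rs : List TextRule) (hrs : ∀ r ∈ rs, Balanced r.guardText) :
      Parsed .top 0 (grammarText st rs)
  | lhs {x : List (Tok × Bool)} (hx : Parsed .top 0 x) (b : Bool) (w : List Bool) :
      Parsed .lhs 0 (x ++ (.rule, b) :: plain (w.map .bit))
  | rhs {x : List (Tok × Bool)} (hx : Parsed .top 0 x) (b : Bool) (A : Ident)
      (α : List (Symbol (Ident ⊕ Ident) Ident)) : Parsed .rhs 0 (x ++ ruleHead b A α)
  | sym {x : List (Tok × Bool)} (hx : Parsed .rhs 0 x) {nt : Bool} {t : Tok}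
      (ht : if nt then t = .nonterm else t = .param ∨ t = .loc) (w : List Bool) :
      Parsed (.sym nt) 0 (x ++ (t, false) :: plain (w.map .bit))
  | gstart {x : List (Tok × Bool)} (hx : Parsed .rhs 0 x) :
      Parsed .gstart 0 (x ++ [(.guard, false)])
  | guard {x : List (Tok × Bool)} (hx : Parsed .gstart 0 x) {d : ℕ} {g : List (Tok × Bool)}
      (hg : ∀ r, closes 0 (g.map Prod.fst ++ r) = closes d r) :
      Parsed .guard d (x ++ (.lpar, false) :: g)

theorem Parsed.of_eq {m : Mode} {d : ℕ} {u v : List (Tok × Bool)} (h : Parsed m d u) (e : u = v) :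
    Parsed m d v :=
  e ▸ h

theorem Parsed.exists_grammarText {d : ℕ} {u : List (Tok × Bool)} (h : Parsed .top d u) :
    ∃ st rs, (∀ r ∈ rs, Balanced (TextRule.guardText r)) ∧ u = grammarText st rs := by
  cases h with
  | top st rs hrs => exact ⟨st, rs, hrs, rfl⟩

theorem Parsed.rhs_append_symbol {x : List (Tok × Bool)} (hx : Parsed .rhs 0 x)
    (y : Symbol (Ident ⊕ Ident) Ident) : Parsed .rhs 0 (x ++ plain (encodeSymbol y)) := by
  cases hx with
  | rhs hx b A α =>
    exact (Parsed.rhs hx b A (α ++ [y])).of_eq (by simp [ruleHead, plain_append])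

theorem Parsed.top_of_guard {x g : List (Tok × Bool)} (hx : Parsed .gstart 0 x)
    (hg : closes 0 (g.map Prod.fst) = true) : Parsed .top 0 (x ++ (.lpar, false) :: g) := by
  obtain _ | _ | _ | _ | _ | _ | hx | _ := hx
  obtain _ | _ | _ | _ | ⟨hx, b, A, α⟩ | _ | _ | _ := hx
  obtain ⟨st, rs, hrs, rfl⟩ := hx.exists_grammarText
  refine (Parsed.top st (rs ++ [⟨b, A, α, (.lpar, false) :: g⟩]) fun r hr => ?_).of_eq
    (by simp [grammarText, TextRule.text])
  rcases List.mem_append.1 hr with hr | hr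
  · exact hrs r hr
  · obtain rfl := List.mem_singleton.1 hr
    exact ⟨g.map Prod.fst, rfl, hg⟩

theorem Parsed.next_of_mode_eq_guard {s : Scan} {u : List (Tok × Bool)} (hs : s.mode = .guard)
    (h : Parsed .guard s.depth u) (t : Tok × Bool) :
    Parsed (s.next (clean t)).mode (s.next (clean t)).depth (u ++ [clean t]) := by
  obtain ⟨t, b⟩ := t
  obtain ⟨mode, ok, sel, good, cur, lhs, prod, depth, idx, out⟩ := s
  subst hs
  cases h with
  | @guard x hx _ g hg =>
    have hg' : ∀ r, closes 0 ((g ++ [clean (t, b)]).map Prod.fst ++ r) = closes depth (t :: r) := by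
      intro r
      rw [List.map_append, List.append_assoc, hg]
      rfl
    rw [List.append_assoc, List.cons_append]
    cases t with
    | rpar =>
      cases depth with
      | zero => exact hx.top_of_guard (by simpa [closes] using hg' [])
      | succ d => exact .guard hx hg'
    | lpar => exact .guard hx hg'
    | _ => exact .guard (d := depth) hx fun r => (hg' r).trans (by simp only [closes])

theorem Parsed.next_of_mode_eq_sym {s : Scan} {u : List (Tok × Bool)} {nt : Bool}
    (hs : s.mode = .sym nt) (h : Parsed (.sym nt) s.depth u) (t : Tok × Bool) :
    Parsed (s.next (clean t)).mode (s.next (clean t)).depth (u ++ [clean t]) := by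
  obtain ⟨t, b⟩ := t
  obtain ⟨mode, ok, sel, good, cur, lhs, prod, depth, idx, out⟩ := s
  subst hs
  cases h with
  | @sym x hx _ t₀ ht w =>
    cases t with
    | bit b' => cases nt <;> exact (hx.sym ht (w ++ [b'])).of_eq (by simp [plain, clean])
    | fin =>
      cases nt with
      | false =>
        rcases ht with rfl | rfl
        · exact (hx.rhs_append_symbol (.terminal (.inl w))).of_eq
            (by simp [plain, clean, encodeSymbol, encodeAtom, encodeIdent])
        · exact (hx.rhs_append_symbol (.terminal (.inr w))).of_eq
            (by simp [plain, clean, encodeSymbol, encodeAtom, encodeIdent])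
      | true =>
        obtain rfl : t₀ = .nonterm := ht
        exact (hx.rhs_append_symbol (.nonterminal w)).of_eq
          (by simp [plain, clean, encodeSymbol, encodeIdent])
    | _ => cases nt <;> exact .fail _ _

theorem Parsed.next {s : Scan} {u : List (Tok × Bool)} (h : Parsed s.mode s.depth u)
    (t : Tok × Bool) :
    Parsed (s.next (clean t)).mode (s.next (clean t)).depth (u ++ [clean t]) := by
  by_cases hs : s.mode = .guard
  · exact Parsed.next_of_mode_eq_guard hs (hs ▸ h) t
  obtain ⟨t, b⟩ := t
  obtain ⟨mode, ok, sel, good, cur, lhs, prod, depth, idx, out⟩ := s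
  cases h with
  | guard => exact absurd rfl hs
  | fail => cases t <;> exact .fail _ _
  | start w =>
    cases t with
    | bit b' => exact (Parsed.start (w ++ [b'])).of_eq (by simp [plain, clean])
    | fin =>
      exact (Parsed.top w [] (by simp)).of_eq (by simp [grammarText, plain_encodeIdent, clean])
    | _ => exact .fail _ _
  | top st rs hrs =>
    cases t with
    | rule => exact (Parsed.lhs (.top st rs hrs) b []).of_eq (by simp [plain, clean])
    | _ => exact .fail _ _
  | lhs hx b₀ w =>
    cases t with
    | bit b' => exact (Parsed.lhs hx b₀ (w ++ [b'])).of_eq (by simp [plain, clean])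
    | fin => exact (Parsed.rhs hx b₀ w []).of_eq (by simp [plain, encodeIdent, clean, ruleHead])
    | _ => exact .fail _ _
  | rhs hx b₀ A α =>
    have h := Parsed.rhs hx b₀ A α
    cases t with
    | param => exact (h.sym (nt := false) (.inl rfl) []).of_eq (by simp [plain, clean])
    | loc => exact (h.sym (nt := false) (.inr rfl) []).of_eq (by simp [plain, clean])
    | nonterm => exact (h.sym (nt := true) rfl []).of_eq (by simp [plain, clean])
    | guard => exact h.gstart.of_eq (by simp [clean])
    | _ => exact .fail _ _
  | @sym _ hx nt _ ht w => exact Parsed.next_of_mode_eq_sym (nt := nt) rfl (.sym hx ht w) (t, b)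
  | gstart hx =>
    cases t with
    | lpar => exact ((Parsed.gstart hx).guard (g := []) fun _ => rfl).of_eq (by simp [clean])
    | _ => exact .fail _ _

theorem parsed_foldl_next (a : List (Tok × Bool)) (p : List (List Bool)) :
    Parsed ((a.map clean).foldl Scan.next (Scan.init p)).mode
      ((a.map clean).foldl Scan.next (Scan.init p)).depth (a.map clean) := by
  induction a using List.reverseRecOn with
  | nil => exact .start []
  | append_singleton a t ih =>
    rw [List.map_append, List.foldl_append]
    exact ih.next t

theorem exists_map_clean_eq_grammarText (a : List (Tok × Bool)) (h : reduction a ≠ []) :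
    ∃ st rs, (∀ r ∈ rs, Balanced (TextRule.guardText r)) ∧ a.map clean = grammarText st rs := by
  have hm : (finalScan a).mode = .top := by
    by_contra hm
    exact h (by simp [reduction, Scan.formula, hm])
  rw [finalScan] at hm
  cases hn : a.length with
  | zero => simp [hn] at hm
  | succ n =>
    rw [hn, Function.iterate_succ_apply', ← Scan.pass_map_clean] at hm
    have hp := parsed_foldl_next a ((Scan.pass a)^[n] {}).prod
    rw [show ((a.map clean).foldl Scan.next _).mode = _ from hm] at hp
    exact hp.exists_grammarText

/-! ### Chains of implications -/

section Chains

variable {L : FirstOrder.Language.{u, v}}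

/-- The premise of a chain of implications that is written for the rule number `i`. -/
def premise (i : ℕ) (q : Bool × Production L) : GuardFormula L :=
  if q.1 then renameFormula (rulePrefix i) q.2.guard
  else .imp .falsum (renameFormula (rulePrefix i) q.2.guard)

/-- The chain of implications for some rules. -/
def chainFormula : ℕ → List (Bool × Production L) → GuardFormula L
  | _, [] => .falsum
  | i, q :: l => .imp (premise i q) (chainFormula (i + 1) l)

theorem isQF_premise (i : ℕ) (q : Bool × Production L) : (premise i q).IsQF := by
  have := isQF_renameFormula (rulePrefix i) q.2.guard_isQF
  rw [premise]
  split
  · exact this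
  · exact .imp .falsum this

theorem isQF_chainFormula (i : ℕ) (l : List (Bool × Production L)) : (chainFormula i l).IsQF := by
  induction l generalizing i with
  | nil => exact .falsum
  | cons q l ih => exact .imp (isQF_premise i q) (ih _)

theorem not_realize_chainFormula {D : Type w} [L.Structure D] (i : ℕ)
    (l : List (Bool × Production L)) (x : Ident ⊕ Ident → D) :
    ¬ (chainFormula i l).Realize x ↔ ∀ (j : ℕ) (r : Production L), l[j]? = some (true, r) →
      r.guard.Realize (x ∘ renameAtom (rulePrefix (i + j))) := by
  induction l generalizing i with
  | nil => exact iff_of_true id (by simp)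
  | cons q l ih =>
    change ¬ ((premise i q).Realize x → (chainFormula (i + 1) l).Realize x) ↔ _
    rw [Classical.not_imp, ih, ← Nat.and_forall_add_one (p := fun j => ∀ r, (q :: l)[j]? = _ → _)]
    refine and_congr ?_ (forall_congr' fun j => ?_)
    · obtain ⟨b, r⟩ := q
      cases b with
      | true =>
        rw [show premise i (true, r) = renameFormula (rulePrefix i) r.guard from rfl,
          realize_renameFormula]
        simp
      | false => exact iff_of_true (fun h => h.elim) (by simp)
    · rw [List.getElem?_cons_succ, Nat.add_assoc, Nat.add_comm 1]

/-- The interpretation that agrees with `Y i` on the names with the prefix of the rule `i`. -/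
def jointInterpretation (Y : ℕ → Ident → D) (y : Ident) : D :=
  Y (y.takeWhile id).length (y.drop ((y.takeWhile id).length + 1))

theorem jointInterpretation_rulePrefix (Y : ℕ → Ident → D) (i : ℕ) (y : Ident) :
    jointInterpretation Y (rulePrefix i ++ y) = Y i y := by
  have h : (rulePrefix i ++ y).takeWhile id = List.replicate i true := by
    rw [rulePrefix, List.append_assoc, List.takeWhile_append_of_pos (by simp)]
    simp
  rw [jointInterpretation, h, List.length_replicate]
  congr 1
  rw [List.drop_append_of_le_length (by simp [rulePrefix]), List.drop_of_length_le
    (by simp [rulePrefix]), List.nil_append]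

theorem exists_not_realize_chainFormula_iff {D : Type w} [L.Structure D]
    {l : List (Bool × Production L)} {X : Ident → D} :
    (∃ Y, ¬ (chainFormula 0 l).Realize (Sum.elim X Y)) ↔
      ∀ r, (true, r) ∈ l → ∃ Y, r.guard.Realize (Sum.elim X Y) := by
  have h_comp (Y : Ident → D) (p : List Bool) :
      Sum.elim X Y ∘ renameAtom p = Sum.elim X fun y => Y (p ++ y) :=
    Sum.elim_comp_map
  simp only [not_realize_chainFormula, Nat.zero_add, h_comp]
  constructor
  · rintro ⟨Y, hY⟩ r hr
    obtain ⟨j, hj⟩ := List.mem_iff_getElem?.1 hr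
    exact ⟨_, hY j r hj⟩
  · intro h
    have h_local (j : ℕ) : ∃ Y : Ident → D, ∀ r : Production L, l[j]? = some (true, r) →
        r.guard.Realize (Sum.elim X Y) := by
      by_cases hj : ∃ r, l[j]? = some (true, r)
      · obtain ⟨r, hj⟩ := hj
        obtain ⟨Y, hY⟩ := h r (List.mem_of_getElem? hj)
        refine ⟨Y, fun r' hr' => ?_⟩
        obtain rfl : r = r' := by simpa [hj] using hr'
        exact hY
      · exact ⟨X, fun r hr => absurd ⟨r, hr⟩ hj⟩
    choose Y hY using h_local
    refine ⟨jointInterpretation Y, fun j r hj => ?_⟩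
    simpa only [jointInterpretation_rulePrefix] using hY j r hj

end Chains

section ChainTexts

variable {L : FirstOrder.Language.{u, v}} (c : SymbolCoding L)

/-- A rule whose guard is a text stands for a production. -/
structure Represents (r : TextRule) (q : Bool × Production L) : Prop where
  sel : r.sel = q.1
  lhs : r.lhs = q.2.lhs
  rhs : r.rhs = q.2.rhs
  guard : r.guardText = encodeFormula c q.2.guard

theorem encodeFormula_chainFormula (i : ℕ) {rs : List TextRule} {l : List (Bool × Production L)}
    (h : List.Forall₂ (Represents c) rs l) :
    encodeFormula c (chainFormula i l) = chainText i rs := by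
  induction h generalizing i with
  | nil => rfl
  | @cons r q rs l h _ ih =>
    rw [chainFormula, encodeFormula, ih, chainText, Scan.ruleOut, h.guard, h.sel,
      ← encodeFormula_renameFormula, premise]
    cases q.1 <;> simp [guardPrefix, guardSuffix, encodeFormula]

theorem exists_of_encodeFormula_eq_chainText {i : ℕ} {rs : List TextRule}
    (hr : ∀ r ∈ rs, Balanced r.guardText) {ψ : GuardFormula L} (hψ : ψ.IsQF)
    (h : encodeFormula c ψ = chainText i rs) :
    ∃ l : List (Bool × Production L), List.Forall₂ (Represents c) rs l ∧
      ψ = chainFormula i l := by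
  induction rs generalizing i ψ with
  | nil => exact ⟨[], .nil, eq_falsum_of_encodeFormula_eq c h⟩
  | cons r rs ih =>
    have hb := (hr r (by simp)).rename (rulePrefix i)
    have hr' : ∀ r ∈ rs, Balanced r.guardText := fun r h => hr r (by simp [h])
    obtain ⟨sel, lhs, rhs, guard⟩ := r
    cases sel with
    | true =>
      obtain ⟨ψ₁, ψ₂, hq₁, hq₂, rfl, h₁, h₂⟩ := eq_imp_of_encodeFormula_eq c hψ hb
        (by simpa [chainText, Scan.ruleOut, guardPrefix, guardSuffix] using h)
      obtain ⟨φ, hφ, h₃, rfl⟩ := exists_of_rename_eq_encodeFormula c hq₁ h₁.symm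
      obtain ⟨l, hl, rfl⟩ := ih hr' hq₂ h₂
      exact ⟨(true, ⟨lhs, rhs, φ, hφ⟩) :: l, .cons ⟨rfl, rfl, rfl, h₃⟩ hl, rfl⟩
    | false =>
      have hb' : Balanced ([.lpar, .imp] ++ ([.lpar, .bot, .rpar] ++
          (rename (rulePrefix i) (TextRule.guardText ⟨false, lhs, rhs, guard⟩) ++ [.rpar]))) :=
        (((neutral_singleton (t := .imp) nofun nofun).append
          (Balanced.neutral ⟨[.bot, .rpar], rfl, rfl⟩)).append hb.neutral).balanced
      obtain ⟨ψ₁, ψ₂, hq₁, hq₂, rfl, h₁, h₂⟩ := eq_imp_of_encodeFormula_eq c hψ hb'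
        (by simpa [chainText, Scan.ruleOut, guardPrefix, guardSuffix] using h)
      obtain ⟨ψ₃, ψ₄, hq₃, hq₄, rfl, h₃, h₄⟩ := eq_imp_of_encodeFormula_eq c hq₁
        ⟨[.bot, .rpar], rfl, rfl⟩ h₁
      obtain rfl := eq_falsum_of_encodeFormula_eq c h₃
      obtain ⟨φ, hφ, h₅, rfl⟩ := exists_of_rename_eq_encodeFormula c hq₄ h₄.symm
      obtain ⟨l, hl, rfl⟩ := ih hr' hq₂ h₂
      exact ⟨(false, ⟨lhs, rhs, φ, hφ⟩) :: l, .cons ⟨rfl, rfl, rfl, h₅⟩ hl, rfl⟩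

theorem balanced_chainText (i : ℕ) {rs : List TextRule} (hr : ∀ r ∈ rs, Balanced r.guardText) :
    Balanced (chainText i rs) := by
  induction rs generalizing i with
  | nil => exact ⟨_, rfl, rfl⟩
  | cons r rs ih =>
    have hb := ((hr r (by simp)).rename (rulePrefix i)).neutral
    have hi := (ih (i + 1) fun r h => hr r (by simp [h])).neutral
    have himp : Neutral [.imp] := neutral_singleton nofun nofun
    rw [chainText, Scan.ruleOut]
    cases r.sel with
    | true => simpa [guardPrefix, guardSuffix] using ((himp.append hb).append hi).balanced
    | false =>
      have hbot : Neutral [.lpar, .bot, .rpar] := Balanced.neutral ⟨_, rfl, rfl⟩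
      simpa [guardPrefix, guardSuffix] using
        ((himp.append ((himp.append hbot).append hb).balanced.neutral).append hi).balanced

end ChainTexts

/-! ### Correctness of the scans -/

/-- The selected rules. -/
def Selected (rs : List TextRule) (A : Ident) (α : List (Symbol (Ident ⊕ Ident) Ident)) : Prop :=
  ∃ r ∈ rs, r.sel = true ∧ r.lhs = A ∧ r.rhs = α

theorem symbolOk_all_iff {p : List (List Bool)} {α : List (Symbol (Ident ⊕ Ident) Ident)} :
    α.all (Scan.symbolOk p) = true ↔ ∀ B, .nonterminal B ∈ α → B.reverse ∈ p := by
  rw [List.all_eq_true]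
  refine ⟨fun h B hB => of_decide_eq_true (h _ hB), fun h y hy => ?_⟩
  cases y with
  | terminal t => rfl
  | nonterminal B => exact decide_eq_true (h B hy)

theorem subset_foldl_prodStep (rs : List TextRule) (p : List (List Bool)) :
    p ⊆ rs.foldl Scan.prodStep p := by
  induction rs generalizing p with
  | nil => simp
  | cons r rs ih =>
    refine List.Subset.trans ?_ (ih _)
    rw [Scan.prodStep]
    split <;> simp

theorem mem_foldl_prodStep {rs : List TextRule} {p : List (List Bool)} {r : TextRule}
    (hr : r ∈ rs) (hs : r.sel = true) (h : ∀ B, .nonterminal B ∈ r.rhs → B.reverse ∈ p) :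
    r.lhs.reverse ∈ rs.foldl Scan.prodStep p := by
  obtain ⟨l, l', rfl⟩ := List.append_of_mem hr
  rw [List.foldl_append, List.foldl_cons]
  refine subset_foldl_prodStep l' _ ?_
  have : r.rhs.all (Scan.symbolOk (l.foldl Scan.prodStep p)) = true :=
    symbolOk_all_iff.2 fun B hB => subset_foldl_prodStep l p (h B hB)
  simp [Scan.prodStep, hs, this]

theorem productive_of_mem_foldl {R : Ident → List (Symbol (Ident ⊕ Ident) Ident) → Prop}
    {rs : List TextRule} (hR : ∀ r ∈ rs, r.sel = true → R r.lhs r.rhs) {p : List (List Bool)}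
    (hp : ∀ e ∈ p, Productive R e.reverse) :
    ∀ e ∈ rs.foldl Scan.prodStep p, Productive R e.reverse := by
  induction rs generalizing p with
  | nil => exact hp
  | cons r rs ih =>
    refine ih (fun r hr => hR r (by simp [hr])) ?_
    rw [Scan.prodStep]
    split
    · next h =>
      rw [Bool.and_eq_true, symbolOk_all_iff] at h
      rintro e (_ | ⟨_, he⟩)
      · rw [List.reverse_reverse]
        exact .intro _ _ (hR r (by simp) h.1) fun B hB => by simpa using hp _ (h.2 B hB)
      · exact hp e he
    · exact hp

theorem productive_of_mem_productiveList {rs : List TextRule} {n : ℕ} {A : Ident}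
    (h : A.reverse ∈ productiveList rs n) : Productive (Selected rs) A := by
  have : ∀ e ∈ productiveList rs n, Productive (Selected rs) e.reverse := by
    clear h
    induction n with
    | zero => simp [productiveList]
    | succ n ih =>
      rw [productiveList_succ]
      exact productive_of_mem_foldl (fun r hr hs => ⟨r, hr, hs, rfl, rfl⟩) ih
  simpa using this _ h

theorem productiveList_subset (rs : List TextRule) {m n : ℕ} (h : m ≤ n) :
    productiveList rs m ⊆ productiveList rs n := by
  induction h with
  | refl => simp
  | step _ ih =>
    rw [productiveList_succ]
    exact List.Subset.trans ih (subset_foldl_prodStep rs _)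

theorem foldl_prodStep_subset (rs : List TextRule) (p : List (List Bool)) :
    rs.foldl Scan.prodStep p ⊆ p ++ rs.map fun r => r.lhs.reverse := by
  induction rs generalizing p with
  | nil => simp
  | cons r rs ih =>
    refine List.Subset.trans (ih _) fun e he => ?_
    rw [Scan.prodStep] at he
    split at he <;> simp at he ⊢ <;> tauto

theorem productiveList_subset_map (rs : List TextRule) (n : ℕ) :
    productiveList rs n ⊆ rs.map fun r => r.lhs.reverse := by
  induction n with
  | zero => simp [productiveList]
  | succ n ih =>
    rw [productiveList_succ]
    refine List.Subset.trans (foldl_prodStep_subset rs _) ?_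
    exact List.append_subset.2 ⟨ih, List.Subset.refl _⟩

/-- Each step before the iteration becomes stationary adds an element of `s`. -/
theorem exists_iterate_succ_subset {β : Type*} {f : List β → List β}
    (hf : ∀ p, p ⊆ f p) {p s : List β} (hs : ∀ n, f^[n] p ⊆ s) :
    ∃ n ≤ s.length, f^[n + 1] p ⊆ f^[n] p := by
  classical
  have h_toFinset {p q : List β} (h : p ⊆ q) : p.toFinset ⊆ q.toFinset :=
    fun e he => List.mem_toFinset.2 (h (List.mem_toFinset.1 he))
  by_contra! h
  have h_card : ∀ n ≤ s.length + 1, n ≤ (f^[n] p).toFinset.card := by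
    intro n hn
    induction n with
    | zero => exact Nat.zero_le _
    | succ n ih =>
      refine (ih (by omega)).trans_lt (Finset.card_lt_card ⟨?_, fun h' => ?_⟩)
      · rw [Function.iterate_succ_apply']
        exact h_toFinset (hf _)
      · exact h n (by omega) fun e he => by simpa using h' (List.mem_toFinset.2 he)
  have h_lower := h_card _ le_rfl
  have h_upper : (f^[s.length + 1] p).toFinset.card ≤ s.length :=
    (Finset.card_le_card (h_toFinset (hs _))).trans (List.toFinset_card_le s)
  omega

theorem mem_productiveList_iff {rs : List TextRule} {n : ℕ} (hn : rs.length ≤ n) {A : Ident} :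
    A.reverse ∈ productiveList rs n ↔ Productive (Selected rs) A := by
  refine ⟨productive_of_mem_productiveList, fun h => ?_⟩
  obtain ⟨m, hm, hs⟩ := exists_iterate_succ_subset (subset_foldl_prodStep rs)
    (productiveList_subset_map rs)
  rw [List.length_map] at hm
  refine productiveList_subset rs (hm.trans hn) ?_
  induction h with
  | intro A α hR _ ih =>
    obtain ⟨r, hr, hsel, rfl, rfl⟩ := hR
    refine hs ?_
    rw [Function.iterate_succ_apply']
    exact mem_foldl_prodStep hr hsel ih

/-! ### Nonemptiness as satisfiability -/

section Nonemptiness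

variable {L : FirstOrder.Language.{u, v}} (c : SymbolCoding L)

theorem Represents.balanced_of_mem {rs : List TextRule} {l : List (Bool × Production L)}
    (h : List.Forall₂ (Represents c) rs l) : ∀ r ∈ rs, Balanced r.guardText := by
  induction h with
  | nil => simp
  | cons h _ ih =>
    refine List.forall_mem_cons.2 ⟨?_, ih⟩
    rw [h.guard]
    exact balanced_encodeFormula c _

theorem map_fst_grammarText (start : Ident) {rs : List TextRule} {l : List (Bool × Production L)}
    (h : List.Forall₂ (Represents c) rs l) :
    (grammarText start rs).map Prod.fst = encodeGrammar c ⟨start, l.map Prod.snd⟩ := by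
  rw [grammarText, encodeGrammar, List.map_append, map_fst_plain]
  congr 1
  induction h with
  | nil => rfl
  | cons h _ ih =>
    rw [List.flatMap_cons, List.map_append, ih, List.map_cons, List.flatMap_cons]
    congr 1
    rw [TextRule.text, encodeProduction, ← h.lhs, ← h.rhs, ← h.guard]
    simp [ruleHead, map_fst_plain, TextRule.guardText]

/-- The text of a production. -/
def textRule (q : Bool × Production L) : TextRule :=
  ⟨q.1, q.2.lhs, q.2.rhs, plain (encodeFormula c q.2.guard)⟩

theorem forall₂_represents_map (l : List (Bool × Production L)) :
    List.Forall₂ (Represents c) (l.map (textRule c)) l := by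
  rw [List.forall₂_map_left_iff]
  exact List.forall₂_same.2 fun q _ => ⟨rfl, rfl, rfl, map_fst_plain _⟩

theorem selected_iff {rs : List TextRule} {l : List (Bool × Production L)}
    (h : List.Forall₂ (Represents c) rs l) {A : Ident}
    {α : List (Symbol (Ident ⊕ Ident) Ident)} :
    Selected rs A α ↔ ∃ r, (true, r) ∈ l ∧ r.lhs = A ∧ r.rhs = α := by
  induction h with
  | nil => simp [Selected]
  | @cons r q rs l h _ ih =>
    obtain ⟨b, r'⟩ := q
    simp only [Selected, List.mem_cons, or_and_right, exists_or, exists_eq_left, Prod.mk.injEq]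
      at ih ⊢
    rw [ih, h.sel, h.lhs, h.rhs]
    refine or_congr ⟨fun h => ⟨r', ⟨h.1.symm, rfl⟩, h.2⟩, ?_⟩ Iff.rfl
    rintro ⟨_, ⟨hb, rfl⟩, h'⟩
    exact ⟨hb.symm, h'⟩

theorem reduction_eq_encodeFormula (start : Ident) {rs : List TextRule}
    {l : List (Bool × Production L)} (h : List.Forall₂ (Represents c) rs l)
    (hs : Productive (Selected rs) start) :
    reduction (grammarText start rs) =
      encodeFormula c (.imp (chainFormula 0 l) .falsum : GuardFormula L) := by
  have hn := Nat.le_sub_one_of_lt (length_lt_length_grammarText start rs)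
  rw [reduction_grammarText start rs (Represents.balanced_of_mem c h),
    if_pos ((mem_productiveList_iff hn).2 hs), encodeFormula, encodeFormula_chainFormula c 0 h]
  simp [encodeFormula]

theorem exists_of_reduction_eq_encodeFormula {start : Ident} {rs : List TextRule}
    (hr : ∀ r ∈ rs, Balanced r.guardText) {ψ : GuardFormula L} (hψ : ψ.IsQF)
    (h : reduction (grammarText start rs) = encodeFormula c ψ) :
    Productive (Selected rs) start ∧ ∃ l : List (Bool × Production L),
      List.Forall₂ (Represents c) rs l ∧ ψ = .imp (chainFormula 0 l) .falsum := by
  rw [reduction_grammarText start rs hr] at h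
  split at h
  · next hs =>
    refine ⟨productive_of_mem_productiveList hs, ?_⟩
    obtain ⟨ψ₁, ψ₂, hψ₁, -, rfl, h₁, h₂⟩ := eq_imp_of_encodeFormula_eq c hψ
      (v := [.lpar, .bot, .rpar]) (balanced_chainText 0 hr) (by simpa using h.symm)
    obtain rfl := eq_falsum_of_encodeFormula_eq c h₂
    obtain ⟨l, hl, rfl⟩ := exists_of_encodeFormula_eq_chainText c hr hψ₁ h₁
    exact ⟨l, hl, rfl⟩
  · exact absurd h.symm (encodeFormula_ne_nil c ψ)

variable {D : Type w} [L.Structure D]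

theorem exists_reduction_mem_satProblem {G : Grammar L}
    (h : Set.Nonempty (G.language D : Set (List D))) :
    ∃ a, a.map Prod.fst = encodeGrammar c G ∧ reduction a ∈ satProblem c D := by
  classical
  obtain ⟨X, hX⟩ := G.language_nonempty_iff.1 h
  let enabled (r : Production L) : Prop := ∃ Y : Ident → D, r.guard.Realize (Sum.elim X Y)
  let l : List (Bool × Production L) := G.productions.map fun r => (decide (enabled r), r)
  have hl := forall₂_represents_map c l
  have hs : Productive (Selected (l.map (textRule c))) G.start := by
    refine hX.mono fun A α => ?_
    rintro ⟨r, hr, rfl, rfl, hY⟩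
    exact (selected_iff c hl).2 ⟨r, List.mem_map.2 ⟨r, hr, by simp [enabled, hY]⟩, rfl, rfl⟩
  have h_enabled : ∀ r, (true, r) ∈ l → enabled r := by
    intro r hr
    obtain ⟨r', -, hr'⟩ := List.mem_map.1 hr
    obtain ⟨h_true, rfl⟩ := Prod.mk.inj hr'
    exact of_decide_eq_true h_true
  obtain ⟨Y, hY⟩ := exists_not_realize_chainFormula_iff.2 h_enabled
  refine ⟨grammarText G.start (l.map (textRule c)), ?_, .imp (chainFormula 0 l) .falsum,
    .imp (isQF_chainFormula 0 l) .falsum, (reduction_eq_encodeFormula c G.start hl hs).symm,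
    X, Y, hY⟩
  rw [map_fst_grammarText c G.start hl]
  simp [l, Function.comp_def]

theorem mem_nonemptinessProblem_of_reduction_mem {a : List (Tok × Bool)}
    (h : reduction a ∈ satProblem c D) : a.map Prod.fst ∈ nonemptinessProblem c D := by
  obtain ⟨ψ, hψ, h_eq, X, Y, hXY⟩ := h
  obtain ⟨st, rs, hr, ha⟩ := exists_map_clean_eq_grammarText a
    (h_eq ▸ encodeFormula_ne_nil c ψ)
  rw [← reduction_map_clean, ha] at h_eq
  obtain ⟨hs, l, hl, rfl⟩ := exists_of_reduction_eq_encodeFormula c hr hψ h_eq.symm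
  refine ⟨⟨st, l.map Prod.snd⟩, ?_, ?_⟩
  · rw [← map_fst_grammarText c st hl, ← ha, map_fst_map_clean]
  · refine (Grammar.language_nonempty_iff _).2 ⟨X, hs.mono fun A α hA => ?_⟩
    obtain ⟨r, hr, rfl, rfl⟩ := (selected_iff c hl).1 hA
    exact ⟨r, List.mem_map.2 ⟨_, hr, rfl⟩, rfl, rfl,
      exists_not_realize_chainFormula_iff.1 ⟨Y, hXY⟩ r hr⟩

theorem mem_nonemptinessProblem_iff {x : List Tok} :
    x ∈ nonemptinessProblem c D ↔ ∃ a, a.map Prod.fst = x ∧ reduction a ∈ satProblem c D := by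
  constructor
  · rintro ⟨G, rfl, h⟩
    exact exists_reduction_mem_satProblem c h
  · rintro ⟨a, rfl, h⟩
    exact mem_nonemptinessProblem_of_reduction_mem c h

theorem nonemptinessProblem_eq_markedProjection (D : Type w) [L.Structure D] :
    nonemptinessProblem c D =
      Complexity.markedProjection (Complexity.preimage reduction (satProblem c D)) :=
  Set.ext fun _ => (mem_nonemptinessProblem_iff c).trans <| exists_congr fun _ => and_comm

end Nonemptiness

open Turing StackProgram RegProgram Function

/-! ### Computing the translation in polynomial time -/

/-- The stacks of the program that computes `reduction`: the annotated grammar `ann`, the result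
`res`, the number `cnt` of scans that remain, and the data of a scan. A primed stack holds what has
been removed from the stack of the same name. -/
inductive ScanStack
  | ann | ann' | res | cnt | out | set | set' | cur | cur' | lhs | depth | idx | idx'
  deriving DecidableEq

instance : Fintype ScanStack where
  elems := {.ann, .ann', .res, .cnt, .out, .set, .set', .cur, .cur', .lhs, .depth, .idx, .idx'}
  complete k := by cases k <;> decide

/-- The alphabets of the stacks. Numbers are written in unary; a list of words is written as one
word in which `none` ends each of them. -/
abbrev ScanStack.Alphabet : ScanStack → Type
  | .ann | .ann' => Tok × Bool
  | .res | .out => Tok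
  | .cur | .cur' | .lhs => Bool
  | .set | .set' => Option Bool
  | .cnt | .depth | .idx | .idx' => Unit

instance (k : ScanStack) : Fintype k.Alphabet := by
  cases k <;> infer_instance

/-- The variables of the program that computes `reduction`. -/
structure ScanVars where
  mode : Mode := .start
  ok : Bool := false
  sel : Bool := false
  good : Bool := false
  /-- The two words that are being compared agree so far. -/
  eq : Bool := false
  /-- A word has been found in a list. -/
  found : Bool := false
  deriving Fintype

/-- The programs from which the one for `reduction` is built. -/
abbrev ScanProg : Type 1 :=
  RegProgram ScanStack.Alphabet ScanVars (Empty.elim : Empty → FinTM2)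

/-- The contents of the stacks of a `ScanProg`. -/
abbrev ScanStacks : Type := ∀ k : ScanStack, List k.Alphabet

/-- The memory of a `ScanProg`. -/
abbrev ScanMem : Type := Mem ScanStack.Alphabet ScanVars

/-- A list of words as one word. -/
def flat (l : List (List Bool)) : List (Option Bool) := l.flatMap fun e => e.map some ++ [none]

theorem length_flat (l : List (List Bool)) :
    (flat l).length = (l.map fun e => e.length + 1).sum := by
  simp [flat, List.length_flatMap]

/-! #### Membership in a list of words -/

/-- Move `cur'` back to `cur`. -/
noncomputable def restoreCur : ScanProg := RegProgram.move .cur' .cur id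

/-- Compare one symbol of `set` with `cur`. -/
noncomputable def compareSymbol (c : Option Bool) : ScanProg :=
  (push .set' c).seq <| pop .cur fun d => match c, d with
    | some b, some b' =>
        (push .cur' b').seq (assign fun v => { v with eq := v.eq && b == b' })
    | some _, none => assign fun v => { v with eq := false }
    | none, some b' =>
        (push .cur' b').seq ((assign fun v => { v with eq := true }).seq restoreCur)
    | none, none =>
        (assign fun v => { v with found := v.found || v.eq, eq := true }).seq restoreCur

/-- The data of the search for the word `cur` in a list of words. -/
structure Comparison where
  eq : Bool
  found : Bool
  cur : List Bool
  cur' : List Bool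
  set' : List (Option Bool)

/-- The effect of `compareSymbol`. -/
def Comparison.next (x : Comparison) (c : Option Bool) : Comparison :=
  match c, x.cur with
  | some b, b' :: l => ⟨x.eq && b == b', x.found, l, b' :: x.cur', some b :: x.set'⟩
  | some b, [] => ⟨false, x.found, [], x.cur', some b :: x.set'⟩
  | none, l => ⟨true, x.found || (x.eq && l.isEmpty), x.cur'.reverse ++ l, [], none :: x.set'⟩

/-- The memory during a search; the symbols `l` of the list remain to be read. -/
def Comparison.mem (v : ScanVars) (S : ScanStacks) (x : Comparison) (l : List (Option Bool)) :
    ScanMem :=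
  ({ v with eq := x.eq, found := x.found }, fun
    | .set => l
    | .set' => x.set'
    | .cur => x.cur
    | .cur' => x.cur'
    | k => S k)

theorem does_restoreCur (s : ScanMem) :
    restoreCur.Does s ((s.2 .cur').length * 4 + 1)
      (s.1, update (update s.2 .cur' []) .cur ((s.2 .cur').reverse ++ s.2 .cur)) := by
  simpa only [List.map_id] using!
    Does.move (Γ := ScanStack.Alphabet) (k := .cur') (k' := .cur) (by decide) id s

theorem does_compareSymbol (v : ScanVars) (S : ScanStacks) (x : Comparison) (c : Option Bool)
    (l : List (Option Bool)) :
    (compareSymbol c).Does (x.mem v S l) (4 * (x.cur.length + x.cur'.length) + 10)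
      ((x.next c).mem v S l) := by
  obtain ⟨eq, found, cur, cur', set'⟩ := x
  refine ((Does.push _ _ _).seq
    (Does.pop (t := 4 * (cur.length + cur'.length) + 6) cur rfl ?_)).mono_time
      (by dsimp only; omega)
  rcases c with _ | b <;> rcases cur with _ | ⟨b', cur⟩
  · refine ((Does.assign _ _).seq (does_restoreCur _)).congr
      (Prod.ext (by simp [Comparison.next, Comparison.mem]) (funext fun k => by cases k <;> rfl)) ?_
    change 1 + (cur'.length * 4 + 1) ≤ 4 * (0 + cur'.length) + 6
    omega
  · refine ((Does.push _ _ _).seq ((Does.assign _ _).seq (does_restoreCur _))).congr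
      (Prod.ext (by simp [Comparison.next, Comparison.mem]) (funext fun k => ?_)) ?_
    · cases k <;> try rfl
      simp [Comparison.next, Comparison.mem]
    · change 1 + (1 + ((cur'.length + 1) * 4 + 1)) ≤ 4 * (cur.length + 1 + cur'.length) + 6
      omega
  · exact (Does.assign _ _).congr (Prod.ext rfl (funext fun k => by cases k <;> rfl)) (by omega)
  · exact ((Does.push _ _ _).seq (Does.assign _ _)).congr
      (Prod.ext rfl (funext fun k => by cases k <;> rfl)) (by omega)

theorem Comparison.length_next (x : Comparison) (c : Option Bool) :
    (x.next c).cur.length + (x.next c).cur'.length = x.cur.length + x.cur'.length := by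
  obtain ⟨eq, found, cur, cur', set'⟩ := x
  rcases c with _ | b <;> rcases cur with _ | ⟨b', cur⟩ <;>
    simp only [Comparison.next, List.length_append, List.length_reverse, List.length_cons,
      List.length_nil] <;> omega

theorem Comparison.foldl_next_word (e : List Bool) (x : Comparison) :
    (e.map some ++ [none]).foldl next x =
      ⟨true, x.found || (x.eq && decide (x.cur = e)), x.cur'.reverse ++ x.cur, [],
        (e.map some ++ [none]).reverse ++ x.set'⟩ := by
  induction e generalizing x with
  | nil =>
    obtain ⟨eq, found, cur, cur', set'⟩ := x
    cases cur <;> simp [Comparison.next]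
  | cons b e ih =>
    simp only [List.map_cons, List.cons_append, List.foldl_cons, ih]
    obtain ⟨eq, found, cur, cur', set'⟩ := x
    rcases cur with _ | ⟨b', cur⟩
    · simp [Comparison.next]
    · by_cases h : b = b'
      · simp [Comparison.next, h]
      · simp [Comparison.next, h, Ne.symm h]

theorem Comparison.foldl_next_flat (p : List (List Bool)) (x : Comparison) (h_eq : x.eq = true)
    (h_cur' : x.cur' = []) :
    (flat p).foldl next x =
      ⟨true, x.found || decide (x.cur ∈ p), x.cur, [], (flat p).reverse ++ x.set'⟩ := by
  induction p generalizing x with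
  | nil =>
    obtain ⟨eq, found, cur, cur', set'⟩ := x
    simp_all [flat]
  | cons e p ih =>
    have h_flat : flat (e :: p) = (e.map some ++ [none]) ++ flat p := rfl
    rw [h_flat, List.foldl_append, foldl_next_word, ih _ rfl rfl]
    simp [h_eq, h_cur', Bool.or_assoc]

theorem does_forAll_compareSymbol (v : ScanVars) (S : ScanStacks) (u : List Bool)
    (p : List (List Bool)) :
    (forAll .set compareSymbol : ScanProg).Does
      (Comparison.mem v S ⟨true, false, u, [], []⟩ (flat p))
      ((flat p).length * (4 * u.length + 10 + 3) + 1)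
      (Comparison.mem v S ⟨true, decide (u ∈ p), u, [], (flat p).reverse⟩ []) := by
  have h := Does.forAll_of_invariant (Γ := ScanStack.Alphabet) (k := .set) (P := compareSymbol)
    (Comparison.mem v S) Comparison.next (fun x _ => x.cur.length + x.cur'.length = u.length)
    (fun _ _ => rfl) (fun _ _ _ => funext fun k => by cases k <;> rfl) (fun _ _ _ => rfl)
    (fun x a _ h => (x.length_next a).trans h)
    (fun x a l h => h ▸ does_compareSymbol v S x a l) ⟨true, false, u, [], []⟩ (flat p) rfl
  rwa [Comparison.foldl_next_flat p _ rfl rfl, Bool.false_or, List.append_nil] at h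

/-- Test whether the word `cur` is in the list `set`. -/
noncomputable def testMember : ScanProg :=
  (assign fun v => { v with eq := true, found := false }).seq <|
    (forAll .set compareSymbol).seq <|
      (RegProgram.move .set' .set id).seq (RegProgram.clear .cur)

theorem does_testMember (v : ScanVars) (S : ScanStacks) (p : List (List Bool))
    (h_set : S .set = flat p) (h_set' : S .set' = []) (h_cur' : S .cur' = []) :
    testMember.Does (v, S) (4 * ((S .cur).length + (flat p).length + 3) ^ 2)
      ({ v with eq := true, found := decide (S .cur ∈ p) }, update S .cur []) := by
  have h_assign := Does.assign (sub := (Empty.elim : Empty → FinTM2))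
    (fun v : ScanVars => { v with eq := true, found := false }) (v, S)
  have h_start : ({ v with eq := true, found := false }, S) =
      Comparison.mem v S ⟨true, false, S .cur, [], []⟩ (flat p) :=
    Prod.ext rfl (funext fun k => by cases k <;> first | rfl | assumption)
  rw [h_start] at h_assign
  refine (h_assign.seq ((does_forAll_compareSymbol v S (S .cur) p).seq
    ((Does.move (Γ := ScanStack.Alphabet) (k := .set') (k' := .set) (by decide) id _).seq
      (Does.clear (Γ := ScanStack.Alphabet) (k := .cur) _)))).congr
        (Prod.ext rfl (funext fun k => ?_)) ?_
  · cases k <;> first | rfl | simp [Comparison.mem, h_set, h_set', h_cur']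
  · change 1 + ((flat p).length * (4 * (S .cur).length + 10 + 3) + 1 +
      ((flat p).reverse.length * 4 + 1 + ((S .cur).length * 4 + 1))) ≤ _
    rw [List.length_reverse]
    nlinarith [Nat.zero_le ((S .cur).length ^ 2), Nat.zero_le ((flat p).length ^ 2)]

/-! #### Scanning -/

/-- The memory during a scan. -/
def Scan.mem (S : ScanStacks) (s : Scan) : ScanMem :=
  ({ mode := s.mode, ok := s.ok, sel := s.sel, good := s.good }, fun
    | .out => s.out
    | .set => flat s.prod
    | .set' => []
    | .cur => s.cur
    | .cur' => []
    | .lhs => s.lhs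
    | .depth => List.replicate s.depth ()
    | .idx => List.replicate s.idx ()
    | .idx' => []
    | k => S k)

/-- Change the mode of the scan. -/
noncomputable def setMode (m : Mode) : ScanProg := assign fun v => { v with mode := m }

/-- Write the number `idx` as the name of a local variable. -/
noncomputable def emitIdx : ScanProg :=
  (forAll .idx fun _ => (push .idx' ()).seq (push .out (.bit true))).seq <|
    (RegProgram.move .idx' .idx id).seq (push .out (.bit false))

/-- Close a parenthesis of a guard, and finish the rule if it is the outermost one. -/
noncomputable def closeParen (sel : Bool) : ScanProg :=
  (push .out .rpar).seq <| pop .depth fun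
    | some _ => skip
    | none => (push .idx ()).seq ((pushList .out (guardSuffix sel)).seq (setMode .top))

/-- Declare the left-hand side of the present rule productive if `ok` holds. -/
noncomputable def commitLhs : Bool → ScanProg
  | true => ((push .set none).seq (RegProgram.move .lhs .set some)).seq (setMode .gstart)
  | false => (RegProgram.clear .lhs).seq (setMode .gstart)

/-- Test whether the word `cur` is in the list `set`, and change the variables accordingly. -/
noncomputable def testMemberThen (f : ScanVars → ScanVars) : ScanProg := testMember.seq (assign f)

/-- The program for an action. -/
noncomputable def Action.prog (ok sel : Bool) : Action → ScanProg
  | .goto m => setMode m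
  | .collect b => push .cur b
  | .checkStart => testMemberThen fun v =>
      { v with mode := .top, good := v.found, eq := false, found := false }
  | .beginRule b => (assign fun v => { v with mode := .lhs, ok := b, sel := b }).seq
      (pushList .out (guardPrefix b))
  | .saveLhs => (RegProgram.move .cur .lhs id).seq (setMode .rhs)
  | .commit => commitLhs ok
  | .checkSym => testMemberThen fun v =>
      { v with mode := .rhs, ok := v.ok && v.found, eq := false, found := false }
  | .dropSym => (RegProgram.clear .cur).seq (setMode .rhs)
  | .openGuard => (push .out .lpar).seq (setMode .guard)
  | .emit t => push .out t
  | .nest => (push .out .lpar).seq (push .depth ())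
  | .unnest => closeParen sel
  | .emitLoc => (push .out .loc).seq emitIdx

theorem foldl_cons_cons_const {α β : Type*} (b : β) (l l₁ : List α) (l₂ : List β) :
    l.foldl (fun x a => (a :: x.1, b :: x.2)) (l₁, l₂) =
      (l.reverse ++ l₁, List.replicate l.length b ++ l₂) := by
  induction l generalizing l₁ l₂ with
  | nil => rfl
  | cons a l ih => simp [ih, List.replicate_succ']

theorem does_copyIdx (v : ScanVars) (S : ScanStacks) (h_idx' : S .idx' = []) :
    (forAll .idx fun _ => (push .idx' ()).seq (push .out (.bit true)) : ScanProg).Does (v, S)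
      ((S .idx).length * 5 + 1)
      (v, update (update (update S .idx []) .idx' (S .idx).reverse) .out
        (List.replicate (S .idx).length (.bit true) ++ S .out)) := by
  have h := Does.forAll (Γ := ScanStack.Alphabet) (τ := ScanVars)
    (sub := (Empty.elim : Empty → FinTM2)) (k := .idx) (T := 1 + 1)
    (P := fun _ => (push .idx' ()).seq (push .out (.bit true)))
    (fun (x : List Unit × List Tok) l =>
      (v, update (update (update S .idx l) .idx' x.1) .out x.2))
    (fun x a => (a :: x.1, Tok.bit true :: x.2)) (fun _ _ => rfl)
    (fun _ _ _ => funext fun k => by cases k <;> rfl) (fun _ _ _ => rfl)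
    (fun x a l => ((Does.push _ _ _).seq (Does.push _ _ _)).congr
      (Prod.ext rfl (funext fun k => by cases k <;> rfl)) le_rfl)
    ([], S .out) (S .idx)
  rw [foldl_cons_cons_const, List.append_nil] at h
  convert h using 2
  simp [← h_idx']

theorem does_emitIdx (S : ScanStacks) (s : Scan) :
    emitIdx.Does (s.mem S) (9 * s.idx + 3)
      (({ s with out := .bit false :: (List.replicate s.idx (.bit true) ++ s.out) } : Scan).mem
        S) := by
  refine ((does_copyIdx _ _ rfl).seq
    ((Does.move (Γ := ScanStack.Alphabet) (k := .idx') (k' := .idx) (by decide) id _).seq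
      (Does.push _ _ _))).congr (Prod.ext rfl (funext fun k => ?_)) ?_
  · cases k <;> first | rfl | simp [Scan.mem]
  · change (List.replicate s.idx ()).length * 5 + 1 +
      ((List.replicate s.idx ()).reverse.length * 4 + 1 + 1) ≤ _
    rw [List.length_reverse, List.length_replicate]
    omega

theorem does_closeParen (S : ScanStacks) (s : Scan) :
    (closeParen s.sel).Does (s.mem S) 12 ((s.apply .unnest).mem S) := by
  have h_suffix : ∀ b, (guardSuffix b).length ≤ 1 := by decide
  refine ((Does.push _ _ _).seq
    (Does.pop (t := 8) (List.replicate s.depth ()) rfl ?_)).mono_time le_rfl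
  rcases h_depth : s.depth with _ | d
  · refine ((Does.push _ _ _).seq ((Does.pushList _ _ _).seq (Does.assign _ _))).congr
      (Prod.ext (by simp [Scan.mem, Scan.apply, h_depth]) (funext fun k => ?_))
      (by have := h_suffix s.sel; omega)
    cases k <;> simp [Scan.mem, Scan.apply, h_depth, List.replicate_succ]
  · refine (Does.skip _).congr
      (Prod.ext (by simp [Scan.mem, Scan.apply, h_depth]) (funext fun k => ?_)) (by omega)
    cases k <;> simp [Scan.mem, Scan.apply, h_depth, List.replicate_succ]

theorem does_commitLhs (S : ScanStacks) (s : Scan) :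
    (commitLhs s.ok).Does (s.mem S) (4 * s.lhs.length + 3) ((s.apply .commit).mem S) := by
  cases h_ok : s.ok
  · refine ((Does.clear (Γ := ScanStack.Alphabet) (k := .lhs) _).seq (Does.assign _ _)).congr
      (Prod.ext (by simp [Scan.mem, Scan.apply]) (funext fun k => ?_)) ?_
    · cases k <;> first | rfl | simp [Scan.mem, Scan.apply, h_ok]
    · change s.lhs.length * 4 + 1 + 1 ≤ _
      omega
  · refine (((Does.push _ _ _).seq (Does.move (Γ := ScanStack.Alphabet) (k := .lhs) (k' := .set)
      (by decide) some _)).seq (Does.assign _ _)).congr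
      (Prod.ext (by simp [Scan.mem, Scan.apply]) (funext fun k => ?_)) ?_
    · cases k <;> first | rfl | simp [Scan.mem, Scan.apply, h_ok, flat]
    · change 1 + (s.lhs.length * 4 + 1) + 1 ≤ _
      omega

theorem does_testMemberThen (S : ScanStacks) (s : Scan) (f : ScanVars → ScanVars) :
    (testMemberThen f).Does (s.mem S) (4 * (s.weight + 4) ^ 2)
      (f { (s.mem S).1 with eq := true, found := decide (s.cur ∈ s.prod) },
        update (s.mem S).2 .cur []) := by
  refine ((does_testMember _ (s.mem S).2 s.prod rfl rfl rfl).seq (Does.assign _ _)).congr rfl ?_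
  have h_length : s.cur.length + (flat s.prod).length ≤ s.weight := by
    rw [length_flat, Scan.weight]
    omega
  calc 4 * (s.cur.length + (flat s.prod).length + 3) ^ 2 + 1
      ≤ 4 * (s.weight + 3) ^ 2 + 1 := by gcongr
    _ ≤ 4 * (s.weight + 4) ^ 2 := by nlinarith

theorem does_action (S : ScanStacks) (s : Scan) (A : Action) :
    (A.prog s.ok s.sel).Does (s.mem S) (4 * (s.weight + 4) ^ 2) ((s.apply A).mem S) := by
  have h_prefix : ∀ b, (guardPrefix b).length ≤ 7 := by decide
  have h_linear : 32 * s.weight + 64 ≤ 4 * (s.weight + 4) ^ 2 := by nlinarith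
  have h_weight : s.cur.length + s.lhs.length + s.idx ≤ s.weight := by
    unfold Scan.weight
    omega
  generalize h_time : 4 * (s.weight + 4) ^ 2 = T at h_linear ⊢
  cases A with
  | goto m => exact (Does.assign _ _).congr rfl (by omega)
  | collect b | emit t =>
    exact (Does.push _ _ _).congr (Prod.ext rfl (funext fun k => by cases k <;> rfl)) (by omega)
  | checkStart | checkSym =>
    exact (does_testMemberThen S s _).congr
      (Prod.ext rfl (funext fun k => by cases k <;> rfl)) h_time.le
  | beginRule b =>
    exact ((Does.assign _ _).seq (Does.pushList _ _ _)).congr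
      (Prod.ext rfl (funext fun k => by cases k <;> rfl)) (by have := h_prefix b; omega)
  | saveLhs =>
    refine ((Does.move (Γ := ScanStack.Alphabet) (k := .cur) (k' := .lhs) (by decide) id _).seq
      (Does.assign _ _)).congr (Prod.ext rfl (funext fun k => ?_))
        (by change s.cur.length * 4 + 1 + 1 ≤ T; omega)
    cases k <;> first | rfl | simp [Scan.mem, Scan.apply]
  | commit => exact (does_commitLhs S s).mono_time (by omega)
  | dropSym =>
    exact ((Does.clear (Γ := ScanStack.Alphabet) (k := .cur) _).seq (Does.assign _ _)).congr
      (Prod.ext rfl (funext fun k => by cases k <;> rfl))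
        (by change s.cur.length * 4 + 1 + 1 ≤ T; omega)
  | openGuard =>
    exact ((Does.push _ _ _).seq (Does.assign _ _)).congr
      (Prod.ext rfl (funext fun k => by cases k <;> rfl)) (by omega)
  | nest =>
    exact ((Does.push _ _ _).seq (Does.push _ _ _)).congr
      (Prod.ext rfl (funext fun k => by cases k <;> rfl)) (by omega)
  | unnest => exact (does_closeParen S s).mono_time (by omega)
  | emitLoc =>
    have h_loc := Does.push (sub := (Empty.elim : Empty → FinTM2)) .out .loc (s.mem S)
    rw [show ((s.mem S).1, update (s.mem S).2 .out (.loc :: (s.mem S).2 .out)) =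
      ({ s with out := .loc :: s.out } : Scan).mem S from
        Prod.ext rfl (funext fun k => by cases k <;> rfl)] at h_loc
    exact (h_loc.seq (does_emitIdx S _)).congr rfl (by dsimp only; omega)

open Complexity

/-- The contents of the stacks outside a scan: the part `a` of the grammar that remains to be read,
the reversed part `a'` that has been read, and the counter `c` of the scans that remain. -/
def inputStacks (a a' : List (Tok × Bool)) (c : List Unit) : ScanStacks
  | .ann => a
  | .ann' => a'
  | .cnt => c
  | _ => []

/-- Read one annotated token. -/
noncomputable def scanToken (t : Tok × Bool) : ScanProg :=
  (push .ann' t).seq (switch fun v => (action t.2 v.mode t.1).prog v.ok v.sel)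

theorem does_scanToken (s : Scan) (t : Tok × Bool) (a a' : List (Tok × Bool)) (c : List Unit) :
    (scanToken t).Does (s.mem (inputStacks a a' c)) (4 * (s.weight + 4) ^ 2 + 2)
      ((s.next t).mem (inputStacks a (t :: a') c)) := by
  have h_push : (push .ann' t : ScanProg).Does (s.mem (inputStacks a a' c)) 1
      (s.mem (inputStacks a (t :: a') c)) :=
    (Does.push _ _ _).congr (Prod.ext rfl (funext fun k => by cases k <;> rfl)) le_rfl
  exact (h_push.seq (DoesWithin.switch (does_action ..))).mono_time (by omega)

theorem foldl_next_cons (l a' : List (Tok × Bool)) (s : Scan) :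
    l.foldl (fun x t => (x.1.next t, t :: x.2)) (s, a') =
      (l.foldl Scan.next s, l.reverse ++ a') := by
  induction l generalizing s a' with
  | nil => rfl
  | cons t l ih => simp [ih]

theorem does_forAll_scanToken (s : Scan) (a : List (Tok × Bool)) (c : List Unit) :
    (forAll .ann scanToken : ScanProg).Does (s.mem (inputStacks a [] c))
      (a.length * (4 * (s.weight + a.length + 4) ^ 2 + 2 + 3) + 1)
      ((a.foldl Scan.next s).mem (inputStacks [] a.reverse c)) := by
  have h := Does.forAll_of_invariant (Γ := ScanStack.Alphabet) (k := .ann) (P := scanToken)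
    (T := 4 * (s.weight + a.length + 4) ^ 2 + 2)
    (fun (x : Scan × List (Tok × Bool)) l => x.1.mem (inputStacks l x.2 c))
    (fun x t => (x.1.next t, t :: x.2))
    (fun x l => x.1.weight + l.length ≤ s.weight + a.length)
    (fun _ _ => rfl) (fun _ _ _ => funext fun k => by cases k <;> rfl) (fun _ _ _ => rfl)
    (fun x t l h => by
      have := x.1.weight_next t
      rw [List.length_cons] at h
      dsimp only
      omega)
    (fun x t l h => (does_scanToken x.1 t l x.2 c).mono_time (by gcongr; omega))
    (s, []) a le_rfl
  rwa [foldl_next_cons, List.append_nil] at h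

/-- Move `ann'` back to `ann`. -/
noncomputable def restoreAnn : ScanProg := RegProgram.move .ann' .ann id

theorem does_restoreAnn (s : Scan) (a : List (Tok × Bool)) (c : List Unit) :
    restoreAnn.Does (s.mem (inputStacks [] a.reverse c)) (a.length * 4 + 1)
      (s.mem (inputStacks a [] c)) := by
  refine (Does.move (Γ := ScanStack.Alphabet) (k := .ann') (k' := .ann) (by decide) id _).congr
    (Prod.ext rfl (funext fun k => ?_)) ?_
  · cases k <;> first | rfl | simp [Scan.mem, inputStacks]
  · change a.reverse.length * 4 + 1 ≤ _
    rw [List.length_reverse]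

/-- Clear the data of a scan, except the output and the list of productive nonterminals. -/
noncomputable def resetScan : ScanProg :=
  (assign fun _ => {}).seq <| (RegProgram.clear .cur).seq <| (RegProgram.clear .lhs).seq <|
    (RegProgram.clear .depth).seq (RegProgram.clear .idx)

theorem does_resetScan (S : ScanStacks) (s : Scan) :
    resetScan.Does (s.mem S) (4 * s.weight + 5)
      (({ prod := s.prod, out := s.out } : Scan).mem S) := by
  refine ((Does.assign _ _).seq ((Does.clear (Γ := ScanStack.Alphabet) (k := .cur) _).seq
    ((Does.clear (Γ := ScanStack.Alphabet) (k := .lhs) _).seq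
      ((Does.clear (Γ := ScanStack.Alphabet) (k := .depth) _).seq
        (Does.clear (Γ := ScanStack.Alphabet) (k := .idx) _))))).congr
    (Prod.ext rfl (funext fun k => by cases k <;> rfl)) ?_
  change 1 + (s.cur.length * 4 + 1 + (s.lhs.length * 4 + 1 +
    ((List.replicate s.depth ()).length * 4 + 1 +
      ((List.replicate s.idx ()).length * 4 + 1)))) ≤ _
  simp only [List.length_replicate, Scan.weight]
  omega

/-- Begin the output. -/
noncomputable def beginOut : ScanProg :=
  (RegProgram.clear .out).seq (pushList .out [.lpar, .imp])

theorem does_beginOut (S : ScanStacks) (s : Scan) :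
    beginOut.Does (({ prod := s.prod, out := s.out } : Scan).mem S) (s.out.length * 4 + 1 + 3)
      ((Scan.init s.prod).mem S) :=
  ((Does.clear (Γ := ScanStack.Alphabet) (k := .out) _).seq (Does.pushList _ _ _)).congr
    (Prod.ext rfl (funext fun k => by cases k <;> rfl)) le_rfl

/-- One scan. -/
noncomputable def scanPass : ScanProg :=
  resetScan.seq <| beginOut.seq <| (forAll .ann scanToken).seq restoreAnn

/-- The time that a scan takes, for an input of length `n`, when the weight is at most `W` and the
length of the output is at most `O`. -/
def passTime (n W O : ℕ) : ℕ := n * (4 * (W + n + 4) ^ 2 + 9) + 4 * W + 4 * O + 11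

theorem does_scanPass (s : Scan) (a : List (Tok × Bool)) (c : List Unit) :
    scanPass.Does (s.mem (inputStacks a [] c)) (passTime a.length s.weight s.out.length)
      ((s.pass a).mem (inputStacks a [] c)) := by
  refine ((does_resetScan _ s).seq ((does_beginOut _ s).seq
    ((does_forAll_scanToken (Scan.init s.prod) a c).seq (does_restoreAnn _ a c)))).mono_time ?_
  calc _ ≤ 4 * s.weight + 5 + (s.out.length * 4 + 1 + 3 +
        (a.length * (4 * (s.weight + a.length + 4) ^ 2 + 2 + 3) + 1 + (a.length * 4 + 1))) := by
        have := s.weight_init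
        gcongr
    _ = passTime a.length s.weight s.out.length := by
        unfold passTime
        ring

/-- Put one symbol on `cnt` for each symbol of `ann`. -/
noncomputable def countAnn : ScanProg :=
  (forAll .ann fun t => (push .ann' t).seq (push .cnt ())).seq restoreAnn

theorem does_countAnn (s : Scan) (a : List (Tok × Bool)) :
    countAnn.Does (s.mem (inputStacks a [] [])) (9 * a.length + 2)
      (s.mem (inputStacks a [] (List.replicate a.length ()))) := by
  have h_loop := Does.forAll (Γ := ScanStack.Alphabet) (τ := ScanVars)
    (sub := (Empty.elim : Empty → FinTM2)) (k := .ann)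
    (P := fun t => (push .ann' t).seq (push .cnt ())) (T := 1 + 1)
    (fun (x : List (Tok × Bool) × List Unit) l => s.mem (inputStacks l x.1 x.2))
    (fun x t => (t :: x.1, () :: x.2))
    (fun _ _ => rfl) (fun _ _ _ => funext fun k => by cases k <;> rfl) (fun _ _ _ => rfl)
    (fun x t l => ((Does.push _ _ _).seq (Does.push _ _ _)).congr
      (Prod.ext rfl (funext fun k => by cases k <;> rfl)) le_rfl) ([], []) a
  rw [foldl_cons_cons_const, List.append_nil, List.append_nil] at h_loop
  exact (h_loop.seq (does_restoreAnn s a _)).mono_time (by omega)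

theorem does_forAll_scanPass (a : List (Tok × Bool)) :
    (forAll .cnt fun _ => scanPass : ScanProg).Does
      (({} : Scan).mem (inputStacks a [] (List.replicate a.length ())))
      (a.length * (passTime a.length (a.length * a.length) (outBound a.length) + 3) + 1)
      ((finalScan a).mem (inputStacks a [] [])) := by
  have h := Does.forAll_of_invariant (Γ := ScanStack.Alphabet) (τ := ScanVars) (k := .cnt)
    (P := fun _ => scanPass)
    (T := passTime a.length (a.length * a.length) (outBound a.length))
    (fun (s : Scan) l => s.mem (inputStacks a [] l)) (fun s _ => s.pass a)
    (fun s l => s.weight + l.length * a.length ≤ a.length * a.length ∧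
      s.out.length ≤ outBound a.length)
    (fun _ _ => rfl)
    (fun x t l => funext fun k => by cases k <;> rfl) (fun _ _ _ => rfl)
    (fun s t l h => by
      have h_weight := s.weight_pass a
      rw [List.length_cons, Nat.succ_mul] at h
      exact ⟨by omega, (s.length_out_pass a).trans
        (Nat.add_le_add_left (Nat.mul_le_mul_left _ (by omega)) _)⟩)
    (fun s t l h => (does_scanPass s a l).mono_time (by
      have h_weight : s.weight ≤ a.length * a.length := (Nat.le_add_right _ _).trans h.1
      have h_out := h.2
      unfold passTime
      gcongr))
    {} (List.replicate a.length ()) (by simp [Scan.weight])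
  rwa [List.length_replicate, List.foldl_const, List.length_replicate] at h

/-- Replace the output by `Scan.formula`. -/
noncomputable def endOut : ScanProg := switch fun v =>
  if v.mode = .top ∧ v.good = true then
    (pushList .out [.lpar, .bot, .rpar]).seq <|
      (RegProgram.move .idx .out fun _ => .rpar).seq <|
        pushList .out [.lpar, .bot, .rpar, .rpar]
  else (RegProgram.clear .out).seq (RegProgram.clear .idx)

theorem does_endOut (S : ScanStacks) (s : Scan) :
    endOut.Does (s.mem S) (4 * s.out.length + 4 * s.idx + 11)
      (({ s with idx := 0, out := s.formula.reverse } : Scan).mem S) := by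
  refine (DoesWithin.switch (t := 4 * s.out.length + 4 * s.idx + 10) ?_).mono_time (by omega)
  change DoesWithin (if s.mode = .top ∧ s.good = true then _ else _) _ _ _ _
  unfold Scan.formula
  split_ifs with h
  · refine ((Does.pushList _ _ _).seq ((Does.move (Γ := ScanStack.Alphabet) (k := .idx)
      (k' := .out) (by decide) (fun _ => .rpar) _).seq (Does.pushList _ _ _))).congr
      (Prod.ext rfl (funext fun k => ?_)) ?_
    · cases k <;> first | rfl | simp [Scan.mem, closing]
    · change 4 + ((List.replicate s.idx ()).length * 4 + 1 + 5) ≤ _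
      rw [List.length_replicate]
      omega
  · refine ((Does.clear (Γ := ScanStack.Alphabet) (k := .out) _).seq
      (Does.clear (Γ := ScanStack.Alphabet) (k := .idx) _)).congr
      (Prod.ext rfl (funext fun k => by cases k <;> rfl)) ?_
    change s.out.length * 4 + 1 + ((List.replicate s.idx ()).length * 4 + 1) ≤ _
    rw [List.length_replicate]
    omega

/-- Clear all the stacks except the output, which becomes the result. -/
noncomputable def returnOut : ScanProg :=
  resetScan.seq <| (RegProgram.clear .set).seq <| (RegProgram.clear .ann).seq <|
    RegProgram.move .out .res id

theorem does_returnOut (s : Scan) (a : List (Tok × Bool)) :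
    returnOut.Does (s.mem (inputStacks a [] []))
      (8 * s.weight + 4 * a.length + 4 * s.out.length + 8)
      ({}, single ScanStack.res s.out.reverse) := by
  refine ((does_resetScan _ s).seq ((Does.clear (Γ := ScanStack.Alphabet) (k := .set) _).seq
    ((Does.clear (Γ := ScanStack.Alphabet) (k := .ann) _).seq
      (Does.move (Γ := ScanStack.Alphabet) (k := .out) (k' := .res) (by decide) id _)))).congr
    (Prod.ext rfl (funext fun k => ?_)) ?_
  · cases k <;> first | rfl | simp [Scan.mem, inputStacks]
  · change 4 * s.weight + 5 + ((flat s.prod).length * 4 + 1 + (a.length * 4 + 1 +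
      (s.out.length * 4 + 1))) ≤ _
    rw [length_flat]
    unfold Scan.weight
    omega

/-- Compute `reduction`. -/
noncomputable def reduceProg : ScanProg :=
  countAnn.seq <| (forAll .cnt fun _ => scanPass).seq <| endOut.seq returnOut

/-- The time for computing `reduction` on an input of length `n`. -/
def reduceTime (n : ℕ) : ℕ :=
  n * (passTime n (n * n) (outBound n) + 16) + 8 * outBound n + 16 * (n * n) + 50

theorem Scan.length_formula_le (s : Scan) : s.formula.length ≤ s.out.length + s.idx + 7 := by
  unfold Scan.formula
  split_ifs
  · simp only [closing, List.length_append, List.length_reverse, List.length_replicate,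
      List.length_cons, List.length_nil]
    omega
  · exact Nat.zero_le _

theorem does_reduceProg (a : List (Tok × Bool)) :
    reduceProg.Does ({}, single ScanStack.ann a) (reduceTime a.length)
      ({}, single ScanStack.res (reduction a)) := by
  have h_start : (({}, single ScanStack.ann a) : ScanMem) =
      ({} : Scan).mem (inputStacks a [] []) :=
    Prod.ext rfl (funext fun k => by cases k <;> rfl)
  have h_return := does_returnOut
    { finalScan a with idx := 0, out := (finalScan a).formula.reverse } a
  dsimp only at h_return
  rw [List.reverse_reverse, List.length_reverse] at h_return
  rw [h_start]
  refine ((does_countAnn {} a).seq ((does_forAll_scanPass a).seq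
    ((does_endOut _ (finalScan a)).seq h_return))).mono_time ?_
  have h_weight : (finalScan a).weight ≤ a.length * a.length := Scan.weight_iterate_pass a _
  have h_out := length_out_finalScan a
  have h_formula := (finalScan a).length_formula_le
  unfold reduceTime
  unfold Scan.weight at h_weight ⊢
  dsimp only
  nlinarith

theorem polyBounded_outBound : PolyBounded outBound :=
  (PolyBounded.const 2).add
    (.mul .id (((PolyBounded.mul .id .id).add .id).add (.const 7)))

theorem polyBounded_reduceTime : PolyBounded reduceTime := by
  unfold reduceTime passTime
  repeat' first
    | exact .const _
    | exact .id
    | exact polyBounded_outBound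
    | apply PolyBounded.add
    | apply PolyBounded.mul

theorem polyTime_reduction : Nonempty (TM2ComputableInPolyTime id id reduction) :=
  polyTime_of_computesOn polyBounded_reduceTime fun a => (does_reduceProg a).computesOn

end ParametricGrammar

theorem mainTheorem5 {L : FirstOrder.Language.{u, v}} (D : Type w) [Nonempty D] [L.Structure D]
    (c : ParametricGrammar.SymbolCoding L) :
    (ParametricGrammar.satProblem c D ∈ Complexity.NP ParametricGrammar.Tok →
      ParametricGrammar.nonemptinessProblem c D ∈ Complexity.NP ParametricGrammar.Tok) ∧
    (ParametricGrammar.satProblem c D ∈ Complexity.PSPACE ParametricGrammar.Tok →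
      ParametricGrammar.nonemptinessProblem c D ∈ Complexity.PSPACE ParametricGrammar.Tok) := by
  rw [ParametricGrammar.nonemptinessProblem_eq_markedProjection]
  exact ⟨fun h => Complexity.markedProjection_mem_NP
      (Complexity.preimage_mem_NP h ParametricGrammar.polyTime_reduction),
    fun h => Complexity.markedProjection_mem_PSPACE
      (Complexity.preimage_mem_PSPACE h ParametricGrammar.polyTime_reduction)⟩
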